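/- Let $n\ge 0$ and let $(G'=G\times\mathbb R^n,\ g'=b+g_E,\ J_L)$ be a Samelson space: $G$ is a compact, connected, simply connected semisimple Lie group, $b$ is a bi-invariant Riemannian metric on $G$, $g_E$ is the Euclidean metric on $\mathbb R^n$, and $J_L$ is a complex structure on $G'$ that is compatible with $g'$ and invariant under the left translations of the Lie group $G\times\mathbb R^n$. Let $(K,g,J)$ be a compact Kähler manifold, let $\psi:\mathbb Z^n\to\mathrm{Isom}_{hol}(K)$ be a group homomorphism into the group of holomorphic isometries of $(K,g,J)$, and let $\rho:\mathbb Z^n\to\mathrm{Isom}(G,b)$ be a group homomorphism such that for every $m\in\mathbb Z^n$ the diffeomorphism $(q,t)\mapsto(\rho(m)q,\,t+m)$ of $G'$ is a holomorphic isometry of $(g',J_L)$. Then $\mathbb Z^n$ acts freely and properly discontinuously on $K\times G\times\mathbb R^n$ by $m\cdot(p,q,t)=(\psi(m)p,\ \rho(m)q,\ t+m)$. The quotient $M_{\psi,\rho}=(K\times G\times\mathbb R^n)/\mathbb Z^n$ is a (Hausdorff, second countable) smooth manifold for which the projection is a local diffeomorphism. The product Hermitian structure $(J\times J_L,\ g+g')$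 descends to a Hermitian structure $(I,h)$ on $M_{\psi,\rho}$, and $(I,h)$ is SKT, i.e. $dd^c\omega=0$, where $\omega=h(I\cdot,\cdot)$ and $d^c\omega(X,Y,Z)=-d\omega(IX,IY,IZ)$. If moreover $(K,g)$ is Ricci-flat, then $(I,h)$ is CYT: the Ricci form $\rho^B(X,Y)=\tfrac12\sum_i h(R^B(X,Y)Ie_i,e_i)$ ($\{e_i\}$ an orthonormal basis of the tangent space) vanishes, where $R^B$ is the curvature of the Bismut connection, that is, of the unique connection $\nabla^B$ with $\nabla^B h=0$, $\nabla^B I=0$ and totally skew-symmetric torsion. If $(K,g)$ is Ricci-flat and not flat, then in addition the Bismut connection of $(I,h)$ is not flat. -/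

import Mathlib

open Bundle Module VectorField
open scoped Manifold ContDiff Topology

noncomputable section

namespace Bismut

/-! ### Vector fields and exterior derivatives -/

section Manifolds

variable {E : Type*} [NormedAddCommGroup E] [NormedSpace ℝ E]
  {H : Type*} [TopologicalSpace H] (I : ModelWithCorners ℝ E H)
  {M : Type*} [TopologicalSpace M] [ChartedSpace H M]

/-- `X` is a smooth vector field on `M`. -/
def IsSmoothField [IsManifold I ∞ M] (X : Π x : M, TangentSpace I x) : Prop :=
  ContMDiff I I.tangent ∞ (fun x ↦ (⟨x, X x⟩ : TangentBundle I M))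

/-- The exterior derivative of a `2`-form, as an operator on vector fields:
`dω(X,Y,Z) = X ω(Y,Z) - Y ω(X,Z) + Z ω(X,Y) - ω([X,Y],Z) + ω([X,Z],Y) - ω([Y,Z],X)`. -/
def extDerivTwo
    (w : (Π x : M, TangentSpace I x) → (Π x : M, TangentSpace I x) → M → ℝ)
    (X Y Z : Π x : M, TangentSpace I x) (x : M) : ℝ :=
  mvfderiv I (w Y Z) x (X x) - mvfderiv I (w X Z) x (Y x) + mvfderiv I (w X Y) x (Z x)
    - w (mlieBracket I X Y) Z x + w (mlieBracket I X Z) Y x - w (mlieBracket I Y Z) X x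

/-- The exterior derivative of a `3`-form, as an operator on vector fields:
`dη(X₀,…,X₃) = ∑ᵢ (-1)ⁱ Xᵢ η(…,X̂ᵢ,…) + ∑_{i<j} (-1)^{i+j} η([Xᵢ,Xⱼ],…,X̂ᵢ,…,X̂ⱼ,…)`. -/
def extDerivThree
    (η : (Π x : M, TangentSpace I x) → (Π x : M, TangentSpace I x) →
      (Π x : M, TangentSpace I x) → M → ℝ)
    (X₀ X₁ X₂ X₃ : Π x : M, TangentSpace I x) (x : M) : ℝ :=
  mvfderiv I (η X₁ X₂ X₃) x (X₀ x) - mvfderiv I (η X₀ X₂ X₃) x (X₁ x)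
    + mvfderiv I (η X₀ X₁ X₃) x (X₂ x) - mvfderiv I (η X₀ X₁ X₂) x (X₃ x)
    - η (mlieBracket I X₀ X₁) X₂ X₃ x + η (mlieBracket I X₀ X₂) X₁ X₃ x
    - η (mlieBracket I X₀ X₃) X₁ X₂ x - η (mlieBracket I X₁ X₂) X₀ X₃ x
    + η (mlieBracket I X₁ X₃) X₀ X₂ x - η (mlieBracket I X₂ X₃) X₀ X₁ x

end Manifolds

/-! ### Riemannian metrics and connections -/

section Riemannian

variable {E : Type*} [NormedAddCommGroup E] [NormedSpace ℝ E]
  {H : Type*} [TopologicalSpace H] {I : ModelWithCorners ℝ E H}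
  {M : Type*} [TopologicalSpace M] [ChartedSpace H M]

theorem mfderiv_perm_mul {f k : Equiv.Perm M} (hf : ContMDiff I I ∞ f) (hk : ContMDiff I I ∞ k)
    (x : M) : mfderiv I I (⇑(f * k)) x = (mfderiv I I f (k x)).comp (mfderiv I I k x) :=
  mfderiv_comp x ((hf (k x)).mdifferentiableAt (by simp)) ((hk x).mdifferentiableAt (by simp))

theorem mfderiv_perm_symm {f : Equiv.Perm M} (hf : ContMDiff I I ∞ f)
    (hf' : ContMDiff I I ∞ f.symm) (x : M) (w : E) :
    (mfderiv I I f (f.symm x) (mfderiv I I f.symm x w) : E) = w := by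
  have hc : mfderiv I I (⇑f ∘ ⇑f.symm) x =
      (mfderiv I I f (f.symm x)).comp (mfderiv I I f.symm x) :=
    mfderiv_comp x ((hf _).mdifferentiableAt (by simp)) ((hf' x).mdifferentiableAt (by simp))
  have h1 := congrArg (fun L : E →L[ℝ] E ↦ L w) hc
  have h2 : (mfderiv I I (⇑f ∘ ⇑f.symm) x : E →L[ℝ] E) = ContinuousLinearMap.id ℝ E := by
    rw [f.self_comp_symm]; exact mfderiv_id
  exact h1.symm.trans (congrArg (fun L : E →L[ℝ] E ↦ L w) h2)

variable [IsManifold I ∞ M]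

variable (I M) in
/-- Smooth Riemannian metrics on the manifold `M`. -/
abbrev SmoothMetric : Type _ := ContMDiffRiemannianMetric I ∞ E (fun x : M ↦ TangentSpace I x)

variable (I M) in
/-- Affine connections on `M`; `nabla Y x (X x)` is `(∇_X Y)(x)`. -/
abbrev AffineConnection : Type _ := CovariantDerivative I E (TangentSpace I : M → Type _)

/-- The curvature `R(X,Y)Z = ∇_X ∇_Y Z - ∇_Y ∇_X Z - ∇_{[X,Y]} Z`. -/
def curvature (nabla : AffineConnection I M) (X Y Z : Π x : M, TangentSpace I x) (x : M) :
    TangentSpace I x :=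
  nabla (fun y ↦ nabla Z y (Y y)) x (X x) - nabla (fun y ↦ nabla Z y (X y)) x (Y x)
    - nabla Z x (mlieBracket I X Y x)

/-- The connection is flat. -/
def IsFlatConnection (nabla : AffineConnection I M) : Prop :=
  ∀ X Y Z : Π x : M, TangentSpace I x,
    IsSmoothField I X → IsSmoothField I Y → IsSmoothField I Z →
    ∀ x, curvature nabla X Y Z x = 0

/-- `∇ g = 0`. -/
def IsMetricConnection (g : SmoothMetric I M) (nabla : AffineConnection I M) : Prop :=
  ∀ Y Z : Π x : M, TangentSpace I x, IsSmoothField I Y → IsSmoothField I Z →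
    ∀ (x : M) (u : TangentSpace I x),
      mvfderiv I (fun y ↦ g.inner y (Y y) (Z y)) x u =
        g.inner x (nabla Y x u) (Z x) + g.inner x (Y x) (nabla Z x u)

/-- Smooth vector fields `e₁, …, e_d`, with `d = dim M`, whose values at the point `x` form an
orthonormal basis of the tangent space there. -/
def IsFrameAt (g : SmoothMetric I M) (x : M)
    (e : Fin (finrank ℝ E) → Π x : M, TangentSpace I x) : Prop :=
  (∀ i, IsSmoothField I (e i)) ∧
    ∀ i j, g.inner x (e i x) (e j x) = if i = j then 1 else 0

/-- The Levi-Civita connection: metric and torsion free. -/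
def IsLeviCivita [FiniteDimensional ℝ E] (g : SmoothMetric I M) (nabla : AffineConnection I M) : Prop :=
  IsMetricConnection g nabla ∧
    ∀ (x : M) (u v : TangentSpace I x), nabla.torsion x u v = 0

/-- The Ricci tensor `Ric(Y,Z) = ∑ᵢ g(R(eᵢ,Y)Z, eᵢ)` of the Levi-Civita connection vanishes. -/
def IsRicciFlat [FiniteDimensional ℝ E] (g : SmoothMetric I M) : Prop :=
  ∃ nabla : AffineConnection I M, IsLeviCivita g nabla ∧
    ∀ (x : M) (e : Fin (finrank ℝ E) → Π x : M, TangentSpace I x), IsFrameAt g x e →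
      ∀ Y Z : Π x : M, TangentSpace I x, IsSmoothField I Y → IsSmoothField I Z →
        ∑ i, g.inner x (curvature nabla (e i) Y Z x) (e i x) = 0

/-- The Levi-Civita connection of `g` is flat. -/
def IsFlatMetric [FiniteDimensional ℝ E] (g : SmoothMetric I M) : Prop :=
  ∃ nabla : AffineConnection I M, IsLeviCivita g nabla ∧ IsFlatConnection nabla

/-- The group `Isom(M, g)` of Riemannian isometries: the diffeomorphisms `f` with `f^* g = g`. -/
def isometryGroup (g : SmoothMetric I M) : Subgroup (Equiv.Perm M) where
  carrier := {f | ContMDiff I I ∞ f ∧ ContMDiff I I ∞ f.symm ∧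
    ∀ (x : M) (u v : TangentSpace I x),
      g.inner (f x) (mfderiv I I f x u) (mfderiv I I f x v) = g.inner x u v}
  one_mem' := by
    refine ⟨contMDiff_id, contMDiff_id, fun x u v ↦ ?_⟩
    have h : mfderiv I I (⇑(1 : Equiv.Perm M)) x = ContinuousLinearMap.id ℝ (TangentSpace I x) :=
      mfderiv_id
    rw [h]; rfl
  mul_mem' := by
    rintro f k ⟨hf, hf', hf''⟩ ⟨hk, hk', hk''⟩
    refine ⟨hf.comp hk, hk'.comp hf', fun x u v ↦ ?_⟩
    rw [mfderiv_perm_mul hf hk]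
    exact (hf'' (k x) _ _).trans (hk'' x u v)
  inv_mem' := by
    rintro f ⟨hf, hf', hf''⟩
    refine ⟨hf', hf, fun x u v ↦ ?_⟩
    refine (hf'' (f.symm x) (mfderiv I I f.symm x u) (mfderiv I I f.symm x v)).symm.trans ?_
    have e : ∀ (y : M), y = x → ∀ a b a' b' : E, a = a' → b = b' →
        g.inner y a b = g.inner x a' b' := by
      rintro y rfl a b a' b' rfl rfl; rfl
    exact e _ (f.apply_symm_apply x) _ _ _ _ (mfderiv_perm_symm hf hf' x u)
      (mfderiv_perm_symm hf hf' x v)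

end Riemannian

/-! ### Hermitian structures -/

section Hermitian

variable {E : Type*} [NormedAddCommGroup E] [NormedSpace ℝ E]
  {H : Type*} [TopologicalSpace H] (I : ModelWithCorners ℝ E H)
  (M : Type*) [TopologicalSpace M] [ChartedSpace H M] [IsManifold I ∞ M]

/-- A Hermitian structure `(g, J)` on the smooth manifold `M`: a complex structure `J` (around each
point there are holomorphic coordinates, i.e. a local diffeomorphism `z` to `ℂᵐ` with
`dz ∘ J = i dz`, which forces `J` to be smooth) and a `J`-invariant Riemannian metric `g`. -/
structure HermitianStructure where
  metric : SmoothMetric I M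
  J : Π x : M, TangentSpace I x →L[ℝ] TangentSpace I x
  J_sq : ∀ (x : M) (u : TangentSpace I x), J x (J x u) = -u
  exists_coordinates : ∀ x : M, ∃ (m : ℕ) (z : M → (Fin m → ℂ)),
    IsLocalDiffeomorphAt I 𝓘(ℝ, Fin m → ℂ) ∞ z x ∧
    ∀ᶠ y in 𝓝 x, ∀ u : TangentSpace I y,
      mvfderiv I z y (J y u) = Complex.I • mvfderiv I z y u
  compatible : ∀ (x : M) (u v : TangentSpace I x),
    metric.inner x (J x u) (J x v) = metric.inner x u v

variable {I M}

namespace HermitianStructure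

variable (S : HermitianStructure I M)

/-- The vector field `JX`. -/
def applyJ (X : Π x : M, TangentSpace I x) : Π x : M, TangentSpace I x := fun x ↦ S.J x (X x)

/-- The fundamental form `ω(X,Y) = g(JX,Y)`. -/
def fundamentalForm (X Y : Π x : M, TangentSpace I x) (x : M) : ℝ :=
  S.metric.inner x (S.J x (X x)) (Y x)

/-- `d^c ω = -J dω`, i.e. `d^c ω(X,Y,Z) = -dω(JX,JY,JZ)`. -/
def dcFundamentalForm (X Y Z : Π x : M, TangentSpace I x) (x : M) : ℝ :=
  -extDerivTwo I S.fundamentalForm (S.applyJ X) (S.applyJ Y) (S.applyJ Z) x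

/-- The Kähler condition `dω = 0`. -/
def IsKahler : Prop :=
  ∀ X Y Z : Π x : M, TangentSpace I x,
    IsSmoothField I X → IsSmoothField I Y → IsSmoothField I Z →
    ∀ x, extDerivTwo I S.fundamentalForm X Y Z x = 0

/-- The SKT (pluriclosed) condition `d d^c ω = 0`. -/
def IsSKT : Prop :=
  ∀ X Y Z W : Π x : M, TangentSpace I x,
    IsSmoothField I X → IsSmoothField I Y → IsSmoothField I Z → IsSmoothField I W →
    ∀ x, extDerivThree I S.dcFundamentalForm X Y Z W x = 0

/-- The Bismut connection: the Hermitian connection (`∇g = 0`, `∇J = 0`) whose torsion is totally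
skew-symmetric, i.e. such that `g(T(X,Y),Z)` is a `3`-form. -/
def IsBismut [FiniteDimensional ℝ E] (nabla : AffineConnection I M) : Prop :=
  IsMetricConnection S.metric nabla ∧
  (∀ Y : Π x : M, TangentSpace I x, IsSmoothField I Y → ∀ (x : M) (u : TangentSpace I x),
    nabla (S.applyJ Y) x u = S.J x (nabla Y x u)) ∧
  ∀ (x : M) (u v w : TangentSpace I x),
    S.metric.inner x (nabla.torsion x u v) w = -S.metric.inner x (nabla.torsion x u w) v

/-- The Bismut-Ricci form `ρ(X,Y) = ½ ∑ᵢ g(R(X,Y)Jeᵢ, eᵢ)` of a connection at the point `x`, in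
terms of a frame `e` that is orthonormal at `x`. -/
def ricciForm (nabla : AffineConnection I M) (e : Fin (finrank ℝ E) → Π x : M, TangentSpace I x)
    (X Y : Π x : M, TangentSpace I x) (x : M) : ℝ :=
  (1 / 2) * ∑ i, S.metric.inner x (curvature nabla X Y (S.applyJ (e i)) x) (e i x)

/-- The CYT condition: the Ricci form of the Bismut connection vanishes. -/
def IsCYT [FiniteDimensional ℝ E] : Prop :=
  ∃ nabla : AffineConnection I M, S.IsBismut nabla ∧
    ∀ (x : M) (e : Fin (finrank ℝ E) → Π x : M, TangentSpace I x), IsFrameAt S.metric x e →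
      ∀ X Y : Π x : M, TangentSpace I x, IsSmoothField I X → IsSmoothField I Y →
        S.ricciForm nabla e X Y x = 0

/-- The Bismut connection is flat. -/
def IsBismutFlat [FiniteDimensional ℝ E] : Prop :=
  ∃ nabla : AffineConnection I M, S.IsBismut nabla ∧ IsFlatConnection nabla

/-- The group `Isom_hol(M)` of holomorphic isometries of `(M, g, J)`. -/
def holIsometryGroup : Subgroup (Equiv.Perm M) where
  carrier := {f | f ∈ isometryGroup S.metric ∧
    ∀ (x : M) (u : TangentSpace I x), mfderiv I I f x (S.J x u) = S.J (f x) (mfderiv I I f x u)}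
  one_mem' := by
    refine ⟨one_mem _, fun x u ↦ ?_⟩
    have h : mfderiv I I (⇑(1 : Equiv.Perm M)) x = ContinuousLinearMap.id ℝ (TangentSpace I x) :=
      mfderiv_id
    rw [h]; rfl
  mul_mem' := by
    rintro f k ⟨hf, hfJ⟩ ⟨hk, hkJ⟩
    refine ⟨mul_mem hf hk, fun x u ↦ ?_⟩
    rw [mfderiv_perm_mul hf.1 hk.1]
    exact (congrArg (mfderiv I I f (k x)) (hkJ x u)).trans (hfJ (k x) _)
  inv_mem' := by
    rintro f ⟨hf, hfJ⟩
    refine ⟨inv_mem hf, fun x u ↦ ?_⟩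
    have e : ∀ (y : M), y = x → ∀ a a' : E, a = a' → (S.J y a : E) = S.J x a' := by
      rintro y rfl a a' rfl; rfl
    have h1 : (mfderiv I I f (f.symm x) (S.J (f.symm x) (mfderiv I I f.symm x u)) : E)
        = S.J x u :=
      (hfJ (f.symm x) (mfderiv I I f.symm x u)).trans
        (e _ (f.apply_symm_apply x) _ _ (mfderiv_perm_symm hf.1 hf.2.1 x u))
    have h2 : ∀ (y : M), y = x → ∀ a b : E,
        (mfderiv I I f (f.symm x) a : E) = b → (mfderiv I I f.symm y b : E) = a := by
      rintro y rfl a b rfl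
      have h3 := mfderiv_perm_symm (f := f.symm) hf.2.1 hf.1 (f.symm y) a
      have h4 : ∀ (y' : M), y' = y → ∀ c : E, (mfderiv I I f.symm y' c : E) =
          mfderiv I I f.symm y c := by rintro y' rfl c; rfl
      exact (h4 _ (f.apply_symm_apply y) _).symm.trans h3
    exact h2 x rfl _ _ h1

end HermitianStructure

end Hermitian

/-! ### Samelson spaces and the quotient -/

/-- A `C^∞` real Lie group has a Lie algebra. -/
instance instLieGroupMinSmoothness {E : Type*} [NormedAddCommGroup E] [NormedSpace ℝ E]
    {H : Type*} [TopologicalSpace H] {I : ModelWithCorners ℝ E H} {G : Type*} [TopologicalSpace G] [ChartedSpace H G] [Group G]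
    [LieGroup I ∞ G] : LieGroup I (minSmoothness ℝ 3) G := by
  rw [minSmoothness_of_isRCLikeNormedField]; infer_instance

section Quotient

variable {n : ℕ}

/-- The abelian group `ℤⁿ`, written multiplicatively. -/
abbrev IntLattice (n : ℕ) : Type := Multiplicative (Fin n → ℤ)

/-- An element of `ℤⁿ`, seen as a vector of `ℝⁿ`. -/
def latticeVec (m : IntLattice n) : EuclideanSpace ℝ (Fin n) :=
  WithLp.toLp 2 (fun i ↦ ((m.toAdd i : ℤ) : ℝ))

theorem latticeVec_one : latticeVec (1 : IntLattice n) = 0 := by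
  ext i; simp [latticeVec]

theorem latticeVec_mul (m m' : IntLattice n) :
    latticeVec (m * m') = latticeVec m + latticeVec m' := by
  ext i; simp [latticeVec]

/-- For a homomorphism `ρ` from `ℤⁿ` to a group of transformations of `G`, the transformations
`(q, t) ↦ (ρ(m) q, t + m)` of `G × ℝⁿ`. -/
def shift {G : Type*} {Γ : Subgroup (Equiv.Perm G)} (rho : IntLattice n →* Γ) :
    IntLattice n →* Equiv.Perm (G × EuclideanSpace ℝ (Fin n)) where
  toFun m := Equiv.prodCongr (rho m : Equiv.Perm G) (Equiv.addRight (latticeVec m))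
  map_one' := by
    ext1 x
    refine Prod.ext ?_ ?_
    · simp
    · simp [latticeVec_one]
  map_mul' m m' := by
    ext1 x
    refine Prod.ext ?_ ?_
    · simp
    · simp [latticeVec_mul, add_comm, add_left_comm]

variable {K G : Type*} {ΓK : Subgroup (Equiv.Perm K)} {ΓG : Subgroup (Equiv.Perm G)}

/-- The action `m · (p, q, t) = (ψ(m) p, ρ(m) q, t + m)` of `ℤⁿ` on `K × G × ℝⁿ`. -/
abbrev deckAction (psi : IntLattice n →* ΓK) (rho : IntLattice n →* ΓG) :
    MulAction (IntLattice n) (K × G × EuclideanSpace ℝ (Fin n)) where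
  smul m x := ((psi m : Equiv.Perm K) x.1, shift rho m x.2)
  one_smul x := by
    change ((psi 1 : Equiv.Perm K) x.1, shift rho 1 x.2) = x
    simp
  mul_smul m m' x := by
    change ((psi (m * m') : Equiv.Perm K) x.1, shift rho (m * m') x.2) =
      ((psi m : Equiv.Perm K) ((psi m' : Equiv.Perm K) x.1), shift rho m (shift rho m' x.2))
    simp

/-- The quotient `M_{ψ,ρ} = (K × G × ℝⁿ) / ℤⁿ`. -/
def QuotientSpace (psi : IntLattice n →* ΓK) (rho : IntLattice n →* ΓG) : Type _ :=
  letI := deckAction psi rho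
  MulAction.orbitRel.Quotient (IntLattice n) (K × G × EuclideanSpace ℝ (Fin n))

/-- The projection `K × G × ℝⁿ → M_{ψ,ρ}`. -/
def quotientMap (psi : IntLattice n →* ΓK) (rho : IntLattice n →* ΓG) :
    K × G × EuclideanSpace ℝ (Fin n) → QuotientSpace psi rho :=
  letI := deckAction psi rho
  Quotient.mk (MulAction.orbitRel (IntLattice n) (K × G × EuclideanSpace ℝ (Fin n)))

/-- The quotient topology. -/
instance instTopologicalSpaceQuotientSpace [TopologicalSpace K] [TopologicalSpace G]
    (psi : IntLattice n →* ΓK) (rho : IntLattice n →* ΓG) : TopologicalSpace (QuotientSpace psi rho) :=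
  TopologicalSpace.coinduced (quotientMap psi rho) inferInstance

variable {EK : Type*} [NormedAddCommGroup EK] [NormedSpace ℝ EK]
  {EG : Type*} [NormedAddCommGroup EG] [NormedSpace ℝ EG]
  [TopologicalSpace K] [ChartedSpace EK K] [IsManifold 𝓘(ℝ, EK) ∞ K]
  [TopologicalSpace G] [ChartedSpace EG G]

/-- The model of the manifolds `G × ℝⁿ`. -/
abbrev modelGR (EG : Type*) [NormedAddCommGroup EG] [NormedSpace ℝ EG] (n : ℕ) :
    ModelWithCorners ℝ (EG × EuclideanSpace ℝ (Fin n)) (ModelProd EG (EuclideanSpace ℝ (Fin n))) :=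
  𝓘(ℝ, EG).prod 𝓘(ℝ, EuclideanSpace ℝ (Fin n))

/-- The model of the manifolds `K × G × ℝⁿ` and `M_{ψ,ρ}`. -/
abbrev modelKGR (EK EG : Type*) [NormedAddCommGroup EK] [NormedSpace ℝ EK]
    [NormedAddCommGroup EG] [NormedSpace ℝ EG] (n : ℕ) :
    ModelWithCorners ℝ (EK × EG × EuclideanSpace ℝ (Fin n))
      (ModelProd EK (ModelProd EG (EuclideanSpace ℝ (Fin n)))) :=
  𝓘(ℝ, EK).prod (modelGR EG n)

/-- The Hermitian structure `(g', J_L)` on `G' = G × ℝⁿ` makes it a Samelson space: `g' = b + g_E`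
with `b` a bi-invariant metric on `G`, and `J_L` is invariant under the left translations
`(q, t) ↦ (a q, s + t)` of the group `G'`. -/
structure IsSamelson [Group G] [LieGroup 𝓘(ℝ, EG) ∞ G] (b : SmoothMetric 𝓘(ℝ, EG) G)
    (S : HermitianStructure (modelGR EG n) (G × EuclideanSpace ℝ (Fin n))) : Prop where
  left_invariant : ∀ (a q : G) (u v : TangentSpace 𝓘(ℝ, EG) q),
    b.inner (a * q) (mfderiv 𝓘(ℝ, EG) 𝓘(ℝ, EG) (fun y : G ↦ a * y) q u)
      (mfderiv 𝓘(ℝ, EG) 𝓘(ℝ, EG) (fun y : G ↦ a * y) q v) = b.inner q u v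
  right_invariant : ∀ (a q : G) (u v : TangentSpace 𝓘(ℝ, EG) q),
    b.inner (q * a) (mfderiv 𝓘(ℝ, EG) 𝓘(ℝ, EG) (fun y : G ↦ y * a) q u)
      (mfderiv 𝓘(ℝ, EG) 𝓘(ℝ, EG) (fun y : G ↦ y * a) q v) = b.inner q u v
  metric_eq : ∀ (q : G) (t : EuclideanSpace ℝ (Fin n)) (u v : EG × EuclideanSpace ℝ (Fin n)),
    S.metric.inner (q, t) u v = b.inner q u.1 v.1 + inner ℝ u.2 v.2
  J_left_invariant : ∀ (a : G) (s : EuclideanSpace ℝ (Fin n))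
    (x : G × EuclideanSpace ℝ (Fin n)) (u : TangentSpace (modelGR EG n) x),
    S.J (a * x.1, s + x.2) (mfderiv (modelGR EG n) (modelGR EG n)
        (fun y : G × EuclideanSpace ℝ (Fin n) ↦ (a * y.1, s + y.2)) x u) =
      mfderiv (modelGR EG n) (modelGR EG n)
        (fun y : G × EuclideanSpace ℝ (Fin n) ↦ (a * y.1, s + y.2)) x (S.J x u)

/-- The Hermitian structure `S = (h, I)` on `M_{ψ,ρ}` is induced by the product structure
`(g + g', J × J_L)` of `K × G × ℝⁿ`: under the projection `h` pulls back to `g + g'`, and the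
differential of the projection intertwines `J × J_L` and `I`. -/
def IsInduced [IsManifold 𝓘(ℝ, EG) ∞ G] (SK : HermitianStructure 𝓘(ℝ, EK) K)
    (SL : HermitianStructure (modelGR EG n) (G × EuclideanSpace ℝ (Fin n)))
    (psi : IntLattice n →* ΓK) (rho : IntLattice n →* ΓG)
    [ChartedSpace (ModelProd EK (ModelProd EG (EuclideanSpace ℝ (Fin n)))) (QuotientSpace psi rho)]
    [IsManifold (modelKGR EK EG n) ∞ (QuotientSpace psi rho)]
    (S : HermitianStructure (modelKGR EK EG n) (QuotientSpace psi rho)) : Prop :=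
  ∀ (p : K) (y : G × EuclideanSpace ℝ (Fin n)) (u v : EK × EG × EuclideanSpace ℝ (Fin n)),
    S.metric.inner (quotientMap psi rho (p, y))
        (mfderiv (modelKGR EK EG n) (modelKGR EK EG n) (quotientMap psi rho) (p, y) u)
        (mfderiv (modelKGR EK EG n) (modelKGR EK EG n) (quotientMap psi rho) (p, y) v) =
      SK.metric.inner p u.1 v.1 + SL.metric.inner y u.2 v.2 ∧
    S.J (quotientMap psi rho (p, y))
        (mfderiv (modelKGR EK EG n) (modelKGR EK EG n) (quotientMap psi rho) (p, y) u) =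
      mfderiv (modelKGR EK EG n) (modelKGR EK EG n) (quotientMap psi rho) (p, y)
        ((SK.J p u.1, SL.J y u.2) : EK × EG × EuclideanSpace ℝ (Fin n))

end Quotient

end Bismut

end

open Bismut

noncomputable section

namespace Bismut

theorem natCast_le_infty (n : ℕ) : ((n : ℕ) : WithTop ℕ∞) ≤ ∞ :=
  WithTop.coe_le_coe.2 (le_top : (n : ℕ∞) ≤ ⊤)

section LocalDiffeo

variable {E : Type*} [NormedAddCommGroup E] [NormedSpace ℝ E]
  {H : Type*} [TopologicalSpace H] {I : ModelWithCorners ℝ E H}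
  {M : Type*} [TopologicalSpace M] [ChartedSpace H M]
  {F : Type*} [NormedAddCommGroup F] [NormedSpace ℝ F]
  {H' : Type*} [TopologicalSpace H'] {I' : ModelWithCorners ℝ F H'}
  {N : Type*} [TopologicalSpace N] [ChartedSpace H' N]

theorem isInvertible_mfderiv_of_isLocalDiffeomorphAt {φ : N → M} {e : N}
    (h : IsLocalDiffeomorphAt I' I ∞ φ e) : (mfderiv I' I φ e).IsInvertible :=
  ⟨h.mfderivToContinuousLinearEquiv (by simp), rfl⟩

theorem IsLocalDiffeomorphAt.eventually {φ : N → M} {e : N}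
    (h : IsLocalDiffeomorphAt I' I ∞ φ e) : ∀ᶠ e' in 𝓝 e, IsLocalDiffeomorphAt I' I ∞ φ e' := by
  obtain ⟨Φ, he, hΦ⟩ := h
  filter_upwards [Φ.open_source.mem_nhds he] with e' he'
  exact ⟨Φ, he', hΦ⟩

theorem IsLocalDiffeomorphAt.map_nhds_eq {φ : N → M} {e : N}
    (h : IsLocalDiffeomorphAt I' I ∞ φ e) : Filter.map φ (𝓝 e) = 𝓝 (φ e) := by
  obtain ⟨Φ, he, hΦ⟩ := h
  have h1 : φ =ᶠ[𝓝 e] Φ.toOpenPartialHomeomorph :=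
    Filter.eventuallyEq_of_mem (Φ.open_source.mem_nhds he) hΦ
  rw [Filter.map_congr h1, Φ.toOpenPartialHomeomorph.map_nhds_eq he, h1.self_of_nhds]

theorem inverse_mfderiv_of_leftInverse {φ : N → M} {e : N} (h : IsLocalDiffeomorphAt I' I ∞ φ e)
    {ψ : M → N} (hψ : MDifferentiableAt I I' ψ (φ e)) (hψφ : ∀ᶠ e' in 𝓝 e, ψ (φ e') = e') (u : F) :
    ((mfderiv I I' ψ (φ e) : E →L[ℝ] F).inverse u : E) = mfderiv I' I φ e u := by
  have h1 := mfderiv_comp e hψ (h.mdifferentiableAt (by simp))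
  have h2 : ψ ∘ φ =ᶠ[𝓝 e] id := hψφ
  rw [h2.mfderiv_eq, mfderiv_id] at h1
  obtain ⟨L, hL⟩ : ∃ L : F ≃L[ℝ] E, (L : F →L[ℝ] E) = mfderiv I' I φ e :=
    isInvertible_mfderiv_of_isLocalDiffeomorphAt h
  have h3 : ∀ v : F, (mfderiv I I' ψ (φ e) : E →L[ℝ] F) (L v) = v := fun v ↦ by
    have := congrArg (fun L : F →L[ℝ] F ↦ L v) h1
    refine Eq.trans ?_ this.symm
    rw [← hL]; rfl
  have h4 : (mfderiv I I' ψ (φ e) : E →L[ℝ] F) = (L.symm : E →L[ℝ] F) := by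
    ext v
    obtain ⟨w, rfl⟩ := L.surjective v
    exact (h3 w).trans (L.symm_apply_apply w).symm
  have h5 : ∀ T : E →L[ℝ] F, T = L.symm → T.inverse u = L u := by
    rintro T rfl
    rw [ContinuousLinearMap.inverse_equiv]; rfl
  exact (h5 _ h4).trans (congrArg (fun T : F →L[ℝ] E ↦ T u) hL)

variable {W : Type*} [NormedAddCommGroup W] [NormedSpace ℝ W]

theorem mdifferentiableAt_of_comp_isLocalDiffeomorphAt {φ : N → M} {e : N}
    (h : IsLocalDiffeomorphAt I' I ∞ φ e) {f : M → W}
    (hf : MDifferentiableAt I' 𝓘(ℝ, W) (f ∘ φ) e) : MDifferentiableAt I 𝓘(ℝ, W) f (φ e) := by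
  have h1 : MDifferentiableAt I I' h.localInverse (φ e) :=
    h.localInverse_mdifferentiableAt (by simp)
  have h2 : h.localInverse (φ e) = e := h.localInverse_left_inv h.localInverse_mem_target
  have h3 : MDifferentiableAt I 𝓘(ℝ, W) ((f ∘ φ) ∘ h.localInverse) (φ e) :=
    MDifferentiableAt.comp (φ e) (by rw [h2]; exact hf) h1
  refine h3.congr_of_eventuallyEq ?_
  filter_upwards [h.localInverse_eventuallyEq_right] with y hy
  simp only [Function.comp_apply, id] at hy ⊢
  rw [hy]

end LocalDiffeo

section Extension

variable {E : Type*} [NormedAddCommGroup E] [NormedSpace ℝ E] [FiniteDimensional ℝ E]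
  {H : Type*} [TopologicalSpace H] {I : ModelWithCorners ℝ E H}
  {M : Type*} [TopologicalSpace M] [ChartedSpace H M] [IsManifold I ∞ M] [T2Space M]

/-- A vector field that is smooth near a point agrees near this point with a global one. -/
theorem exists_isSmoothField_eventuallyEq {X : Π x : M, TangentSpace I x} {x : M}
    (hX : ∀ᶠ y in 𝓝 x, ContMDiffAt I I.tangent ∞ (fun y ↦ (⟨y, X y⟩ : TangentBundle I M)) y) :
    ∃ Y : Π x : M, TangentSpace I x, IsSmoothField I Y ∧ ∀ᶠ y in 𝓝 x, Y y = X y := by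
  obtain ⟨s, hs, hso, hxs⟩ := eventually_nhds_iff.1 hX
  obtain ⟨f, -, hf⟩ := (SmoothBumpFunction.nhds_basis_tsupport (I := I) x).mem_iff.1
    (hso.mem_nhds hxs)
  refine ⟨fun y ↦ f y • X y, ?_, ?_⟩
  · exact ContMDiffOn.smul_section_of_tsupport (V := TangentSpace I) (F := E) (u := s)
      (f.contMDiff.contMDiffOn) hso hf fun y hy ↦ (hs y hy).contMDiffWithinAt
  · filter_upwards [f.eventuallyEq_one] with y hy
    rw [hy]; simp

theorem exists_isSmoothField_eq (x : M) (v : TangentSpace I x) :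
    ∃ X : Π x : M, TangentSpace I x, IsSmoothField I X ∧ X x = v := by
  obtain ⟨s, hs, h⟩ := FiberBundle.exists_contMDiffOn_extend I E (k := ∞) v
  obtain ⟨Y, hY, hYX⟩ := exists_isSmoothField_eventuallyEq
    (X := FiberBundle.extend E v) (x := x) (by
      filter_upwards [eventually_mem_nhds_iff.2 hs] with y hy
      exact h.contMDiffAt hy)
  exact ⟨Y, hY, by rw [hYX.self_of_nhds]; simp⟩

end Extension

theorem IsSmoothField.mdifferentiableAt {E : Type*} [NormedAddCommGroup E] [NormedSpace ℝ E]
    {H : Type*} [TopologicalSpace H] {I : ModelWithCorners ℝ E H}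
    {M : Type*} [TopologicalSpace M] [ChartedSpace H M] [IsManifold I ∞ M]
    {X : Π x : M, TangentSpace I x} (hX : IsSmoothField I X) (x : M) :
    MDifferentiableAt I I.tangent (fun x ↦ (⟨x, X x⟩ : TangentBundle I M)) x :=
  (hX x).mdifferentiableAt (by simp)

theorem IsSmoothField.mlieBracket {E : Type*} [NormedAddCommGroup E] [NormedSpace ℝ E]
    [CompleteSpace E]
    {H : Type*} [TopologicalSpace H] {I : ModelWithCorners ℝ E H}
    {M : Type*} [TopologicalSpace M] [ChartedSpace H M] [IsManifold I ∞ M]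
    {X Y : Π x : M, TangentSpace I x} (hX : IsSmoothField I X) (hY : IsSmoothField I Y) :
    IsSmoothField I (mlieBracket I X Y) := by
  intro x
  have : IsManifold I (((⊤ : ℕ∞) : WithTop ℕ∞) + 1) M := by simpa using ‹IsManifold I ∞ M›
  have : IsManifold I (minSmoothness ℝ 2) M := by
    rw [minSmoothness_of_isRCLikeNormedField]; infer_instance
  exact ContMDiffAt.mlieBracket_vectorField (m := ⊤) (n := ⊤) (hX x) (hY x)
    (by rw [minSmoothness_of_isRCLikeNormedField]; simp)

/-- A parametrization `param` of an open part of `M` by an open subset `dom` of a normed space,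
together with a coframe `co` satisfying a Maurer-Cartan equation with constant coefficients. -/
structure Coframe {E : Type*} [NormedAddCommGroup E] [NormedSpace ℝ E]
    {H : Type*} [TopologicalSpace H] (I : ModelWithCorners ℝ E H)
    (M : Type*) [TopologicalSpace M] [ChartedSpace H M]
    (F : Type*) [NormedAddCommGroup F] [NormedSpace ℝ F]
    (V : Type*) [NormedAddCommGroup V] [NormedSpace ℝ V] where
  param : F → M
  dom : Set F
  isOpen_dom : IsOpen dom
  diffeo : ∀ e ∈ dom, IsLocalDiffeomorphAt 𝓘(ℝ, F) I ∞ param e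
  co : F → F ≃L[ℝ] V
  contDiff_co : ∀ e ∈ dom, ContDiffAt ℝ 2 (fun e ↦ (co e : F →L[ℝ] V)) e
  bracket : V →L[ℝ] V →L[ℝ] V
  maurerCartan : ∀ e ∈ dom, ∀ u v : F,
    fderiv ℝ (fun e ↦ (co e : F →L[ℝ] V)) e u v - fderiv ℝ (fun e ↦ (co e : F →L[ℝ] V)) e v u =
      -bracket (co e u) (co e v)

namespace Coframe

variable {E : Type*} [NormedAddCommGroup E] [NormedSpace ℝ E]
    {H : Type*} [TopologicalSpace H] {I : ModelWithCorners ℝ E H}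
    {M : Type*} [TopologicalSpace M] [ChartedSpace H M]
    {F : Type*} [NormedAddCommGroup F] [NormedSpace ℝ F]
    {V : Type*} [NormedAddCommGroup V] [NormedSpace ℝ V] (𝔣 : Coframe I M F V)

/-- The differential of the parametrization. -/
def dparam (e : F) : F →L[ℝ] E := mfderiv 𝓘(ℝ, F) I 𝔣.param e

/-- The coframe as a map on tangent vectors of `M`. -/
def toModel (e : F) : TangentSpace I (𝔣.param e) →L[ℝ] V :=
  ((𝔣.co e : F →L[ℝ] V).comp (𝔣.dparam e).inverse : E →L[ℝ] V)

/-- The tangent vector with given coefficients. -/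
def vec (e : F) : V →L[ℝ] TangentSpace I (𝔣.param e) :=
  ((𝔣.dparam e).comp ((𝔣.co e).symm : V →L[ℝ] F) : V →L[ℝ] E)

/-- The coefficients of a vector field. -/
def comp (X : Π x : M, TangentSpace I x) (e : F) : V := 𝔣.toModel e (X (𝔣.param e))

/-- The derivative of a function in the direction with given coefficients. -/
def der {W : Type*} [NormedAddCommGroup W] [NormedSpace ℝ W] (f : F → W) (e : F) : V →L[ℝ] W :=
  (fderiv ℝ f e).comp ((𝔣.co e).symm : V →L[ℝ] F)

variable {𝔣} {e : F}

theorem isInvertible_dparam (he : e ∈ 𝔣.dom) : (𝔣.dparam e).IsInvertible :=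
  isInvertible_mfderiv_of_isLocalDiffeomorphAt (𝔣.diffeo e he)

theorem toModel_vec (he : e ∈ 𝔣.dom) (a : V) : 𝔣.toModel e (𝔣.vec e a) = a := by
  obtain ⟨L, hL⟩ := isInvertible_dparam he
  change (((𝔣.co e : F →L[ℝ] V).comp (𝔣.dparam e).inverse : E →L[ℝ] V)
    (((𝔣.dparam e).comp ((𝔣.co e).symm : V →L[ℝ] F) : V →L[ℝ] E) a)) = a
  simp [← hL]

theorem vec_toModel (he : e ∈ 𝔣.dom) (u : TangentSpace I (𝔣.param e)) :
    𝔣.vec e (𝔣.toModel e u) = u := by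
  obtain ⟨L, hL⟩ := isInvertible_dparam he
  change (((𝔣.dparam e).comp ((𝔣.co e).symm : V →L[ℝ] F) : V →L[ℝ] E)
    (((𝔣.co e : F →L[ℝ] V).comp (𝔣.dparam e).inverse : E →L[ℝ] V) (u : E))) = (u : E)
  have h : ∀ w : E, ((𝔣.dparam e).comp ((𝔣.co e).symm : V →L[ℝ] F) : V →L[ℝ] E)
      (((𝔣.co e : F →L[ℝ] V).comp (𝔣.dparam e).inverse : E →L[ℝ] V) w) = w := by
    intro w; simp [← hL]
  exact h u

theorem toModel_injective (he : e ∈ 𝔣.dom) : Function.Injective (𝔣.toModel e) :=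
  Function.LeftInverse.injective (vec_toModel he)

theorem toModel_dparam (he : e ∈ 𝔣.dom) (u : F) :
    𝔣.toModel e (𝔣.dparam e u) = 𝔣.co e u := by
  have h := toModel_vec he (𝔣.co e u)
  have h2 : 𝔣.vec e (𝔣.co e u) = (𝔣.dparam e u : E) :=
    congrArg (𝔣.dparam e) ((𝔣.co e).symm_apply_apply u)
  rwa [h2] at h

theorem eventually_mem_dom (he : e ∈ 𝔣.dom) : ∀ᶠ e' in 𝓝 e, e' ∈ 𝔣.dom :=
  𝔣.isOpen_dom.mem_nhds he

theorem mvfderiv_eq_der {W : Type*} [NormedAddCommGroup W] [NormedSpace ℝ W] (he : e ∈ 𝔣.dom)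
    {f : M → W} (hf : DifferentiableAt ℝ (f ∘ 𝔣.param) e)
    (u : TangentSpace I (𝔣.param e)) :
    mvfderiv I f (𝔣.param e) u = 𝔣.der (f ∘ 𝔣.param) e (𝔣.toModel e u) := by
  have hd := 𝔣.diffeo e he
  have h1 : MDifferentiableAt I 𝓘(ℝ, W) f (𝔣.param e) :=
    mdifferentiableAt_of_comp_isLocalDiffeomorphAt hd hf.mdifferentiableAt
  have h2 := mfderiv_comp e h1 (hd.mdifferentiableAt (by simp))
  rw [mfderiv_eq_fderiv] at h2
  obtain ⟨a, rfl⟩ : ∃ a, 𝔣.vec e a = u := ⟨_, vec_toModel he u⟩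
  rw [toModel_vec he, der]
  have h3 := congrArg (fun L : F →L[ℝ] W ↦ L ((𝔣.co e).symm a)) h2
  exact h3.symm

theorem mvfderiv_eq_der_of_eventuallyEq {W : Type*} [NormedAddCommGroup W] [NormedSpace ℝ W]
    (he : e ∈ 𝔣.dom) {f : M → W} {k : F → W} (hfk : ∀ᶠ e' in 𝓝 e, f (𝔣.param e') = k e')
    (hk : DifferentiableAt ℝ k e) (u : TangentSpace I (𝔣.param e)) :
    mvfderiv I f (𝔣.param e) u = 𝔣.der k e (𝔣.toModel e u) := by
  have h : f ∘ 𝔣.param =ᶠ[𝓝 e] k := hfk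
  rw [mvfderiv_eq_der he (hk.congr_of_eventuallyEq h), der, der, h.fderiv_eq]

variable [CompleteSpace F]

variable (𝔣) in
/-- A vector field in the parametrization. -/
def pull (X : Π x : M, TangentSpace I x) (e : F) : F := (𝔣.dparam e).inverse (X (𝔣.param e))

omit [CompleteSpace F] in
theorem co_pull (X : Π x : M, TangentSpace I x) (e : F) : 𝔣.co e (𝔣.pull X e) = 𝔣.comp X e := rfl

omit [CompleteSpace F] in
theorem co_symm_comp (X : Π x : M, TangentSpace I x) (e : F) :
    (𝔣.co e).symm (𝔣.comp X e) = 𝔣.pull X e := by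
  rw [← co_pull, ContinuousLinearEquiv.symm_apply_apply]

omit [CompleteSpace F] in
theorem dparam_pull (he : e ∈ 𝔣.dom) (X : Π x : M, TangentSpace I x) :
    𝔣.dparam e (𝔣.pull X e) = X (𝔣.param e) := by
  obtain ⟨L, hL⟩ := isInvertible_dparam he
  simp only [pull, ← hL, ContinuousLinearMap.inverse_equiv]
  exact L.apply_symm_apply _

theorem contDiffAt_pull [IsManifold I ∞ M] {X : Π x : M, TangentSpace I x} {n : WithTop ℕ∞}
    (he : e ∈ 𝔣.dom) (hn : n + 1 ≤ ∞)
    (hX : ContMDiffAt I I.tangent n (fun x ↦ (⟨x, X x⟩ : TangentBundle I M)) (𝔣.param e)) :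
    ContDiffAt ℝ n (𝔣.pull X) e := by
  have h := ContMDiffAt.mpullback_vectorField_preimage (I := 𝓘(ℝ, F)) (n := ∞) hX
    (𝔣.diffeo e he).contMDiffAt
    (isInvertible_mfderiv_of_isLocalDiffeomorphAt (𝔣.diffeo e he)) hn
  have h2 := (contMDiff_snd_tangentBundle_modelSpace F 𝓘(ℝ, F) (n := n)).contMDiffAt.comp e h
  exact h2.contDiffAt

theorem contDiffAt_comp [IsManifold I ∞ M] {X : Π x : M, TangentSpace I x} {n : WithTop ℕ∞}
    (he : e ∈ 𝔣.dom) (hn : n ≤ 2)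
    (hX : ContMDiffAt I I.tangent n (fun x ↦ (⟨x, X x⟩ : TangentBundle I M)) (𝔣.param e)) :
    ContDiffAt ℝ n (𝔣.comp X) e := by
  have : 𝔣.comp X = fun e ↦ (𝔣.co e : F →L[ℝ] V) (𝔣.pull X e) := rfl
  rw [this]
  refine ((𝔣.contDiff_co e he).of_le hn).clm_apply (contDiffAt_pull he ?_ hX)
  calc n + 1 ≤ 2 + 1 := by gcongr
    _ ≤ ∞ := by
      convert natCast_le_infty 3 using 1; norm_num

theorem differentiableAt_pull [IsManifold I ∞ M] {X : Π x : M, TangentSpace I x}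
    (he : e ∈ 𝔣.dom)
    (hX : MDifferentiableAt I I.tangent (fun x ↦ (⟨x, X x⟩ : TangentBundle I M)) (𝔣.param e)) :
    DifferentiableAt ℝ (𝔣.pull X) e := by
  have h := MDifferentiableAt.mpullback_vectorField (I := 𝓘(ℝ, F)) (n := ∞) hX
    (𝔣.diffeo e he).contMDiffAt
    (isInvertible_mfderiv_of_isLocalDiffeomorphAt (𝔣.diffeo e he)) (natCast_le_infty 2)
  have h2 := ((contMDiff_snd_tangentBundle_modelSpace F 𝓘(ℝ, F)
    (n := 1)).contMDiffAt.mdifferentiableAt (by simp)).comp e h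
  exact h2.differentiableAt

theorem differentiableAt_comp [IsManifold I ∞ M] {X : Π x : M, TangentSpace I x}
    (he : e ∈ 𝔣.dom)
    (hX : MDifferentiableAt I I.tangent (fun x ↦ (⟨x, X x⟩ : TangentBundle I M)) (𝔣.param e)) :
    DifferentiableAt ℝ (𝔣.comp X) e := by
  have : 𝔣.comp X = fun e ↦ (𝔣.co e : F →L[ℝ] V) (𝔣.pull X e) := rfl
  rw [this]
  exact ((𝔣.contDiff_co e he).differentiableAt (by simp)).clm_apply (differentiableAt_pull he hX)

omit [CompleteSpace F] in
theorem mdifferentiableAt_of_pull [IsManifold I ∞ M] [CompleteSpace E]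
    {X : Π x : M, TangentSpace I x}
    (he : e ∈ 𝔣.dom) (hX : DifferentiableAt ℝ (𝔣.pull X) e) :
    MDifferentiableAt I I.tangent (fun x ↦ (⟨x, X x⟩ : TangentBundle I M)) (𝔣.param e) := by
  have hd := 𝔣.diffeo e he
  have hψ : hd.localInverse (𝔣.param e) = e := hd.localInverse_left_inv hd.localInverse_mem_target
  have h1 : MDifferentiableAt 𝓘(ℝ, F) 𝓘(ℝ, F).tangent
      (fun x ↦ (⟨x, 𝔣.pull X x⟩ : TangentBundle 𝓘(ℝ, F) F)) (hd.localInverse (𝔣.param e)) := by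
    rw [hψ]
    refine (mdifferentiableAt_totalSpace (F := F) (E := TangentSpace 𝓘(ℝ, F)) 𝓘(ℝ, F) _).2
      ⟨mdifferentiableAt_id, ?_⟩
    exact (show MDifferentiableAt 𝓘(ℝ, F) 𝓘(ℝ, F) (𝔣.pull X) e from
      hX.mdifferentiableAt).congr_of_eventuallyEq (.of_forall fun e' ↦ by simp)
  have h2 := MDifferentiableAt.mpullback_vectorField (I := I) (n := ∞) h1
    hd.localInverse_contMDiffAt
    (isInvertible_mfderiv_of_isLocalDiffeomorphAt hd.localInverse_isLocalDiffeomorphAt)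
    (natCast_le_infty 2)
  refine h2.congr_of_eventuallyEq ?_
  rw [← IsLocalDiffeomorphAt.map_nhds_eq hd, Filter.EventuallyEq, Filter.eventually_map]
  have h3 : ∀ᶠ e' in 𝓝 e, e' ∈ hd.localInverse.target :=
    hd.localInverse.open_target.mem_nhds hd.localInverse_mem_target
  filter_upwards [h3, eventually_mem_dom he] with e' he3 he'
  have h4 : MDifferentiableAt I 𝓘(ℝ, F) hd.localInverse (𝔣.param e') := by
    refine hd.localInverse.mdifferentiableAt (by simp) ?_
    have := hd.localInverse.map_target he3
    convert this using 1
    exact (hd.choose_spec.2 he3)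
  have h5 := inverse_mfderiv_of_leftInverse (𝔣.diffeo e' he') h4 (by
    filter_upwards [hd.localInverse.open_target.mem_nhds he3] with e'' h
    exact hd.localInverse_left_inv h) (𝔣.pull X e')
  refine Bundle.TotalSpace.ext rfl (heq_of_eq ?_)
  have h6 : hd.localInverse (𝔣.param e') = e' := hd.localInverse_left_inv he3
  refine ((h5.trans (dparam_pull he' X))).symm.trans ?_
  change _ = ((mfderiv I 𝓘(ℝ, F) hd.localInverse (𝔣.param e') : E →L[ℝ] F).inverse
    (𝔣.pull X (hd.localInverse (𝔣.param e'))))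
  rw [h6]

theorem mdifferentiableAt_of_comp [IsManifold I ∞ M] [CompleteSpace E]
    {X : Π x : M, TangentSpace I x}
    (he : e ∈ 𝔣.dom) (hX : DifferentiableAt ℝ (𝔣.comp X) e) :
    MDifferentiableAt I I.tangent (fun x ↦ (⟨x, X x⟩ : TangentBundle I M)) (𝔣.param e) := by
  refine mdifferentiableAt_of_pull he ?_
  have h1 : DifferentiableAt ℝ (fun e ↦ (𝔣.co e : F →L[ℝ] V).inverse) e :=
    ContDiffAt.differentiableAt (n := 1)
      ((contDiffAt_map_inverse (𝔣.co e)).fun_comp e ((𝔣.contDiff_co e he).of_le (by simp)))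
      (by simp)
  have h2 := h1.clm_apply hX
  refine h2.congr_of_eventuallyEq (.of_forall fun e' ↦ ?_)
  simp [ContinuousLinearMap.inverse_equiv, co_symm_comp]

theorem pull_mlieBracket [IsManifold I ∞ M] [CompleteSpace E]
    {X Y : Π x : M, TangentSpace I x} (he : e ∈ 𝔣.dom)
    (hX : MDifferentiableAt I I.tangent (fun x ↦ (⟨x, X x⟩ : TangentBundle I M)) (𝔣.param e))
    (hY : MDifferentiableAt I I.tangent (fun x ↦ (⟨x, Y x⟩ : TangentBundle I M)) (𝔣.param e)) :
    𝔣.pull (mlieBracket I X Y) e =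
      fderiv ℝ (𝔣.pull Y) e (𝔣.pull X e) - fderiv ℝ (𝔣.pull X) e (𝔣.pull Y e) := by
  have : IsManifold I (minSmoothness ℝ 3) M := by
    rw [minSmoothness_of_isRCLikeNormedField]; infer_instance
  have h := mpullback_mlieBracket (I := 𝓘(ℝ, F)) (n := ∞) hX hY (𝔣.diffeo e he).contMDiffAt
    (by rw [minSmoothness_of_isRCLikeNormedField]; exact natCast_le_infty 2)
  rw [← mlieBracketWithin_univ (I := 𝓘(ℝ, F)), mlieBracketWithin_eq_lieBracketWithin] at h
  refine Eq.trans h ?_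
  exact congrFun (lieBracketWithin_univ (𝕜 := ℝ) (V := 𝔣.pull X) (W := 𝔣.pull Y)) e

theorem comp_mlieBracket [IsManifold I ∞ M] [CompleteSpace E]
    {X Y : Π x : M, TangentSpace I x} (he : e ∈ 𝔣.dom)
    (hX : MDifferentiableAt I I.tangent (fun x ↦ (⟨x, X x⟩ : TangentBundle I M)) (𝔣.param e))
    (hY : MDifferentiableAt I I.tangent (fun x ↦ (⟨x, Y x⟩ : TangentBundle I M)) (𝔣.param e)) :
    𝔣.comp (mlieBracket I X Y) e = 𝔣.der (𝔣.comp Y) e (𝔣.comp X e)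
      - 𝔣.der (𝔣.comp X) e (𝔣.comp Y e) + 𝔣.bracket (𝔣.comp X e) (𝔣.comp Y e) := by
  have hco := (𝔣.contDiff_co e he).differentiableAt (by simp)
  have h2 : ∀ (Z : Π x : M, TangentSpace I x), DifferentiableAt ℝ (𝔣.pull Z) e → ∀ u : F,
      fderiv ℝ (𝔣.comp Z) e u = fderiv ℝ (fun e ↦ (𝔣.co e : F →L[ℝ] V)) e u (𝔣.pull Z e)
        + 𝔣.co e (fderiv ℝ (𝔣.pull Z) e u) := by
    intro Z hZ u
    have : 𝔣.comp Z = fun e ↦ (𝔣.co e : F →L[ℝ] V) (𝔣.pull Z e) := rfl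
    rw [this, fderiv_clm_apply hco hZ]
    simp [add_comm]
  have h3 := 𝔣.maurerCartan e he (𝔣.pull X e) (𝔣.pull Y e)
  rw [← co_pull, pull_mlieBracket he hX hY, map_sub]
  simp only [der, ContinuousLinearMap.comp_apply, ContinuousLinearEquiv.coe_coe, co_symm_comp]
  rw [h2 Y (differentiableAt_pull he hY), h2 X (differentiableAt_pull he hX)]
  rw [co_pull, co_pull] at h3
  rw [sub_eq_iff_eq_add] at h3
  rw [h3]
  abel

end Coframe

namespace Coframe

variable {E : Type*} [NormedAddCommGroup E] [NormedSpace ℝ E] [CompleteSpace E]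
    {H : Type*} [TopologicalSpace H] {I : ModelWithCorners ℝ E H}
    {M : Type*} [TopologicalSpace M] [ChartedSpace H M] [IsManifold I ∞ M]
    {F : Type*} [NormedAddCommGroup F] [NormedSpace ℝ F] [CompleteSpace F]
    {V : Type*} [NormedAddCommGroup V] [NormedSpace ℝ V] {𝔣 : Coframe I M F V} {e : F}

omit [CompleteSpace E] [CompleteSpace F] [IsManifold I ∞ M] in
theorem der_clm_apply {W W' : Type*} [NormedAddCommGroup W] [NormedSpace ℝ W]
    [NormedAddCommGroup W'] [NormedSpace ℝ W'] {L : F → W →L[ℝ] W'} {f : F → W}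
    (hL : DifferentiableAt ℝ L e) (hf : DifferentiableAt ℝ f e) (a : V) :
    𝔣.der (fun e ↦ L e (f e)) e a = 𝔣.der L e a (f e) + L e (𝔣.der f e a) := by
  simp only [der, ContinuousLinearMap.comp_apply, fderiv_clm_apply hL hf]
  simp [add_comm]

omit [CompleteSpace E] [CompleteSpace F] [IsManifold I ∞ M] in
theorem der_clm_apply₂ {W W' W'' : Type*} [NormedAddCommGroup W] [NormedSpace ℝ W]
    [NormedAddCommGroup W'] [NormedSpace ℝ W'] [NormedAddCommGroup W''] [NormedSpace ℝ W'']
    {L : F → W →L[ℝ] W' →L[ℝ] W''} {f : F → W} {k : F → W'}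
    (hL : DifferentiableAt ℝ L e) (hf : DifferentiableAt ℝ f e) (hk : DifferentiableAt ℝ k e)
    (a : V) :
    𝔣.der (fun e ↦ L e (f e) (k e)) e a =
      𝔣.der L e a (f e) (k e) + L e (𝔣.der f e a) (k e) + L e (f e) (𝔣.der k e a) := by
  rw [der_clm_apply (L := fun e ↦ L e (f e)) (hL.clm_apply hf) hk, der_clm_apply hL hf]
  simp

/-- The exterior derivative of a `2`-form in a coframe. -/
theorem extDerivTwo_eq
    {w : (Π x : M, TangentSpace I x) → (Π x : M, TangentSpace I x) → M → ℝ}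
    {B : F → V →L[ℝ] V →L[ℝ] ℝ} (he : e ∈ 𝔣.dom) (hB : DifferentiableAt ℝ B e)
    (hBa : ∀ a b, B e a b = -B e b a)
    (hw : ∀ e ∈ 𝔣.dom, ∀ X Y, w X Y (𝔣.param e) = B e (𝔣.comp X e) (𝔣.comp Y e))
    {X Y Z : Π x : M, TangentSpace I x}
    (hX : MDifferentiableAt I I.tangent (fun x ↦ (⟨x, X x⟩ : TangentBundle I M)) (𝔣.param e))
    (hY : MDifferentiableAt I I.tangent (fun x ↦ (⟨x, Y x⟩ : TangentBundle I M)) (𝔣.param e))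
    (hZ : MDifferentiableAt I I.tangent (fun x ↦ (⟨x, Z x⟩ : TangentBundle I M)) (𝔣.param e)) :
    extDerivTwo I w X Y Z (𝔣.param e) =
      𝔣.der B e (𝔣.comp X e) (𝔣.comp Y e) (𝔣.comp Z e)
      - 𝔣.der B e (𝔣.comp Y e) (𝔣.comp X e) (𝔣.comp Z e)
      + 𝔣.der B e (𝔣.comp Z e) (𝔣.comp X e) (𝔣.comp Y e)
      - B e (𝔣.bracket (𝔣.comp X e) (𝔣.comp Y e)) (𝔣.comp Z e)
      + B e (𝔣.bracket (𝔣.comp X e) (𝔣.comp Z e)) (𝔣.comp Y e)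
      - B e (𝔣.bracket (𝔣.comp Y e) (𝔣.comp Z e)) (𝔣.comp X e) := by
  have key : ∀ {X Y : Π x : M, TangentSpace I x} (Z : Π x : M, TangentSpace I x),
      MDifferentiableAt I I.tangent (fun x ↦ (⟨x, X x⟩ : TangentBundle I M)) (𝔣.param e) →
      MDifferentiableAt I I.tangent (fun x ↦ (⟨x, Y x⟩ : TangentBundle I M)) (𝔣.param e) →
      mvfderiv I (w X Y) (𝔣.param e) (Z (𝔣.param e)) =
        𝔣.der B e (𝔣.comp Z e) (𝔣.comp X e) (𝔣.comp Y e)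
        + B e (𝔣.der (𝔣.comp X) e (𝔣.comp Z e)) (𝔣.comp Y e)
        + B e (𝔣.comp X e) (𝔣.der (𝔣.comp Y) e (𝔣.comp Z e)) := by
    intro X Y Z hX hY
    have h1 := differentiableAt_comp he hX
    have h2 := differentiableAt_comp he hY
    rw [← der_clm_apply₂ hB h1 h2]
    refine mvfderiv_eq_der_of_eventuallyEq he ?_ ((hB.clm_apply h1).clm_apply h2) _
    filter_upwards [eventually_mem_dom he] with e' he' using hw e' he' X Y
  rw [extDerivTwo, key X hY hZ, key Y hX hZ, key Z hX hY, hw e he, hw e he, hw e he,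
    comp_mlieBracket he hX hY, comp_mlieBracket he hX hZ, comp_mlieBracket he hY hZ]
  simp only [map_add, map_sub, add_apply, sub_apply]
  rw [hBa (𝔣.comp Y e), hBa (𝔣.comp X e) (𝔣.der (𝔣.comp Z) e _), hBa (𝔣.comp X e)]
  ring

/-- The exterior derivative of a `3`-form with constant coefficients in a coframe. -/
theorem extDerivThree_eq
    {η : (Π x : M, TangentSpace I x) → (Π x : M, TangentSpace I x) →
      (Π x : M, TangentSpace I x) → M → ℝ}
    {g : V →L[ℝ] V →L[ℝ] ℝ} {L : V →L[ℝ] V →L[ℝ] V} (he : e ∈ 𝔣.dom)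
    (hT₁ : ∀ a b c, g (L a b) c = -g (L b a) c) (hT₂ : ∀ a b c, g (L a b) c = -g (L a c) b)
    (hη : ∀ e ∈ 𝔣.dom, ∀ X Y Z, IsSmoothField I X → IsSmoothField I Y → IsSmoothField I Z →
      η X Y Z (𝔣.param e) = g (L (𝔣.comp X e) (𝔣.comp Y e)) (𝔣.comp Z e))
    {X₀ X₁ X₂ X₃ : Π x : M, TangentSpace I x} (h₀ : IsSmoothField I X₀) (h₁ : IsSmoothField I X₁)
    (h₂ : IsSmoothField I X₂) (h₃ : IsSmoothField I X₃) :
    extDerivThree I η X₀ X₁ X₂ X₃ (𝔣.param e) =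
      - g (L (𝔣.bracket (𝔣.comp X₀ e) (𝔣.comp X₁ e)) (𝔣.comp X₂ e)) (𝔣.comp X₃ e)
      + g (L (𝔣.bracket (𝔣.comp X₀ e) (𝔣.comp X₂ e)) (𝔣.comp X₁ e)) (𝔣.comp X₃ e)
      - g (L (𝔣.bracket (𝔣.comp X₀ e) (𝔣.comp X₃ e)) (𝔣.comp X₁ e)) (𝔣.comp X₂ e)
      - g (L (𝔣.bracket (𝔣.comp X₁ e) (𝔣.comp X₂ e)) (𝔣.comp X₀ e)) (𝔣.comp X₃ e)
      + g (L (𝔣.bracket (𝔣.comp X₁ e) (𝔣.comp X₃ e)) (𝔣.comp X₀ e)) (𝔣.comp X₂ e)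
      - g (L (𝔣.bracket (𝔣.comp X₂ e) (𝔣.comp X₃ e)) (𝔣.comp X₀ e)) (𝔣.comp X₁ e) := by
  have hd : ∀ {X : Π x : M, TangentSpace I x}, IsSmoothField I X →
      DifferentiableAt ℝ (𝔣.comp X) e := fun h ↦ differentiableAt_comp he (h.mdifferentiableAt _)
  have key : ∀ {X Y Z : Π x : M, TangentSpace I x} (W : Π x : M, TangentSpace I x),
      IsSmoothField I X → IsSmoothField I Y → IsSmoothField I Z →
      mvfderiv I (η X Y Z) (𝔣.param e) (W (𝔣.param e)) =
        g (L (𝔣.der (𝔣.comp X) e (𝔣.comp W e)) (𝔣.comp Y e)) (𝔣.comp Z e)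
        + g (L (𝔣.comp X e) (𝔣.der (𝔣.comp Y) e (𝔣.comp W e))) (𝔣.comp Z e)
        + g (L (𝔣.comp X e) (𝔣.comp Y e)) (𝔣.der (𝔣.comp Z) e (𝔣.comp W e)) := by
    intro X Y Z W hX hY hZ
    have hL : DifferentiableAt ℝ (fun _ : F ↦ L) e := differentiableAt_const _
    have hg : DifferentiableAt ℝ (fun _ : F ↦ g) e := differentiableAt_const _
    have hL0 : 𝔣.der (fun _ ↦ L) e = 0 := by simp [der]
    have hg0 : 𝔣.der (fun _ ↦ g) e = 0 := by simp [der]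
    have h1 := (hL.clm_apply (hd hX)).clm_apply (hd hY)
    refine (mvfderiv_eq_der_of_eventuallyEq he
      (k := fun e ↦ g (L (𝔣.comp X e) (𝔣.comp Y e)) (𝔣.comp Z e)) ?_
      ((hg.clm_apply h1).clm_apply (hd hZ)) _).trans ?_
    rotate_left
    · rw [der_clm_apply₂ hg h1 (hd hZ), der_clm_apply₂ hL (hd hX) (hd hY), hL0, hg0]
      simp; rfl
    · filter_upwards [eventually_mem_dom he] with e' he' using hη e' he' X Y Z hX hY hZ
  have hb : ∀ {X Y : Π x : M, TangentSpace I x}, IsSmoothField I X → IsSmoothField I Y →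
      𝔣.comp (mlieBracket I X Y) e = 𝔣.der (𝔣.comp Y) e (𝔣.comp X e)
      - 𝔣.der (𝔣.comp X) e (𝔣.comp Y e) + 𝔣.bracket (𝔣.comp X e) (𝔣.comp Y e) := fun hX hY ↦
    comp_mlieBracket he (hX.mdifferentiableAt _) (hY.mdifferentiableAt _)
  rw [extDerivThree, key X₀ h₁ h₂ h₃, key X₁ h₀ h₂ h₃, key X₂ h₀ h₁ h₃, key X₃ h₀ h₁ h₂,
    hη e he _ _ _ (h₀.mlieBracket h₁) h₂ h₃, hη e he _ _ _ (h₀.mlieBracket h₂) h₁ h₃,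
    hη e he _ _ _ (h₀.mlieBracket h₃) h₁ h₂, hη e he _ _ _ (h₁.mlieBracket h₂) h₀ h₃,
    hη e he _ _ _ (h₁.mlieBracket h₃) h₀ h₂, hη e he _ _ _ (h₂.mlieBracket h₃) h₀ h₁,
    hb h₀ h₁, hb h₀ h₂, hb h₀ h₃, hb h₁ h₂, hb h₁ h₃, hb h₂ h₃]
  simp only [map_add, map_sub, add_apply, sub_apply]
  have r₁ : ∀ (i k : Π x : M, TangentSpace I x) (d : V),
      g (L (𝔣.comp i e) d) (𝔣.comp k e) = - g (L d (𝔣.comp i e)) (𝔣.comp k e) := fun i k d ↦ hT₁ _ _ _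
  have r₂ : ∀ (i j : Π x : M, TangentSpace I x) (d : V),
      g (L (𝔣.comp i e) (𝔣.comp j e)) d = g (L d (𝔣.comp i e)) (𝔣.comp j e) := fun i j d ↦ by
    rw [hT₂, hT₁, neg_neg]
  simp only [r₂ X₁ X₂, r₂ X₀ X₂, r₂ X₀ X₁, r₁ X₀ X₂, r₁ X₀ X₃, r₁ X₁ X₃]
  ring

end Coframe

/-! ### Connections at a point -/

section ConnectionAt

variable {E : Type*} [NormedAddCommGroup E] [NormedSpace ℝ E]
    {H : Type*} [TopologicalSpace H] (I : ModelWithCorners ℝ E H)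
    {M : Type*} [TopologicalSpace M] [ChartedSpace H M]

/-- The value at the point `x` of an affine connection. -/
structure IsConnectionAt [IsManifold I ∞ M] (x : M)
    (D : (Π x : M, TangentSpace I x) → TangentSpace I x →L[ℝ] TangentSpace I x) : Prop where
  add : ∀ {σ σ' : Π x : M, TangentSpace I x},
    MDifferentiableAt I I.tangent (fun x ↦ (⟨x, σ x⟩ : TangentBundle I M)) x →
    MDifferentiableAt I I.tangent (fun x ↦ (⟨x, σ' x⟩ : TangentBundle I M)) x →
    D (σ + σ') = D σ + D σ'
  leibniz : ∀ {σ : Π x : M, TangentSpace I x} {f : M → ℝ},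
    MDifferentiableAt I I.tangent (fun x ↦ (⟨x, σ x⟩ : TangentBundle I M)) x →
    MDifferentiableAt I 𝓘(ℝ) f x →
    D (f • σ) = f x • D σ + (mvfderiv I f x).smulRight (σ x)

variable {I} [IsManifold I ∞ M] {x : M}

theorem IsConnectionAt.of_connection (nabla : AffineConnection I M) (x : M) :
    IsConnectionAt I x (fun σ ↦ nabla σ x) where
  add hσ hσ' := nabla.isCovariantDerivativeOnUniv.add hσ hσ'
  leibniz hσ hf := nabla.isCovariantDerivativeOnUniv.leibniz hσ hf

open Classical in
/-- A connection at a point as a family over all points. -/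
def extendConnection (D : (Π x : M, TangentSpace I x) → TangentSpace I x →L[ℝ] TangentSpace I x)
    (σ : Π x : M, TangentSpace I x) (y : M) : TangentSpace I y →L[ℝ] TangentSpace I y :=
  if h : y = x then h ▸ D σ else 0

omit [IsManifold I ∞ M] in
theorem extendConnection_self
    (D : (Π x : M, TangentSpace I x) → TangentSpace I x →L[ℝ] TangentSpace I x)
    (σ : Π x : M, TangentSpace I x) : extendConnection D σ x = D σ := by
  simp [extendConnection]

theorem IsConnectionAt.isCovariantDerivativeOn
    {D : (Π x : M, TangentSpace I x) → TangentSpace I x →L[ℝ] TangentSpace I x}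
    (h : IsConnectionAt I x D) :
    IsCovariantDerivativeOn (I := I) (V := (TangentSpace I : M → Type _)) E
      (extendConnection D) {x} where
  add := by
    rintro σ σ' y hσ hσ' rfl
    simpa only [extendConnection_self] using h.add hσ hσ'
  leibniz := by
    rintro σ f y hσ hf rfl
    simpa only [extendConnection_self] using h.leibniz hσ hf

theorem exists_connection
    {D : Π x : M, (Π x : M, TangentSpace I x) → TangentSpace I x →L[ℝ] TangentSpace I x}
    (h : ∀ x, IsConnectionAt I x (D x)) :
    ∃ nabla : AffineConnection I M, ∀ σ x, nabla σ x = D x σ :=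
  ⟨⟨fun σ x ↦ D x σ, fun hσ hσ' _ ↦ (h _).add hσ hσ', fun hσ hf _ ↦ (h _).leibniz hσ hf⟩,
    fun _ _ ↦ rfl⟩

variable [FiniteDimensional ℝ E]

theorem IsConnectionAt.exists_difference
    {D D' : (Π x : M, TangentSpace I x) → TangentSpace I x →L[ℝ] TangentSpace I x}
    (h : IsConnectionAt I x D) (h' : IsConnectionAt I x D') :
    ∃ T : TangentSpace I x →L[ℝ] TangentSpace I x →L[ℝ] TangentSpace I x,
      ∀ σ : Π x : M, TangentSpace I x,
      MDifferentiableAt I I.tangent (fun x ↦ (⟨x, σ x⟩ : TangentBundle I M)) x →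
      T (σ x) = D σ - D' σ :=
  ⟨IsCovariantDerivativeOn.difference h.isCovariantDerivativeOn h'.isCovariantDerivativeOn x,
    fun σ hσ ↦ by
      simpa only [extendConnection_self] using
        IsCovariantDerivativeOn.difference_apply h.isCovariantDerivativeOn
          h'.isCovariantDerivativeOn (by trivial) hσ⟩

/-- `∇ g = 0` at the point `x`. -/
def IsMetricAt (g : SmoothMetric I M) (x : M)
    (D : (Π x : M, TangentSpace I x) → TangentSpace I x →L[ℝ] TangentSpace I x) : Prop :=
  ∀ Y Z : Π x : M, TangentSpace I x, IsSmoothField I Y → IsSmoothField I Z →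
    ∀ u : TangentSpace I x, mvfderiv I (fun y ↦ g.inner y (Y y) (Z y)) x u =
      g.inner x (D Y u) (Z x) + g.inner x (Y x) (D Z u)

omit [FiniteDimensional ℝ E] in
variable (I) in
/-- The torsion on vector fields of a connection at a point. -/
def torsionAt (x : M) (D : (Π x : M, TangentSpace I x) → TangentSpace I x →L[ℝ] TangentSpace I x)
    (X Y : Π x : M, TangentSpace I x) : TangentSpace I x :=
  D Y (X x) - D X (Y x) - mlieBracket I X Y x

variable [T2Space M]

omit [FiniteDimensional ℝ E] [T2Space M] in
theorem eq_of_inner_eq (g : SmoothMetric I M) {u v : TangentSpace I x}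
    (h : ∀ w, g.inner x u w = g.inner x v w) : u = v := by
  by_contra hne
  have h1 := g.pos x (u - v) (sub_ne_zero.2 hne)
  rw [map_sub, map_sub, sub_apply, sub_apply, h, h] at h1
  simp at h1

/-- A torsion free metric connection is determined by the metric, point by point. -/
theorem levi_civita_unique (g : SmoothMetric I M)
    {D D' : (Π x : M, TangentSpace I x) → TangentSpace I x →L[ℝ] TangentSpace I x}
    (hD : IsConnectionAt I x D) (hD' : IsConnectionAt I x D')
    (hg : IsMetricAt g x D) (hg' : IsMetricAt g x D')
    (ht : ∀ X Y, IsSmoothField I X → IsSmoothField I Y → torsionAt I x D X Y = 0)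
    (ht' : ∀ X Y, IsSmoothField I X → IsSmoothField I Y → torsionAt I x D' X Y = 0)
    {σ : Π x : M, TangentSpace I x}
    (hσ : MDifferentiableAt I I.tangent (fun x ↦ (⟨x, σ x⟩ : TangentBundle I M)) x) :
    D σ = D' σ := by
  obtain ⟨T, hT⟩ := hD.exists_difference hD'
  have hTs : ∀ X, IsSmoothField I X → T (X x) = D X - D' X := fun X hX ↦
    hT X (hX.mdifferentiableAt x)
  have h1 : ∀ u v w, g.inner x (T v u) w = -g.inner x (T w u) v := by
    intro u v w
    obtain ⟨Y, hY, rfl⟩ := exists_isSmoothField_eq x v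
    obtain ⟨Z, hZ, rfl⟩ := exists_isSmoothField_eq x w
    have h2 := (hg Y Z hY hZ u).symm.trans (hg' Y Z hY hZ u)
    rw [hTs Y hY, hTs Z hZ, g.symm x _ (Y x)]
    simp only [sub_apply, map_sub]
    linarith
  have h2 : ∀ u v, T v u = T u v := by
    intro u v
    obtain ⟨Y, hY, rfl⟩ := exists_isSmoothField_eq x v
    obtain ⟨X, hX, rfl⟩ := exists_isSmoothField_eq x u
    have h3 := (ht X Y hX hY).trans (ht' X Y hX hY).symm
    rw [torsionAt, torsionAt, sub_left_inj] at h3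
    rw [hTs Y hY, hTs X hX, sub_apply, sub_apply, sub_eq_sub_iff_sub_eq_sub]
    rw [sub_eq_sub_iff_sub_eq_sub] at h3
    rw [sub_eq_sub_iff_add_eq_add] at h3 ⊢
    rw [h3, add_comm]
  rw [← sub_eq_zero, ← hT σ hσ]
  ext u
  refine eq_of_inner_eq (x := x) g fun w ↦ ?_
  have h0 : g.inner x (T (σ x) u) w = 0 := by
    have s : ∀ a b c, g.inner x (T a b) c = g.inner x (T b a) c := fun a b c ↦ by rw [h2]
    have a1 := h1 u (σ x) w
    have a2 := h1 w u (σ x)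
    have a3 := h1 (σ x) w u
    have b1 := s w u (σ x)
    have b2 := s (σ x) w u
    have b3 := s (σ x) u w
    linarith
  rw [h0]; simp

end ConnectionAt

section BismutAt

variable {E : Type*} [NormedAddCommGroup E] [NormedSpace ℝ E]
    {H : Type*} [TopologicalSpace H] {I : ModelWithCorners ℝ E H}
    {M : Type*} [TopologicalSpace M] [ChartedSpace H M] [IsManifold I ∞ M] {x : M}

/-- The properties of the Bismut connection at the point `x`. -/
structure IsBismutAt (S : HermitianStructure I M) (x : M)
    (D : (Π x : M, TangentSpace I x) → TangentSpace I x →L[ℝ] TangentSpace I x) : Prop where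
  isConnectionAt : IsConnectionAt I x D
  isMetricAt : IsMetricAt S.metric x D
  applyJ : ∀ Y : Π x : M, TangentSpace I x, IsSmoothField I Y → ∀ u : TangentSpace I x,
    D (S.applyJ Y) u = S.J x (D Y u)
  torsion : ∀ X Y Z : Π x : M, TangentSpace I x,
    IsSmoothField I X → IsSmoothField I Y → IsSmoothField I Z →
    S.metric.inner x (torsionAt I x D X Y) (Z x) = -S.metric.inner x (torsionAt I x D X Z) (Y x)

variable [FiniteDimensional ℝ E]

theorem torsionAt_connection (nabla : AffineConnection I M) {X Y : Π x : M, TangentSpace I x}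
    (hX : IsSmoothField I X) (hY : IsSmoothField I Y) :
    torsionAt I x (fun σ ↦ nabla σ x) X Y = nabla.torsion x (X x) (Y x) :=
  (nabla.torsion_apply (hX.mdifferentiableAt x) (hY.mdifferentiableAt x)).symm

theorem HermitianStructure.IsBismut.isBismutAt {S : HermitianStructure I M}
    {nabla : AffineConnection I M} (h : S.IsBismut nabla) (x : M) :
    IsBismutAt S x (fun σ ↦ nabla σ x) where
  isConnectionAt := .of_connection nabla x
  isMetricAt Y Z hY hZ u := h.1 Y Z hY hZ x u
  applyJ Y hY u := h.2.1 Y hY x u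
  torsion X Y Z hX hY hZ := by
    rw [torsionAt_connection nabla hX hY, torsionAt_connection nabla hX hZ]
    exact h.2.2 x _ _ _

variable [T2Space M]

theorem isBismut_of_isBismutAt {S : HermitianStructure I M} {nabla : AffineConnection I M}
    (h : ∀ x, IsBismutAt S x (fun σ ↦ nabla σ x)) : S.IsBismut nabla := by
  refine ⟨fun Y Z hY hZ x u ↦ (h x).isMetricAt Y Z hY hZ u, fun Y hY x u ↦ (h x).applyJ Y hY u,
    fun x u v w ↦ ?_⟩
  obtain ⟨X, hX, rfl⟩ := exists_isSmoothField_eq x u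
  obtain ⟨Y, hY, rfl⟩ := exists_isSmoothField_eq x v
  obtain ⟨Z, hZ, rfl⟩ := exists_isSmoothField_eq x w
  have := (h x).torsion X Y Z hX hY hZ
  rwa [torsionAt_connection nabla hX hY, torsionAt_connection nabla hX hZ] at this

/-- The Bismut connection is unique. -/
theorem IsBismutAt.unique {S : HermitianStructure I M}
    {D D' : (Π x : M, TangentSpace I x) → TangentSpace I x →L[ℝ] TangentSpace I x}
    (h : IsBismutAt S x D) (h' : IsBismutAt S x D')
    (hJ : ∀ X, IsSmoothField I X → MDifferentiableAt I I.tangent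
      (fun x ↦ (⟨x, S.applyJ X x⟩ : TangentBundle I M)) x)
    {σ : Π x : M, TangentSpace I x}
    (hσ : MDifferentiableAt I I.tangent (fun x ↦ (⟨x, σ x⟩ : TangentBundle I M)) x) :
    D σ = D' σ := by
  obtain ⟨T, hT⟩ := h.isConnectionAt.exists_difference h'.isConnectionAt
  have hTs : ∀ X, IsSmoothField I X → T (X x) = D X - D' X := fun X hX ↦
    hT X (hX.mdifferentiableAt x)
  set g := S.metric.inner x with hg
  have hs : ∀ a b, g a b = g b a := S.metric.symm x
  have h1 : ∀ u v w, g (T v u) w = -g (T w u) v := by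
    intro u v w
    obtain ⟨Y, hY, rfl⟩ := exists_isSmoothField_eq x v
    obtain ⟨Z, hZ, rfl⟩ := exists_isSmoothField_eq x w
    have h2 := (h.isMetricAt Y Z hY hZ u).symm.trans (h'.isMetricAt Y Z hY hZ u)
    rw [← hg, hs (Y x), hs (Y x)] at h2
    rw [hTs Y hY, hTs Z hZ]
    simp only [sub_apply, map_sub]
    linarith
  have h2 : ∀ u v, T (S.J x v) u = S.J x (T v u) := by
    intro u v
    obtain ⟨Y, hY, rfl⟩ := exists_isSmoothField_eq x v
    have := hT (S.applyJ Y) (hJ Y hY)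
    rw [HermitianStructure.applyJ] at this
    rw [this, hTs Y hY, sub_apply, sub_apply, map_sub, ← h.applyJ Y hY, ← h'.applyJ Y hY]
  have h3 : ∀ u v w, g (T v u - T u v) w = -g (T w u - T u w) v := by
    intro u v w
    obtain ⟨X, hX, rfl⟩ := exists_isSmoothField_eq x u
    obtain ⟨Y, hY, rfl⟩ := exists_isSmoothField_eq x v
    obtain ⟨Z, hZ, rfl⟩ := exists_isSmoothField_eq x w
    have a := h.torsion X Y Z hX hY hZ
    have b := h'.torsion X Y Z hX hY hZ
    rw [← hg] at a b
    rw [hTs X hX, hTs Y hY, hTs Z hZ]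
    simp only [torsionAt, sub_apply, map_sub] at a b ⊢
    linarith
  have hJJ : ∀ a b, g (S.J x a) b = - g a (S.J x b) := fun a b ↦ by
    rw [← S.compatible x a, S.J_sq, map_neg, neg_neg]
  rw [← sub_eq_zero, ← hT σ hσ]
  ext u
  refine eq_of_inner_eq (x := x) S.metric fun w ↦ ?_
  have t : ∀ u v w, g (T v u) w = - g (T u v) w := by
    intro u v w
    have a := h3 v u w
    have a1 := h1 v u w
    have a2 := h1 w u v
    have a3 := h3 w u v
    have a4 := h1 u v w
    simp only [sub_apply, map_sub] at a a3
    linarith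
  have q : ∀ u v w, g (T (S.J x v) u) w = - g (T v u) (S.J x w) := by
    intro u v w
    rw [h2, hJJ]
  have h0 : g (T (σ x) u) (S.J x (S.J x w)) = 0 := by
    have q1 := q u (σ x) (S.J x w)
    have q2 := q (σ x) u (S.J x w)
    have q3 := q (S.J x w) u (σ x)
    have t1 := t u (σ x) (S.J x (S.J x w))
    have t2 := t u (S.J x (σ x)) (S.J x w)
    have t3 := t (S.J x u) (σ x) (S.J x w)
    have t4 := t u (S.J x w) (S.J x (σ x))
    have s1 := h1 u (S.J x (σ x)) (S.J x w)
    have s2 := h1 (σ x) (S.J x u) (S.J x w)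
    have s3 := h1 (S.J x w) (S.J x u) (σ x)
    have s4 := h1 (S.J x w) u (S.J x (σ x))
    have t5 := t (σ x) (S.J x w) (S.J x u)
    have t6 := t (S.J x u) (S.J x w) (σ x)
    linarith
  rw [S.J_sq, map_neg, neg_eq_zero] at h0
  rw [← hg, h0]; simp

end BismutAt

namespace Coframe

variable {E : Type*} [NormedAddCommGroup E] [NormedSpace ℝ E] [CompleteSpace E]
    {H : Type*} [TopologicalSpace H] {I : ModelWithCorners ℝ E H}
    {M : Type*} [TopologicalSpace M] [ChartedSpace H M] [IsManifold I ∞ M]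
    {F : Type*} [NormedAddCommGroup F] [NormedSpace ℝ F] [CompleteSpace F]
    {V : Type*} [NormedAddCommGroup V] [NormedSpace ℝ V] (𝔣 : Coframe I M F V) {e : F}

/-- The connection with Christoffel symbols `A` in the given coframe, at one point. -/
def connection (e : F) (A : V →L[ℝ] V →L[ℝ] V) (σ : Π x : M, TangentSpace I x) :
    TangentSpace I (𝔣.param e) →L[ℝ] TangentSpace I (𝔣.param e) :=
  (𝔣.vec e).comp ((𝔣.der (𝔣.comp σ) e + A.flip (𝔣.comp σ e)).comp (𝔣.toModel e))

variable {𝔣}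

omit [IsManifold I ∞ M] [CompleteSpace E] [CompleteSpace F] in
theorem toModel_connection (he : e ∈ 𝔣.dom) (A : V →L[ℝ] V →L[ℝ] V)
    (σ : Π x : M, TangentSpace I x) (u : TangentSpace I (𝔣.param e)) :
    𝔣.toModel e (𝔣.connection e A σ u) =
      𝔣.der (𝔣.comp σ) e (𝔣.toModel e u) + A (𝔣.toModel e u) (𝔣.comp σ e) := by
  exact toModel_vec he _

omit [CompleteSpace E] in
theorem isConnectionAt_connection (he : e ∈ 𝔣.dom) (A : V →L[ℝ] V →L[ℝ] V) :
    IsConnectionAt I (𝔣.param e) (𝔣.connection e A) where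
  add {σ σ'} hσ hσ' := by
    ext u
    refine toModel_injective he ?_
    have h1 : 𝔣.comp (σ + σ') = 𝔣.comp σ + 𝔣.comp σ' := by
      ext e'; exact map_add (𝔣.toModel e') _ _
    have h2 : 𝔣.toModel e ((𝔣.connection e A σ + 𝔣.connection e A σ') u) =
      𝔣.toModel e (𝔣.connection e A σ u) + 𝔣.toModel e (𝔣.connection e A σ' u) :=
        map_add (𝔣.toModel e) _ _
    rw [h2, toModel_connection he, toModel_connection he, toModel_connection he, h1, der, der, der,
      fderiv_add (differentiableAt_comp he hσ) (differentiableAt_comp he hσ')]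
    simp only [Pi.add_apply, map_add, ContinuousLinearMap.comp_apply, add_apply]
    abel
  leibniz {σ f} hσ hf := by
    ext u
    refine toModel_injective he ?_
    have h1 : 𝔣.comp (f • σ) = fun e ↦ f (𝔣.param e) • 𝔣.comp σ e := by
      ext e'; exact map_smul (𝔣.toModel e') _ _
    have hfd : DifferentiableAt ℝ (f ∘ 𝔣.param) e :=
      (hf.comp e ((𝔣.diffeo e he).mdifferentiableAt (by simp))).differentiableAt
    have h2 : 𝔣.toModel e ((f (𝔣.param e) • 𝔣.connection e A σ +
        (mvfderiv I f (𝔣.param e)).smulRight (σ (𝔣.param e))) u) =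
        f (𝔣.param e) • 𝔣.toModel e (𝔣.connection e A σ u) +
          mvfderiv I f (𝔣.param e) u • 𝔣.comp σ e := by
      refine (map_add (𝔣.toModel e) _ _).trans ?_
      congr 1
      · exact map_smul (𝔣.toModel e) _ _
      · exact map_smul (𝔣.toModel e) _ _
    rw [h2, toModel_connection he, toModel_connection he, mvfderiv_eq_der he hfd, h1, der, der, der]
    have h3 := fderiv_fun_smul hfd (differentiableAt_comp he hσ)
    simp only [Function.comp_apply] at h3
    rw [h3]
    simp only [map_smul, ContinuousLinearMap.comp_apply, add_apply, smul_add,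
      _root_.smul_apply, ContinuousLinearMap.smulRight_apply, Function.comp_def]
    abel

omit [CompleteSpace E] in
theorem isMetricAt_connection (he : e ∈ 𝔣.dom) {A : V →L[ℝ] V →L[ℝ] V} {g : SmoothMetric I M}
    {B : F → V →L[ℝ] V →L[ℝ] ℝ} (hB : DifferentiableAt ℝ B e)
    (hg : ∀ e ∈ 𝔣.dom, ∀ u v : TangentSpace I (𝔣.param e), g.inner (𝔣.param e) u v = B e (𝔣.toModel e u) (𝔣.toModel e v))
    (hA : ∀ a b c, 𝔣.der B e a b c = B e (A a b) c + B e b (A a c)) :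
    IsMetricAt g (𝔣.param e) (𝔣.connection e A) := by
  intro Y Z hY hZ u
  have hY' := differentiableAt_comp he (hY.mdifferentiableAt (𝔣.param e))
  have hZ' := differentiableAt_comp he (hZ.mdifferentiableAt (𝔣.param e))
  rw [hg e he, hg e he]
  refine (mvfderiv_eq_der_of_eventuallyEq he (k := fun e ↦ B e (𝔣.comp Y e) (𝔣.comp Z e)) ?_
    ((hB.clm_apply hY').clm_apply hZ') u).trans ?_
  · filter_upwards [eventually_mem_dom he] with e' he' using hg e' he' _ _
  · rw [der_clm_apply₂ hB hY' hZ', toModel_connection he, toModel_connection he, hA]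
    change _ = B e (𝔣.der (𝔣.comp Y) e (𝔣.toModel e u) + A (𝔣.toModel e u) (𝔣.comp Y e))
      (𝔣.comp Z e) + B e (𝔣.comp Y e) _
    simp only [map_add, add_apply]
    ring

theorem toModel_torsionAt_connection (he : e ∈ 𝔣.dom) {A : V →L[ℝ] V →L[ℝ] V}
    {X Y : Π x : M, TangentSpace I x} (hX : IsSmoothField I X) (hY : IsSmoothField I Y) :
    𝔣.toModel e (torsionAt I (𝔣.param e) (𝔣.connection e A) X Y) =
      A (𝔣.comp X e) (𝔣.comp Y e) - A (𝔣.comp Y e) (𝔣.comp X e)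
        - 𝔣.bracket (𝔣.comp X e) (𝔣.comp Y e) := by
  have h1 : 𝔣.toModel e (torsionAt I (𝔣.param e) (𝔣.connection e A) X Y) =
      𝔣.toModel e (𝔣.connection e A Y (X (𝔣.param e)))
      - 𝔣.toModel e (𝔣.connection e A X (Y (𝔣.param e))) - 𝔣.comp (mlieBracket I X Y) e := by
    refine (map_sub (𝔣.toModel e) _ _).trans ?_
    congr 1
    exact map_sub (𝔣.toModel e) _ _
  rw [h1, toModel_connection he, toModel_connection he,
    comp_mlieBracket he (hX.mdifferentiableAt _) (hY.mdifferentiableAt _)]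
  change (𝔣.der (𝔣.comp Y) e (𝔣.comp X e) + A (𝔣.comp X e) (𝔣.comp Y e)) -
    (𝔣.der (𝔣.comp X) e (𝔣.comp Y e) + A (𝔣.comp Y e) (𝔣.comp X e)) - _ = _
  abel

omit [CompleteSpace E] [CompleteSpace F] in
theorem comp_applyJ {S : HermitianStructure I M} {J : V →L[ℝ] V}
    (hJ : ∀ e ∈ 𝔣.dom, ∀ u : TangentSpace I (𝔣.param e), 𝔣.toModel e (S.J (𝔣.param e) u) = J (𝔣.toModel e u))
    (he : e ∈ 𝔣.dom) (X : Π x : M, TangentSpace I x) :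
    𝔣.comp (S.applyJ X) e = J (𝔣.comp X e) := hJ e he _

theorem mdifferentiableAt_applyJ {S : HermitianStructure I M} {J : V →L[ℝ] V}
    (hJ : ∀ e ∈ 𝔣.dom, ∀ u : TangentSpace I (𝔣.param e), 𝔣.toModel e (S.J (𝔣.param e) u) = J (𝔣.toModel e u))
    (he : e ∈ 𝔣.dom) {X : Π x : M, TangentSpace I x}
    (hX : MDifferentiableAt I I.tangent (fun x ↦ (⟨x, X x⟩ : TangentBundle I M)) (𝔣.param e)) :
    MDifferentiableAt I I.tangent (fun x ↦ (⟨x, S.applyJ X x⟩ : TangentBundle I M)) (𝔣.param e) :=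
  mdifferentiableAt_of_comp he <|
    (J.differentiableAt.comp e (differentiableAt_comp he hX)).congr_of_eventuallyEq <| by
      filter_upwards [eventually_mem_dom he] with e' he' using comp_applyJ hJ he' X

theorem isBismutAt_connection (he : e ∈ 𝔣.dom) {A : V →L[ℝ] V →L[ℝ] V}
    {S : HermitianStructure I M}
    {B : F → V →L[ℝ] V →L[ℝ] ℝ} (hB : DifferentiableAt ℝ B e)
    (hg : ∀ e ∈ 𝔣.dom, ∀ u v : TangentSpace I (𝔣.param e),
      S.metric.inner (𝔣.param e) u v = B e (𝔣.toModel e u) (𝔣.toModel e v))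
    (hA : ∀ a b c, 𝔣.der B e a b c = B e (A a b) c + B e b (A a c))
    {J : V →L[ℝ] V}
    (hJ : ∀ e ∈ 𝔣.dom, ∀ u : TangentSpace I (𝔣.param e), 𝔣.toModel e (S.J (𝔣.param e) u) = J (𝔣.toModel e u))
    (hAJ : ∀ a b, A a (J b) = J (A a b))
    (hAt : ∀ a b c, B e (A a b - A b a - 𝔣.bracket a b) c =
      -B e (A a c - A c a - 𝔣.bracket a c) b) :
    IsBismutAt S (𝔣.param e) (𝔣.connection e A) where
  isConnectionAt := isConnectionAt_connection he A
  isMetricAt := isMetricAt_connection he hB hg hA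
  applyJ Y hY u := by
    refine toModel_injective he ?_
    have h1 : 𝔣.der (𝔣.comp (S.applyJ Y)) e = J.comp (𝔣.der (𝔣.comp Y) e) := by
      have h2 : 𝔣.comp (S.applyJ Y) =ᶠ[𝓝 e] J ∘ 𝔣.comp Y := by
        filter_upwards [eventually_mem_dom he] with e' he' using comp_applyJ hJ he' Y
      rw [der, h2.fderiv_eq, fderiv_comp e J.differentiableAt
        (differentiableAt_comp he (hY.mdifferentiableAt _)), J.fderiv]
      rfl
    rw [hJ e he, toModel_connection he, toModel_connection he, h1, comp_applyJ hJ he, hAJ, map_add]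
    rfl
  torsion X Y Z hX hY hZ := by
    rw [hg e he, hg e he, toModel_torsionAt_connection he hX hY,
      toModel_torsionAt_connection he hX hZ]
    exact hAt _ _ _

/-- The curvature of a connection in a coframe. -/
theorem toModel_curvature (he : e ∈ 𝔣.dom) {A : F → V →L[ℝ] V →L[ℝ] V}
    (hA : DifferentiableAt ℝ A e) {nabla : AffineConnection I M}
    (hn : ∀ᶠ e in 𝓝 e, ∀ σ : Π x : M, TangentSpace I x,
      MDifferentiableAt I I.tangent (fun x ↦ (⟨x, σ x⟩ : TangentBundle I M)) (𝔣.param e) →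
      nabla σ (𝔣.param e) = 𝔣.connection e (A e) σ)
    {X Y Z : Π x : M, TangentSpace I x} (hX : IsSmoothField I X) (hY : IsSmoothField I Y)
    (hcZ : ContDiffAt ℝ 2 (𝔣.comp Z) e) :
    𝔣.toModel e (curvature nabla X Y Z (𝔣.param e)) =
      𝔣.der A e (𝔣.comp X e) (𝔣.comp Y e) (𝔣.comp Z e)
      - 𝔣.der A e (𝔣.comp Y e) (𝔣.comp X e) (𝔣.comp Z e)
      + A e (𝔣.comp X e) (A e (𝔣.comp Y e) (𝔣.comp Z e))
      - A e (𝔣.comp Y e) (A e (𝔣.comp X e) (𝔣.comp Z e))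
      - A e (𝔣.bracket (𝔣.comp X e) (𝔣.comp Y e)) (𝔣.comp Z e) := by
  have hZ : ∀ᶠ e' in 𝓝 e, MDifferentiableAt I I.tangent
      (fun x ↦ (⟨x, Z x⟩ : TangentBundle I M)) (𝔣.param e') := by
    filter_upwards [hcZ.eventually (by simp), eventually_mem_dom he] with e' h he'
    exact mdifferentiableAt_of_comp he' (h.differentiableAt (by simp))
  have hdZ : DifferentiableAt ℝ (fderiv ℝ (𝔣.comp Z)) e :=
    (hcZ.fderiv_right (m := 1) (by norm_num)).differentiableAt (by simp)
  have hZ' : DifferentiableAt ℝ (𝔣.comp Z) e := hcZ.differentiableAt (by simp)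
  have hn' := hn.self_of_nhds
  have key : ∀ Y : Π x : M, TangentSpace I x, IsSmoothField I Y →
      DifferentiableAt ℝ (𝔣.comp (fun y ↦ nabla Z y (Y y))) e ∧
      ∀ X : Π x : M, TangentSpace I x,
        𝔣.der (𝔣.comp (fun y ↦ nabla Z y (Y y))) e (𝔣.comp X e) =
          fderiv ℝ (fderiv ℝ (𝔣.comp Z)) e (𝔣.pull X e) (𝔣.pull Y e)
          + fderiv ℝ (𝔣.comp Z) e (fderiv ℝ (𝔣.pull Y) e (𝔣.pull X e))
          + 𝔣.der A e (𝔣.comp X e) (𝔣.comp Y e) (𝔣.comp Z e)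
          + A e (𝔣.der (𝔣.comp Y) e (𝔣.comp X e)) (𝔣.comp Z e)
          + A e (𝔣.comp Y e) (𝔣.der (𝔣.comp Z) e (𝔣.comp X e)) := by
    intro Y hY
    have hY' := differentiableAt_comp he (hY.mdifferentiableAt (𝔣.param e))
    have hY'' := differentiableAt_pull he (hY.mdifferentiableAt (𝔣.param e))
    have h1 : 𝔣.comp (fun y ↦ nabla Z y (Y y)) =ᶠ[𝓝 e] (fun e ↦
        fderiv ℝ (𝔣.comp Z) e (𝔣.pull Y e)) + fun e ↦ A e (𝔣.comp Y e) (𝔣.comp Z e) := by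
      filter_upwards [hn, hZ, eventually_mem_dom he] with e' hn hZ he'
      have h2 := hn Z hZ
      change 𝔣.toModel e' (nabla Z (𝔣.param e') (Y (𝔣.param e'))) = _
      rw [h2, toModel_connection he']
      change 𝔣.der (𝔣.comp Z) e' (𝔣.comp Y e') + _ = _
      rw [der, ContinuousLinearMap.comp_apply, ContinuousLinearEquiv.coe_coe, co_symm_comp]
      rfl
    have hd1 := hdZ.clm_apply hY''
    have hd2 := (hA.clm_apply hY').clm_apply hZ'
    refine ⟨(hd1.add hd2).congr_of_eventuallyEq h1, fun X ↦ ?_⟩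
    have h3 := der_clm_apply₂ (𝔣 := 𝔣) hA hY' hZ' (𝔣.comp X e)
    rw [der, h1.fderiv_eq, fderiv_add hd1 hd2, ContinuousLinearMap.comp_apply, add_apply]
    rw [der, ContinuousLinearMap.comp_apply] at h3
    rw [h3, fderiv_clm_apply hdZ hY'', ContinuousLinearEquiv.coe_coe, co_symm_comp]
    simp
    abel
  have hsymm : fderiv ℝ (fderiv ℝ (𝔣.comp Z)) e (𝔣.pull X e) (𝔣.pull Y e) =
      fderiv ℝ (fderiv ℝ (𝔣.comp Z)) e (𝔣.pull Y e) (𝔣.pull X e) :=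
    (hcZ.isSymmSndFDerivAt (by rw [minSmoothness_of_isRCLikeNormedField])) _ _
  have hc : ∀ (W X : Π x : M, TangentSpace I x),
      MDifferentiableAt I I.tangent (fun x ↦ (⟨x, W x⟩ : TangentBundle I M)) (𝔣.param e) →
      𝔣.toModel e (nabla W (𝔣.param e) (X (𝔣.param e))) =
        𝔣.der (𝔣.comp W) e (𝔣.comp X e) + A e (𝔣.comp X e) (𝔣.comp W e) := by
    intro W X hW
    rw [hn' W hW, toModel_connection he]
    rfl
  have hval : ∀ X : Π x : M, TangentSpace I x, 𝔣.comp (fun y ↦ nabla Z y (X y)) e =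
      𝔣.der (𝔣.comp Z) e (𝔣.comp X e) + A e (𝔣.comp X e) (𝔣.comp Z e) :=
    fun X ↦ hc Z X hZ.self_of_nhds
  have h1 : 𝔣.toModel e (curvature nabla X Y Z (𝔣.param e)) =
      𝔣.toModel e (nabla (fun y ↦ nabla Z y (Y y)) (𝔣.param e) (X (𝔣.param e)))
      - 𝔣.toModel e (nabla (fun y ↦ nabla Z y (X y)) (𝔣.param e) (Y (𝔣.param e)))
      - 𝔣.toModel e (nabla Z (𝔣.param e) (mlieBracket I X Y (𝔣.param e))) := by
    refine (map_sub (𝔣.toModel e) _ _).trans ?_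
    congr 1
    exact map_sub (𝔣.toModel e) _ _
  have hb := pull_mlieBracket he (hX.mdifferentiableAt _) (hY.mdifferentiableAt _)
  rw [h1, hc _ X (mdifferentiableAt_of_comp he (key Y hY).1),
    hc _ Y (mdifferentiableAt_of_comp he (key X hX).1), hc Z _ hZ.self_of_nhds,
    (key Y hY).2, (key X hX).2, hval, hval, hsymm]
  have h5 : 𝔣.der (𝔣.comp Z) e (𝔣.comp (mlieBracket I X Y) e) =
      fderiv ℝ (𝔣.comp Z) e (fderiv ℝ (𝔣.pull Y) e (𝔣.pull X e))
      - fderiv ℝ (𝔣.comp Z) e (fderiv ℝ (𝔣.pull X) e (𝔣.pull Y e)) := by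
    rw [der, ContinuousLinearMap.comp_apply, ContinuousLinearEquiv.coe_coe, co_symm_comp, hb,
      map_sub]
  rw [h5, comp_mlieBracket he (hX.mdifferentiableAt _) (hY.mdifferentiableAt _)]
  simp only [map_add, map_sub, add_apply, sub_apply]
  abel

end Coframe

section LocalHomeomorph

variable {E : Type*} [NormedAddCommGroup E] [NormedSpace ℝ E]
  {H : Type*} [TopologicalSpace H] {I : ModelWithCorners ℝ E H}
  {N : Type*} [TopologicalSpace N] [ChartedSpace H N]
  {Q : Type*} [TopologicalSpace Q] {p : N → Q}

/-- A local inverse of a surjective local homeomorphism. -/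
def localSection (hp : IsLocalHomeomorph p) (hs : Function.Surjective p) (y : Q) :
    OpenPartialHomeomorph N Q := (hp (hs y).choose).choose

theorem coe_localSection (hp : IsLocalHomeomorph p) (hs : Function.Surjective p) (y : Q) :
    ⇑(localSection hp hs y) = p := (hp (hs y).choose).choose_spec.2.symm

theorem mem_localSection_source (hp : IsLocalHomeomorph p) (hs : Function.Surjective p) (y : Q) :
    (hs y).choose ∈ (localSection hp hs y).source := (hp (hs y).choose).choose_spec.1

theorem mem_localSection_target (hp : IsLocalHomeomorph p) (hs : Function.Surjective p) (y : Q) :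
    y ∈ (localSection hp hs y).target := by
  have h := (localSection hp hs y).map_source (mem_localSection_source hp hs y)
  rwa [coe_localSection, (hs y).choose_spec] at h

theorem localSection_symm (hp : IsLocalHomeomorph p) (hs : Function.Surjective p) (y : Q) :
    (localSection hp hs y).symm y = (hs y).choose := by
  have h := (localSection hp hs y).left_inv (mem_localSection_source hp hs y)
  rwa [coe_localSection, (hs y).choose_spec] at h

/-- The charts of the image of a surjective local homeomorphism. -/
abbrev chartedSpaceOfIsLocalHomeomorph (hp : IsLocalHomeomorph p) (hs : Function.Surjective p) :
    ChartedSpace H Q where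
  atlas := Set.range fun y ↦ (localSection hp hs y).symm ≫ₕ chartAt H (hs y).choose
  chartAt y := (localSection hp hs y).symm ≫ₕ chartAt H (hs y).choose
  mem_chart_source y := by
    simp [mem_localSection_target, localSection_symm]
  chart_mem_atlas y := ⟨y, rfl⟩

/-- Any two points of a fibre are related by a smooth deck transformation. -/
def HasDeckTransformations (I : ModelWithCorners ℝ E H) (p : N → Q) : Prop :=
  ∀ x x', p x = p x' → ∃ τ : N → N, ContMDiff I I ∞ τ ∧ τ x = x' ∧ ∀ y, p (τ y) = p y

theorem HasDeckTransformations.contMDiffAt_symm_comp (hd : HasDeckTransformations I p)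
    {e : OpenPartialHomeomorph N Q} (he : ⇑e = p) {x : N} (hx : p x ∈ e.target) :
    ContMDiffAt I I ∞ (e.symm ∘ p) x := by
  obtain ⟨τ, hτ, hτx, hpτ⟩ := hd x (e.symm (p x)) (by rw [← he] at hx ⊢; rw [e.right_inv hx])
  refine (hτ x).congr_of_eventuallyEq ?_
  have h1 : ∀ᶠ y in 𝓝 x, τ y ∈ e.source := by
    refine hτ.continuous.continuousAt.eventually_mem (e.open_source.mem_nhds ?_)
    rw [hτx]; exact e.map_target hx
  filter_upwards [h1] with y hy
  have := e.left_inv hy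
  rw [he, hpτ] at this
  exact this

variable [IsManifold I ∞ N]

theorem isManifold_of_isLocalHomeomorph (hd : HasDeckTransformations I p)
    (hp : IsLocalHomeomorph p) (hs : Function.Surjective p) :
    letI := chartedSpaceOfIsLocalHomeomorph (H := H) hp hs
    IsManifold I ∞ Q := by
  let _ := chartedSpaceOfIsLocalHomeomorph (H := H) hp hs
  refine isManifold_of_contDiffOn I ∞ Q ?_
  rintro _ _ ⟨y, rfl⟩ ⟨y', rfl⟩ u ⟨hu, hu'⟩
  set e := localSection hp hs y with he
  set e' := localSection hp hs y' with he'
  have hec : ⇑e = p := coe_localSection hp hs y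
  have hec' : ⇑e' = p := coe_localSection hp hs y'
  set x := (hs y).choose
  set x' := (hs y').choose
  simp only [OpenPartialHomeomorph.trans_source, OpenPartialHomeomorph.symm_source,
    OpenPartialHomeomorph.trans_symm_eq_symm_trans_symm, OpenPartialHomeomorph.symm_symm,
    Set.mem_preimage, Set.mem_inter_iff, OpenPartialHomeomorph.coe_trans,
    Function.comp_apply] at hu
  obtain ⟨⟨hu1, hu2⟩, hu3, hu4⟩ := hu
  rw [hec] at hu3 hu4
  refine ContDiffWithinAt.mono ?_ Set.inter_subset_right
  refine ContMDiffWithinAt.contDiffWithinAt ?_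
  have ht : u ∈ (extChartAt I x).target := by
    rw [extChartAt_target]; exact ⟨hu1, hu'⟩
  have h1 := contMDiffWithinAt_extChartAt_symm_range (n := ∞) x ht
  have h2 := hd.contMDiffAt_symm_comp hec' (x := (extChartAt I x).symm u) hu3
  have h3 : ContMDiffAt I 𝓘(ℝ, E) ∞ (extChartAt I x') ((e'.symm ∘ p) ((extChartAt I x).symm u)) :=
    contMDiffAt_extChartAt' hu4
  have h4 := (h3.comp _ h2).comp_contMDiffWithinAt u h1
  refine h4.congr (fun z _ ↦ ?_) ?_ <;>
  · change I (chartAt H x' (e'.symm (e _))) = I (chartAt H x' (e'.symm (p _)))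
    rw [hec]
    rfl

theorem isLocalDiffeomorph_of_isLocalHomeomorph (hd : HasDeckTransformations I p)
    (hp : IsLocalHomeomorph p) (hs : Function.Surjective p) :
    letI := chartedSpaceOfIsLocalHomeomorph (H := H) hp hs
    IsLocalDiffeomorph I I ∞ p := by
  let _ := chartedSpaceOfIsLocalHomeomorph (H := H) hp hs
  intro x
  obtain ⟨e, hx, he⟩ := hp x
  refine ⟨⟨e.toPartialEquiv, e.open_source, e.open_target, fun a _ ↦ ?_, fun y hy ↦ ?_⟩, hx,
    fun a _ ↦ congrFun he a⟩
  · refine ContMDiffAt.contMDiffWithinAt ?_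
    change ContMDiffAt I I ∞ e a
    rw [← he, contMDiffAt_iff_target]
    refine ⟨hp.continuous.continuousAt, ?_⟩
    have h2 := hd.contMDiffAt_symm_comp (coe_localSection hp hs (p a))
      (mem_localSection_target hp hs _)
    refine ContMDiffAt.comp (g := extChartAt I (hs (p a)).choose) a ?_ h2
    refine contMDiffAt_extChartAt' ?_
    change (localSection hp hs (p a)).symm (p a) ∈ _
    rw [localSection_symm]
    exact mem_chart_source H _
  · refine ContMDiffAt.contMDiffWithinAt ?_
    change ContMDiffAt I I ∞ e.symm y
    rw [contMDiffAt_iff_source]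
    have h1 := contMDiffWithinAt_extChartAt_symm_range_self (I := I) (n := ∞) (hs y).choose
    have hl := localSection_symm hp hs y
    have h3 : extChartAt I y y = extChartAt I (hs y).choose (hs y).choose := by
      change I ((chartAt H (hs y).choose) ((localSection hp hs y).symm y)) = _
      rw [hl]; rfl
    rw [h3]
    have h2 := hd.contMDiffAt_symm_comp he.symm
      (x := (extChartAt I (hs y).choose).symm (extChartAt I (hs y).choose (hs y).choose)) (by
        rw [extChartAt_to_inv, (hs y).choose_spec]; exact hy)
    refine (h2.comp_contMDiffWithinAt _ h1).congr (fun z _ ↦ ?_) ?_ <;>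
    · change e.symm (localSection hp hs y _) = e.symm (p _)
      rw [coe_localSection]
      rfl

end LocalHomeomorph

section Deck

variable {n : ℕ} {K G : Type*} {ΓK : Subgroup (Equiv.Perm K)} {ΓG : Subgroup (Equiv.Perm G)}

theorem deckAction_free (psi : IntLattice n →* ΓK) (rho : IntLattice n →* ΓG)
    (m : IntLattice n) (x : K × G × EuclideanSpace ℝ (Fin n))
    (h : letI := deckAction psi rho; m • x = x) : m = 1 := by
  have h1 : x.2.2 + latticeVec m = x.2.2 :=
    congrArg (fun y : K × G × EuclideanSpace ℝ (Fin n) ↦ y.2.2) h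
  have h2 : latticeVec m = 0 := by simpa using h1
  refine Multiplicative.toAdd.injective (funext fun i ↦ ?_)
  have h3 := congrArg (fun y : EuclideanSpace ℝ (Fin n) ↦ y i) h2
  simpa [latticeVec] using h3

theorem finite_setOf_norm_latticeVec_le (r : ℝ) :
    {m : IntLattice n | ‖latticeVec m‖ ≤ r}.Finite := by
  have h : (Set.univ.pi fun _ : Fin n ↦ Set.Icc (-⌈r⌉) ⌈r⌉).Finite :=
    Set.Finite.pi fun _ ↦ Set.finite_Icc _ _
  refine (h.preimage (f := fun m : IntLattice n ↦ m.toAdd)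
    (Multiplicative.toAdd.injective.injOn)).subset fun m hm i _ ↦ ?_
  have h1 : |((m.toAdd i : ℤ) : ℝ)| ≤ r :=
    (PiLp.norm_apply_le (latticeVec m) i).trans hm
  have h2 : |m.toAdd i| ≤ ⌈r⌉ := by
    have : ((|m.toAdd i| : ℤ) : ℝ) ≤ (⌈r⌉ : ℝ) := by
      push_cast; exact h1.trans (Int.le_ceil r)
    exact_mod_cast this
  exact abs_le.1 h2

theorem properlyDiscontinuousSMul_deckAction [TopologicalSpace K] [TopologicalSpace G] (psi : IntLattice n →* ΓK) (rho : IntLattice n →* ΓG) :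
    letI := deckAction psi rho
    ProperlyDiscontinuousSMul (IntLattice n) (K × G × EuclideanSpace ℝ (Fin n)) := by
  let _ := deckAction psi rho
  refine ⟨fun {A B} hA hB ↦ ?_⟩
  obtain ⟨r, hr⟩ := (hA.image (continuous_snd.comp continuous_snd)).isBounded.exists_norm_le
  obtain ⟨s, hs⟩ := (hB.image (continuous_snd.comp continuous_snd)).isBounded.exists_norm_le
  refine (finite_setOf_norm_latticeVec_le (s + r)).subset ?_
  rintro m ⟨_, ⟨x, hx, rfl⟩, hmx⟩
  have h1 := hr _ ⟨x, hx, rfl⟩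
  have h2 : ‖x.2.2 + latticeVec m‖ ≤ s := hs _ ⟨_, hmx, rfl⟩
  have h3 : latticeVec m = (x.2.2 + latticeVec m) - x.2.2 := by abel
  change ‖latticeVec m‖ ≤ s + r
  rw [h3]
  exact (norm_sub_le _ _).trans (add_le_add h2 h1)

theorem isCancelSMul_deckAction (psi : IntLattice n →* ΓK) (rho : IntLattice n →* ΓG) :
    letI := deckAction psi rho
    IsCancelSMul (IntLattice n) (K × G × EuclideanSpace ℝ (Fin n)) := by
  let _ := deckAction psi rho
  refine ⟨fun g h x hgh ↦ ?_⟩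
  have := deckAction_free psi rho (h⁻¹ * g) x (by
    change (h⁻¹ * g) • x = x
    rw [mul_smul, hgh, inv_smul_smul])
  exact (inv_mul_eq_one.1 this).symm

end Deck

/-- The pullback of a bilinear form. -/
def pullBilinear {E F : Type*} [NormedAddCommGroup E] [NormedSpace ℝ E]
    [NormedAddCommGroup F] [NormedSpace ℝ F] (B : E →L[ℝ] E →L[ℝ] ℝ) (L : F →L[ℝ] E) :
    F →L[ℝ] F →L[ℝ] ℝ := B.bilinearComp L L

/-- The direct sum of two bilinear maps. -/
def sumBilinear {V V' W : Type*} [NormedAddCommGroup V] [NormedSpace ℝ V]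
    [NormedAddCommGroup V'] [NormedSpace ℝ V'] [NormedAddCommGroup W] [NormedSpace ℝ W]
    (B : V →L[ℝ] V →L[ℝ] W) (B' : V' →L[ℝ] V' →L[ℝ] W) : V × V' →L[ℝ] V × V' →L[ℝ] W :=
  B.bilinearComp (.fst ℝ V V') (.fst ℝ V V') + B'.bilinearComp (.snd ℝ V V') (.snd ℝ V V')

@[simp]
theorem sumBilinear_apply {V V' W : Type*} [NormedAddCommGroup V] [NormedSpace ℝ V]
    [NormedAddCommGroup V'] [NormedSpace ℝ V'] [NormedAddCommGroup W] [NormedSpace ℝ W]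
    (B : V →L[ℝ] V →L[ℝ] W) (B' : V' →L[ℝ] V' →L[ℝ] W) (u v : V × V') :
    sumBilinear B B' u v = B u.1 v.1 + B' u.2 v.2 := rfl

section Forms

variable {E : Type*} [NormedAddCommGroup E] [NormedSpace ℝ E] [FiniteDimensional ℝ E]
  {H : Type*} [TopologicalSpace H] {I : ModelWithCorners ℝ E H}
  {M : Type*} [TopologicalSpace M] [ChartedSpace H M]
  {F : Type*} [NormedAddCommGroup F] [NormedSpace ℝ F] [FiniteDimensional ℝ F]

omit [FiniteDimensional ℝ E] in
theorem contMDiffAt_clm_of_apply {W : Type*} [NormedAddCommGroup W] [NormedSpace ℝ W]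
    {n : WithTop ℕ∞} {f : M → F →L[ℝ] W} {x : M}
    (h : ∀ v, ContMDiffAt I 𝓘(ℝ, W) n (fun y ↦ f y v) x) :
    ContMDiffAt I 𝓘(ℝ, F →L[ℝ] W) n f x := by
  let d := finrank ℝ F
  have hd : d = finrank ℝ (Fin d → ℝ) := (finrank_fin_fun ℝ).symm
  let e₁ := ContinuousLinearEquiv.ofFinrankEq hd
  let e₂ := (e₁.arrowCongr (1 : W ≃L[ℝ] W)).trans (ContinuousLinearEquiv.piRing (Fin d))
  rw [← Function.id_comp f, ← e₂.symm_comp_self]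
  exact e₂.symm.contDiff.contMDiff.contMDiffAt.comp x (contMDiffAt_pi_space.2 fun i ↦ h _)

theorem contDiffAt_clm_of_apply {D W : Type*} [NormedAddCommGroup W] [NormedSpace ℝ W]
    [NormedAddCommGroup D] [NormedSpace ℝ D]
    {n : WithTop ℕ∞} {f : D → F →L[ℝ] W} {x : D} (h : ∀ v, ContDiffAt ℝ n (fun y ↦ f y v) x) :
    ContDiffAt ℝ n f x :=
  (contMDiffAt_clm_of_apply (I := 𝓘(ℝ, D)) fun v ↦ (h v).contMDiffAt).contDiffAt

variable [IsManifold I ∞ M]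

theorem contMDiffAt_form_of_apply {g : Π x : M, TangentSpace I x →L[ℝ] TangentSpace I x →L[ℝ] ℝ}
    {x : M} (h : ∀ X Y : Π x : M, TangentSpace I x,
      ContMDiffAt I I.tangent ∞ (fun y ↦ (⟨y, X y⟩ : TangentBundle I M)) x →
      ContMDiffAt I I.tangent ∞ (fun y ↦ (⟨y, Y y⟩ : TangentBundle I M)) x →
      ContMDiffAt I 𝓘(ℝ) ∞ (fun y ↦ g y (X y) (Y y)) x) :
    ContMDiffAt I (I.prod 𝓘(ℝ, E →L[ℝ] E →L[ℝ] ℝ)) ∞ (fun b ↦ TotalSpace.mk' (E →L[ℝ] E →L[ℝ] ℝ)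
      (E := fun x : M ↦ TangentSpace I x →L[ℝ] TangentSpace I x →L[ℝ] ℝ) b (g b)) x := by
  set t := trivializationAt E (TangentSpace I : M → Type _) x with ht
  have hx : x ∈ t.baseSet := mem_baseSet_trivializationAt _ _ _
  have hs : ∀ a : E, ContMDiffAt I I.tangent ∞
      (fun y ↦ (⟨y, t.symm y a⟩ : TangentBundle I M)) x := by
    intro a
    rw [Trivialization.contMDiffAt_iff (e := t) (by rw [Trivialization.mem_source]; exact hx)]
    refine ⟨contMDiffAt_id, contMDiffAt_const (c := a) |>.congr_of_eventuallyEq ?_⟩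
    filter_upwards [t.open_baseSet.mem_nhds hx] with y hy
    rw [t.apply_mk_symm hy]
  rw [contMDiffAt_hom_bundle]
  refine ⟨contMDiffAt_id, contMDiffAt_clm_of_apply fun a ↦ contMDiffAt_clm_of_apply fun b ↦ ?_⟩
  refine (h _ _ (hs a) (hs b)).congr_of_eventuallyEq ?_
  filter_upwards [t.open_baseSet.mem_nhds hx] with y hy
  refine (inCoordinates_apply_eq₂ (F₁ := E) (F₂ := E) (F₃ := ℝ)
    (E₁ := (TangentSpace I : M → Type _)) (E₂ := (TangentSpace I : M → Type _))
    (E₃ := fun _ : M ↦ ℝ) hy hy (Set.mem_univ _)).trans ?_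
  simp only [Trivial.fiberBundle_trivializationAt', Trivial.linearMapAt_trivialization,
        LinearMap.id_coe, id_eq]
  rfl

/-- The pullback of a bilinear form on tangent vectors. -/
def pullForm (φ : F → M) (g : Π x : M, TangentSpace I x →L[ℝ] TangentSpace I x →L[ℝ] ℝ) (e : F) :
    F →L[ℝ] F →L[ℝ] ℝ :=
  pullBilinear (E := E) (F := F) (g (φ e)) (mfderiv 𝓘(ℝ, F) I φ e)

omit [FiniteDimensional ℝ F] [FiniteDimensional ℝ E] [IsManifold I ∞ M] in
theorem pullForm_apply (φ : F → M) (g : Π x : M, TangentSpace I x →L[ℝ] TangentSpace I x →L[ℝ] ℝ)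
    (e u v : F) : pullForm φ g e u v =
      g (φ e) (mfderiv 𝓘(ℝ, F) I φ e u) (mfderiv 𝓘(ℝ, F) I φ e v) := rfl

omit [FiniteDimensional ℝ E] [FiniteDimensional ℝ F] in
theorem contMDiffAt_mfderiv_apply {φ : F → M} {e : F} (h : IsLocalDiffeomorphAt 𝓘(ℝ, F) I ∞ φ e)
    (u : F) : ContMDiffAt 𝓘(ℝ, F) I.tangent ∞
      (fun e ↦ (⟨φ e, mfderiv 𝓘(ℝ, F) I φ e u⟩ : TangentBundle I M)) e := by
  obtain ⟨s, hs, hso, hes⟩ := eventually_nhds_iff.1 (IsLocalDiffeomorphAt.eventually h)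
  have h1 : ContMDiffOn 𝓘(ℝ, F) I ∞ φ s := fun e he ↦ (hs e he).contMDiffAt.contMDiffWithinAt
  have h2 := h1.contMDiffOn_tangentMapWithin (m := ∞) (by simp) hso.uniqueMDiffOn
  have h3 : ContMDiff 𝓘(ℝ, F) 𝓘(ℝ, F).tangent ∞
      (fun e ↦ (⟨e, u⟩ : TangentBundle 𝓘(ℝ, F) F)) := by
    intro e
    refine (contMDiffAt_totalSpace (F := F) (E := TangentSpace 𝓘(ℝ, F)) ).2
      ⟨contMDiffAt_id, ?_⟩
    exact (contMDiffAt_const (c := u)).congr_of_eventuallyEq (.of_forall fun e' ↦ by simp)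
  have h5 : Bundle.TotalSpace.proj ⁻¹' s ∈ 𝓝 (⟨e, u⟩ : TangentBundle 𝓘(ℝ, F) F) :=
    (FiberBundle.continuous_proj F (TangentSpace 𝓘(ℝ, F))).continuousAt.preimage_mem_nhds
      (hso.mem_nhds hes)
  refine ((h2.contMDiffAt h5).comp e (h3 e)).congr_of_eventuallyEq ?_
  filter_upwards [hso.mem_nhds hes] with e' he'
  simp [tangentMapWithin, mfderivWithin_of_isOpen hso he']

omit [FiniteDimensional ℝ E] in
theorem contDiffAt_pullForm (g : SmoothMetric I M) {φ : F → M} {e : F}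
    (h : IsLocalDiffeomorphAt 𝓘(ℝ, F) I ∞ φ e) : ContDiffAt ℝ ∞ (pullForm φ g.inner) e := by
  refine contDiffAt_clm_of_apply fun u ↦ contDiffAt_clm_of_apply fun v ↦ ?_
  have h1 := ContMDiffAt.clm_bundle_apply₂ (F₁ := E) (F₂ := E) (F₃ := ℝ)
    (E₃ := Bundle.Trivial M ℝ) (IM := 𝓘(ℝ, F)) (b := φ)
    ((g.contMDiff (φ e)).comp e h.contMDiffAt) (contMDiffAt_mfderiv_apply h u)
    (contMDiffAt_mfderiv_apply h v)
  have h2 := ((contMDiffAt_totalSpace (F := ℝ) (E := Bundle.Trivial M ℝ)).1 h1).2.contDiffAt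
  simp only [Trivial.fiberBundle_trivializationAt'] at h2
  exact h2

omit [FiniteDimensional ℝ E] [IsManifold I ∞ M] [FiniteDimensional ℝ F] in
theorem contMDiffAt_of_comp_isLocalDiffeomorphAt {W : Type*} [NormedAddCommGroup W]
    [NormedSpace ℝ W] {φ : F → M} {e : F}
    (h : IsLocalDiffeomorphAt 𝓘(ℝ, F) I ∞ φ e) {f : M → W}
    (hf : ContDiffAt ℝ ∞ (f ∘ φ) e) : ContMDiffAt I 𝓘(ℝ, W) ∞ f (φ e) := by
  have h2 : h.localInverse (φ e) = e := h.localInverse_left_inv h.localInverse_mem_target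
  have h3 : ContMDiffAt I 𝓘(ℝ, W) ∞ ((f ∘ φ) ∘ h.localInverse) (φ e) :=
    ContMDiffAt.comp (φ e) (by rw [h2]; exact hf.contMDiffAt) h.localInverse_contMDiffAt
  refine h3.congr_of_eventuallyEq ?_
  filter_upwards [h.localInverse_eventuallyEq_right] with y hy
  simp only [Function.comp_apply, id] at hy ⊢
  rw [hy]

/-- The coordinate coframe of a parametrization. -/
@[simps]
def Coframe.ofParam (φ : F → M) (s : Set F) (hs : IsOpen s)
    (h : ∀ e ∈ s, IsLocalDiffeomorphAt 𝓘(ℝ, F) I ∞ φ e) : Coframe I M F F where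
  param := φ
  dom := s
  isOpen_dom := hs
  diffeo := h
  co _ := .refl ℝ F
  contDiff_co _ _ := contDiffAt_const
  bracket := 0
  maurerCartan := by simp

theorem contMDiffAt_form_of_pullForm
    {g : Π x : M, TangentSpace I x →L[ℝ] TangentSpace I x →L[ℝ] ℝ} {φ : F → M} {e : F}
    (h : IsLocalDiffeomorphAt 𝓘(ℝ, F) I ∞ φ e) (hg : ContDiffAt ℝ ∞ (pullForm φ g) e) :
    ContMDiffAt I (I.prod 𝓘(ℝ, E →L[ℝ] E →L[ℝ] ℝ)) ∞ (fun b ↦ TotalSpace.mk' (E →L[ℝ] E →L[ℝ] ℝ)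
      (E := fun x : M ↦ TangentSpace I x →L[ℝ] TangentSpace I x →L[ℝ] ℝ) b (g b)) (φ e) := by
  obtain ⟨s, hs, hso, hes⟩ := eventually_nhds_iff.1 (IsLocalDiffeomorphAt.eventually h)
  refine contMDiffAt_form_of_apply fun X Y hX hY ↦ ?_
  refine contMDiffAt_of_comp_isLocalDiffeomorphAt h ?_
  have h1 := Coframe.contDiffAt_pull (𝔣 := Coframe.ofParam φ s hso hs) hes (by simp) hX
  have h2 := Coframe.contDiffAt_pull (𝔣 := Coframe.ofParam φ s hso hs) hes (by simp) hY
  refine ((hg.clm_apply h1).clm_apply h2).congr_of_eventuallyEq ?_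
  filter_upwards [hso.mem_nhds hes] with e' he'
  have h3 : ∀ X, mfderiv 𝓘(ℝ, F) I φ e' ((Coframe.ofParam φ s hso hs).pull X e') = X (φ e') :=
    Coframe.dparam_pull (𝔣 := Coframe.ofParam φ s hso hs) he'
  rw [pullForm_apply, h3, h3]
  rfl

omit [FiniteDimensional ℝ E] [IsManifold I ∞ M] [FiniteDimensional ℝ F] in
theorem exists_param {φ : F → M} {e : F}
    (h : IsLocalDiffeomorphAt 𝓘(ℝ, F) I ∞ φ e) :
    ∃ s : Set F, IsOpen s ∧ e ∈ s ∧ ∀ e ∈ s, IsLocalDiffeomorphAt 𝓘(ℝ, F) I ∞ φ e := by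
  obtain ⟨s, hs, hso, hes⟩ := eventually_nhds_iff.1 (IsLocalDiffeomorphAt.eventually h)
  exact ⟨s, hso, hes, hs⟩

end Forms

namespace Coframe

variable {E : Type*} [NormedAddCommGroup E] [NormedSpace ℝ E]
    {H : Type*} [TopologicalSpace H] {I : ModelWithCorners ℝ E H}
    {M : Type*} [TopologicalSpace M] [ChartedSpace H M]
    {F : Type*} [NormedAddCommGroup F] [NormedSpace ℝ F]
    {V : Type*} [NormedAddCommGroup V] [NormedSpace ℝ V]
    {E' : Type*} [NormedAddCommGroup E'] [NormedSpace ℝ E']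
    {H' : Type*} [TopologicalSpace H'] {I' : ModelWithCorners ℝ E' H'}
    {M' : Type*} [TopologicalSpace M'] [ChartedSpace H' M']
    {F' : Type*} [NormedAddCommGroup F'] [NormedSpace ℝ F']
    {V' : Type*} [NormedAddCommGroup V'] [NormedSpace ℝ V']

/-- Products of local diffeomorphisms. -/
theorem _root_.Bismut.IsLocalDiffeomorphAt.prodParam {φ : F → M} {φ' : F' → M'} {e : F × F'}
    (h : IsLocalDiffeomorphAt 𝓘(ℝ, F) I ∞ φ e.1) (h' : IsLocalDiffeomorphAt 𝓘(ℝ, F') I' ∞ φ' e.2) :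
    IsLocalDiffeomorphAt 𝓘(ℝ, F × F') (I.prod I') ∞ (fun e ↦ (φ e.1, φ' e.2)) e := by
  obtain ⟨Φ, he, hΦ⟩ := h
  obtain ⟨Φ', he', hΦ'⟩ := h'
  refine ⟨⟨Φ.toPartialEquiv.prod Φ'.toPartialEquiv, Φ.open_source.prod Φ'.open_source,
    Φ.open_target.prod Φ'.open_target, ?_, ?_⟩, ⟨he, he'⟩, ?_⟩
  · exact (Φ.contMDiffOn_toFun.comp contDiff_fst.contMDiff.contMDiffOn fun x hx ↦ hx.1).prodMk
      (Φ'.contMDiffOn_toFun.comp contDiff_snd.contMDiff.contMDiffOn fun x hx ↦ hx.2)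
  · exact (Φ.contMDiffOn_invFun.comp contMDiff_fst.contMDiffOn fun x hx ↦ hx.1).prodMk_space
      (Φ'.contMDiffOn_invFun.comp contMDiff_snd.contMDiffOn fun x hx ↦ hx.2)
  · exact fun x hx ↦ Prod.ext (hΦ hx.1) (hΦ' hx.2)

theorem _root_.Bismut.mfderiv_prodParam {φ : F → M} {φ' : F' → M'} {e : F × F'}
    (h : MDifferentiableAt 𝓘(ℝ, F) I φ e.1) (h' : MDifferentiableAt 𝓘(ℝ, F') I' φ' e.2)
    (u : F × F') :
    (mfderiv 𝓘(ℝ, F × F') (I.prod I') (fun e ↦ (φ e.1, φ' e.2)) e u : E × E') =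
      (mfderiv 𝓘(ℝ, F) I φ e.1 u.1, mfderiv 𝓘(ℝ, F') I' φ' e.2 u.2) := by
  have h1 : MDifferentiableAt 𝓘(ℝ, F × F') 𝓘(ℝ, F) (Prod.fst : F × F' → F) e :=
    differentiableAt_fst.mdifferentiableAt
  have h2 : MDifferentiableAt 𝓘(ℝ, F × F') 𝓘(ℝ, F') (Prod.snd : F × F' → F') e :=
    differentiableAt_snd.mdifferentiableAt
  have h3 := mfderiv_prodMk (h.comp e h1) (h'.comp e h2)
  rw [mfderiv_comp e h h1, mfderiv_comp e h' h2, mfderiv_eq_fderiv, mfderiv_eq_fderiv, fderiv_fst,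
    fderiv_snd] at h3
  exact congrArg (fun L : F × F' →L[ℝ] E × E' ↦ L u) h3

/-- The product of two coframes. -/
def prod (𝔣 : Coframe I M F V) (𝔣' : Coframe I' M' F' V') :
    Coframe (I.prod I') (M × M') (F × F') (V × V') where
  param e := (𝔣.param e.1, 𝔣'.param e.2)
  dom := 𝔣.dom ×ˢ 𝔣'.dom
  isOpen_dom := 𝔣.isOpen_dom.prod 𝔣'.isOpen_dom
  diffeo e he := IsLocalDiffeomorphAt.prodParam (𝔣.diffeo _ he.1) (𝔣'.diffeo _ he.2)
  co e := (𝔣.co e.1).prodCongr (𝔣'.co e.2)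
  contDiff_co e he := by
    have h1 := (𝔣.contDiff_co _ he.1).comp e contDiffAt_fst
    have h2 := (𝔣'.contDiff_co _ he.2).comp e contDiffAt_snd
    exact (ContinuousLinearMap.prodMapL ℝ F V F' V').contDiff.contDiffAt.comp e (h1.prodMk h2)
  bracket := sumBilinear
    ((ContinuousLinearMap.compL ℝ V V (V × V') (.inl ℝ V V')).comp 𝔣.bracket)
    ((ContinuousLinearMap.compL ℝ V' V' (V × V') (.inr ℝ V V')).comp 𝔣'.bracket)
  maurerCartan e he u v := by
    have h1 := ((𝔣.contDiff_co _ he.1).differentiableAt (by simp)).hasFDerivAt.comp e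
      (hasFDerivAt_fst (𝕜 := ℝ))
    have h2 := ((𝔣'.contDiff_co _ he.2).differentiableAt (by simp)).hasFDerivAt.comp e
      (hasFDerivAt_snd (𝕜 := ℝ))
    have h3 := (ContinuousLinearMap.prodMapL ℝ F V F' V').hasFDerivAt.comp e (h1.prodMk h2)
    have h4 : (fun e : F × F' ↦ ((𝔣.co e.1).prodCongr (𝔣'.co e.2) : F × F' →L[ℝ] V × V')) =
      (ContinuousLinearMap.prodMapL ℝ F V F' V') ∘ fun e : F × F' ↦
        (((fun e ↦ (𝔣.co e : F →L[ℝ] V)) ∘ Prod.fst) e,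
          ((fun e ↦ (𝔣'.co e : F' →L[ℝ] V')) ∘ Prod.snd) e) := rfl
    rw [h4, h3.fderiv]
    have m1 := 𝔣.maurerCartan _ he.1 u.1 v.1
    have m2 := 𝔣'.maurerCartan _ he.2 u.2 v.2
    refine Prod.ext ?_ ?_
    · simpa using m1
    · simpa using m2

/-- The image of a coframe under a local diffeomorphism. -/
@[simps dom co bracket]
def map (𝔣 : Coframe I M F V) (p : M → M') (hp : IsLocalDiffeomorph I I' ∞ p) :
    Coframe I' M' F V where
  param e := p (𝔣.param e)
  dom := 𝔣.dom
  isOpen_dom := 𝔣.isOpen_dom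
  diffeo e he := (𝔣.diffeo e he).comp I' M' (hp _)
  co := 𝔣.co
  contDiff_co := 𝔣.contDiff_co
  bracket := 𝔣.bracket
  maurerCartan := 𝔣.maurerCartan

theorem prod_bracket_apply (𝔣 : Coframe I M F V) (𝔣' : Coframe I' M' F' V') (u v : V × V') :
    (𝔣.prod 𝔣').bracket u v = (𝔣.bracket u.1 v.1, 𝔣'.bracket u.2 v.2) := by
  simp [prod]

theorem toModel_map {𝔣 : Coframe I M F V} {p : M → M'} (hp : IsLocalDiffeomorph I I' ∞ p) {e : F}
    (he : e ∈ 𝔣.dom) (u : TangentSpace I (𝔣.param e)) :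
    (𝔣.map p hp).toModel e (mfderiv I I' p (𝔣.param e) u) = 𝔣.toModel e u := by
  obtain ⟨a, rfl⟩ : ∃ a, 𝔣.vec e a = u := ⟨_, vec_toModel he u⟩
  have h1 : (𝔣.map p hp).vec e a = mfderiv I I' p (𝔣.param e) (𝔣.vec e a) := by
    have := mfderiv_comp e ((hp (𝔣.param e)).mdifferentiableAt (by simp))
      ((𝔣.diffeo e he).mdifferentiableAt (by simp))
    exact congrArg (fun L : F →L[ℝ] E' ↦ L ((𝔣.co e).symm a)) this
  rw [← h1, toModel_vec he, toModel_vec (𝔣 := 𝔣.map p hp) he]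

theorem toModel_prod {𝔣 : Coframe I M F V} {𝔣' : Coframe I' M' F' V'} {e : F × F'}
    (he : e.1 ∈ 𝔣.dom) (he' : e.2 ∈ 𝔣'.dom) (u : TangentSpace (I.prod I') ((𝔣.prod 𝔣').param e)) :
    (𝔣.prod 𝔣').toModel e u = (𝔣.toModel e.1 (u : E × E').1, 𝔣'.toModel e.2 (u : E × E').2) := by
  obtain ⟨a, rfl⟩ : ∃ a, (𝔣.prod 𝔣').vec e a = u :=
    ⟨_, vec_toModel (𝔣 := 𝔣.prod 𝔣') ⟨he, he'⟩ u⟩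
  have h1 : ((𝔣.prod 𝔣').vec e a : E × E') = (𝔣.vec e.1 a.1, 𝔣'.vec e.2 a.2) :=
    mfderiv_prodParam ((𝔣.diffeo _ he).mdifferentiableAt (by simp))
      ((𝔣'.diffeo _ he').mdifferentiableAt (by simp)) (((𝔣.prod 𝔣').co e).symm a)
  have h2 : ((𝔣.prod 𝔣').vec e a : E × E').1 = 𝔣.vec e.1 a.1 := congrArg Prod.fst h1
  have h3 : ((𝔣.prod 𝔣').vec e a : E × E').2 = 𝔣'.vec e.2 a.2 := congrArg Prod.snd h1
  refine (toModel_vec (𝔣 := 𝔣.prod 𝔣') ⟨he, he'⟩ a).trans ?_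
  refine Prod.ext ?_ ?_
  · exact (toModel_vec he a.1).symm.trans (congrArg (𝔣.toModel e.1) h2.symm)
  · exact (toModel_vec he' a.2).symm.trans (congrArg (𝔣'.toModel e.2) h3.symm)

end Coframe

/-- The coframe dual to a frame. -/
@[simps param dom bracket]
def Coframe.ofFrame {E : Type*} [NormedAddCommGroup E] [NormedSpace ℝ E]
    {H : Type*} [TopologicalSpace H] {I : ModelWithCorners ℝ E H}
    {M : Type*} [TopologicalSpace M] [ChartedSpace H M]
    {F : Type*} [NormedAddCommGroup F] [NormedSpace ℝ F]
    {V : Type*} [NormedAddCommGroup V] [NormedSpace ℝ V] [CompleteSpace V]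
    (φ : F → M) (s : Set F) (hs : IsOpen s)
    (h : ∀ e ∈ s, IsLocalDiffeomorphAt 𝓘(ℝ, F) I ∞ φ e) (L : F → V ≃L[ℝ] F)
    (hL : ∀ e ∈ s, ContDiffAt ℝ 2 (fun e ↦ (L e : V →L[ℝ] F)) e) (bracket : V →L[ℝ] V →L[ℝ] V)
    (hb : ∀ e ∈ s, ∀ a b, fderiv ℝ (fun e ↦ (L e : V →L[ℝ] F)) e (L e a) b
      - fderiv ℝ (fun e ↦ (L e : V →L[ℝ] F)) e (L e b) a = L e (bracket a b)) :
    Coframe I M F V where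
  param := φ
  dom := s
  isOpen_dom := hs
  diffeo := h
  co e := (L e).symm
  contDiff_co e he := by
    have h1 := (contDiffAt_map_inverse (n := 2) (L e)).comp e (hL e he)
    refine h1.congr_of_eventuallyEq (.of_forall fun e' ↦ ?_)
    simp [ContinuousLinearMap.inverse_equiv]
  bracket := bracket
  maurerCartan e he u v := by
    have hd : DifferentiableAt ℝ (fun e ↦ (L e : V →L[ℝ] F)) e :=
      (hL e he).differentiableAt (by simp)
    have hd' : DifferentiableAt ℝ (fun e ↦ ((L e).symm : F →L[ℝ] V)) e := by
      have h1 := (contDiffAt_map_inverse (n := 2) (L e)).comp e (hL e he)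
      refine ContDiffAt.differentiableAt (n := 2)
        (h1.congr_of_eventuallyEq (.of_forall fun e' ↦ ?_)) (by simp)
      simp [ContinuousLinearMap.inverse_equiv]
    have key : ∀ u a, fderiv ℝ (fun e ↦ ((L e).symm : F →L[ℝ] V)) e u (L e a) =
        -(L e).symm (fderiv ℝ (fun e ↦ (L e : V →L[ℝ] F)) e u a) := by
      intro u a
      have h1 := fderiv_clm_apply hd' (hd.clm_apply (differentiableAt_const a))
      have h2 : (fun e ↦ ((L e).symm : F →L[ℝ] V) ((L e : V →L[ℝ] F) a)) = fun _ ↦ a := by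
        ext e; simp
      have h3 := congrArg (fun T : F →L[ℝ] V ↦ T u) (h2 ▸ h1)
      have h4 := fderiv_clm_apply hd (differentiableAt_const a)
      simp only [fderiv_const_apply] at h3 h4
      rw [h4] at h3
      simp at h3
      rw [eq_neg_iff_add_eq_zero, add_comm]
      exact h3.symm
    obtain ⟨a, rfl⟩ := (L e).surjective u
    obtain ⟨b, rfl⟩ := (L e).surjective v
    rw [key, key, (L e).symm_apply_apply, (L e).symm_apply_apply]
    have h1 := congrArg (L e).symm (hb e he a b)
    rw [(L e).symm_apply_apply, map_sub] at h1
    rw [← h1]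
    abel

theorem isLocalDiffeomorphAt_extChartAt_symm {E : Type*} [NormedAddCommGroup E] [NormedSpace ℝ E]
    {H : Type*} [TopologicalSpace H] {I : ModelWithCorners ℝ E H} [I.Boundaryless]
    {M : Type*} [TopologicalSpace M] [ChartedSpace H M] [IsManifold I ∞ M] (x : M) {e : E}
    (he : e ∈ (extChartAt I x).target) :
    IsLocalDiffeomorphAt 𝓘(ℝ, E) I ∞ (extChartAt I x).symm e :=
  ⟨⟨(extChartAt I x).symm, isOpen_extChartAt_target x, isOpen_extChartAt_source x,
    contMDiffOn_extChartAt_symm x, by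
      rw [PartialEquiv.symm_target, extChartAt_source]
      exact contMDiffOn_extChartAt⟩, he, fun _ _ ↦ rfl⟩

section LieGroup

variable {E : Type*} [NormedAddCommGroup E] [NormedSpace ℝ E] [FiniteDimensional ℝ E]
  {G : Type*} [TopologicalSpace G] [ChartedSpace E G] [Group G] [LieGroup 𝓘(ℝ, E) ∞ G]

variable (E G) in
/-- The bracket of the Lie algebra of a Lie group, as a bilinear map. -/
def lieBracketLM : E →ₗ[ℝ] E →ₗ[ℝ] E :=
  LinearMap.mk₂ ℝ
    (@Bracket.bracket (GroupLieAlgebra 𝓘(ℝ, E) G) (GroupLieAlgebra 𝓘(ℝ, E) G) _)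
    (fun a b c ↦ add_lie (L := GroupLieAlgebra 𝓘(ℝ, E) G) (M := GroupLieAlgebra 𝓘(ℝ, E) G) a b c)
    (fun a b c ↦ smul_lie (R := ℝ) (L := GroupLieAlgebra 𝓘(ℝ, E) G)
      (M := GroupLieAlgebra 𝓘(ℝ, E) G) a b c)
    (fun a b c ↦ lie_add (L := GroupLieAlgebra 𝓘(ℝ, E) G) (M := GroupLieAlgebra 𝓘(ℝ, E) G) a b c)
    (fun a b c ↦ lie_smul (R := ℝ) (L := GroupLieAlgebra 𝓘(ℝ, E) G)
      (M := GroupLieAlgebra 𝓘(ℝ, E) G) a b c)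

variable (E G) in
/-- The bracket of the Lie algebra of a Lie group, as a continuous bilinear map. -/
def lieBracketCLM : E →L[ℝ] E →L[ℝ] E :=
  LinearMap.toContinuousLinearMap ((LinearMap.toContinuousLinearMap (𝕜 := ℝ) (E := E)
    (F' := E)).toLinearMap.comp (lieBracketLM E G))

theorem lieBracketCLM_skew (a b : E) : lieBracketCLM E G a b = -lieBracketCLM E G b a := by
  have h : ∀ a b : GroupLieAlgebra 𝓘(ℝ, E) G, ⁅a, b⁆ = -⁅b, a⁆ := fun a b ↦ (lie_skew a b).symm
  exact h a b

theorem lieBracketCLM_jacobi (a b c : E) : lieBracketCLM E G a (lieBracketCLM E G b c) =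
    lieBracketCLM E G (lieBracketCLM E G a b) c + lieBracketCLM E G b (lieBracketCLM E G a c) := by
  have h : ∀ a b c : GroupLieAlgebra 𝓘(ℝ, E) G, ⁅a, ⁅b, c⁆⁆ = ⁅⁅a, b⁆, c⁆ + ⁅b, ⁅a, c⁆⁆ := leibniz_lie
  exact h a b c

/-- The differential at the identity of a left translation. -/
def leftMulDeriv (q : G) : E →L[ℝ] E := mfderiv 𝓘(ℝ, E) 𝓘(ℝ, E) (fun x ↦ q * x) (1 : G)

omit [FiniteDimensional ℝ E] in
theorem contMDiff_leftMul (q : G) : ContMDiff 𝓘(ℝ, E) 𝓘(ℝ, E) ∞ (fun x : G ↦ q * x) :=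
  contMDiff_mul_left

theorem isInvertible_leftMulDeriv (q : G) : (leftMulDeriv q : E →L[ℝ] E).IsInvertible := by
  have h : ∀ q x : G, MDifferentiableAt 𝓘(ℝ, E) 𝓘(ℝ, E) (fun x : G ↦ q * x) x := fun q x ↦
    (contMDiff_leftMul (E := E) q x).mdifferentiableAt (by simp)
  have h1 : Function.LeftInverse (mfderiv 𝓘(ℝ, E) 𝓘(ℝ, E) (fun x ↦ q⁻¹ * x) q : E →L[ℝ] E)
      (leftMulDeriv q : E →L[ℝ] E) := by
    intro u
    have h2 := mfderiv_comp (1 : G) (g := fun x ↦ q⁻¹ * x) (h q⁻¹ (q * 1)) (h q 1)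
    have h3 : (fun x : G ↦ q⁻¹ * x) ∘ (fun x ↦ q * x) = id := by ext; simp
    rw [h3, mfderiv_id, mul_one] at h2
    exact (congrArg (fun L : E →L[ℝ] E ↦ L u) h2).symm
  have hb : Function.Bijective (leftMulDeriv q : E →L[ℝ] E) :=
    ⟨h1.injective, LinearMap.surjective_of_injective
      (f := ((leftMulDeriv q : E →L[ℝ] E) : E →ₗ[ℝ] E)) h1.injective⟩
  exact ⟨(LinearEquiv.ofBijective ((leftMulDeriv q : E →L[ℝ] E) : E →ₗ[ℝ] E) hb).toContinuousLinearEquiv, by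
    ext; rfl⟩

/-- The left invariant frame in a parametrization of a Lie group. -/
def leftFrameCLM (φ : E → G) (e : E) : E →L[ℝ] E :=
  (mfderiv 𝓘(ℝ, E) 𝓘(ℝ, E) φ e : E →L[ℝ] E).inverse.comp (leftMulDeriv (φ e))

open Classical in
/-- The left invariant frame in a parametrization of a Lie group, as an isomorphism. -/
def leftFrame (φ : E → G) (e : E) : E ≃L[ℝ] E :=
  if h : (leftFrameCLM φ e).IsInvertible then h.choose else .refl ℝ E

theorem coe_leftFrame {φ : E → G} {e : E} (h : IsLocalDiffeomorphAt 𝓘(ℝ, E) 𝓘(ℝ, E) ∞ φ e) :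
    (leftFrame φ e : E →L[ℝ] E) = leftFrameCLM φ e := by
  have h1 : (leftFrameCLM φ e).IsInvertible := by
    obtain ⟨L, hL⟩ := isInvertible_leftMulDeriv (E := E) (φ e)
    obtain ⟨L', hL'⟩ : (mfderiv 𝓘(ℝ, E) 𝓘(ℝ, E) φ e : E →L[ℝ] E).IsInvertible :=
      isInvertible_mfderiv_of_isLocalDiffeomorphAt h
    exact ⟨L.trans L'.symm, by rw [leftFrameCLM, ← hL, ← hL', ContinuousLinearMap.inverse_equiv]; rfl⟩
  rw [leftFrame, dif_pos h1, h1.choose_spec]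

section LieBracket

variable {φ : E → G} {s : Set E} (hs : IsOpen s)
  (h : ∀ e ∈ s, IsLocalDiffeomorphAt 𝓘(ℝ, E) 𝓘(ℝ, E) ∞ φ e)

omit [FiniteDimensional ℝ E] [LieGroup 𝓘(ℝ, E) ∞ G] in
theorem leftFrameCLM_apply (a e : E) : leftFrameCLM φ e a =
    (Coframe.ofParam φ s hs h).pull (mulInvariantVectorField (I := 𝓘(ℝ, E)) (G := G) a) e := rfl

include hs h in
theorem contDiffAt_leftFrame {e : E} (he : e ∈ s) :
    ContDiffAt ℝ 2 (fun e ↦ (leftFrame φ e : E →L[ℝ] E)) e := by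
  have h1 : ContDiffAt ℝ 2 (leftFrameCLM φ) e := by
    refine contDiffAt_clm_of_apply fun a ↦ ?_
    have h2 := contMDiffAt_mulInvariantVectorField (I := 𝓘(ℝ, E)) (G := G) a (g := φ e)
    exact Coframe.contDiffAt_pull (𝔣 := Coframe.ofParam φ s hs h) he (natCast_le_infty 3)
      (h2.of_le (by rw [minSmoothness_of_isRCLikeNormedField]))
  refine h1.congr_of_eventuallyEq ?_
  filter_upwards [hs.mem_nhds he] with e' he'
  exact coe_leftFrame (h e' he')

include hs h in
theorem fderiv_leftFrame {e : E} (he : e ∈ s) (a b : E) :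
    fderiv ℝ (fun e ↦ (leftFrame φ e : E →L[ℝ] E)) e (leftFrame φ e a) b
      - fderiv ℝ (fun e ↦ (leftFrame φ e : E →L[ℝ] E)) e (leftFrame φ e b) a =
      leftFrame φ e (lieBracketCLM E G a b) := by
  have h1 : ∀ a, (fun e ↦ (leftFrame φ e : E →L[ℝ] E) a) =ᶠ[𝓝 e]
      (Coframe.ofParam φ s hs h).pull (mulInvariantVectorField (I := 𝓘(ℝ, E)) (G := G) a) := by
    intro a
    filter_upwards [hs.mem_nhds he] with e' he'
    rw [coe_leftFrame (h e' he')]; rfl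
  have h2 : ∀ a u, fderiv ℝ (fun e ↦ (leftFrame φ e : E →L[ℝ] E)) e u a =
      fderiv ℝ ((Coframe.ofParam φ s hs h).pull
        (mulInvariantVectorField (I := 𝓘(ℝ, E)) (G := G) a)) e u := by
    intro a u
    rw [← (h1 a).fderiv_eq, fderiv_clm_apply
      ((contDiffAt_leftFrame hs h he).differentiableAt (by simp)) (differentiableAt_const a)]
    simp
  have h3 : ∀ a, leftFrame φ e a = (Coframe.ofParam φ s hs h).pull
      (mulInvariantVectorField (I := 𝓘(ℝ, E)) (G := G) a) e := fun a ↦ (h1 a).self_of_nhds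
  rw [h2, h2, h3, h3, h3]
  have h4 := Coframe.pull_mlieBracket (𝔣 := Coframe.ofParam φ s hs h) he
    (mdifferentiableAt_mulInvariantVectorField (I := 𝓘(ℝ, E)) (G := G) a)
    (mdifferentiableAt_mulInvariantVectorField (I := 𝓘(ℝ, E)) (G := G) b)
  have h5 := mulInvariantVector_mlieBracket (I := 𝓘(ℝ, E)) (G := G) a b
  refine h4.symm.trans ?_
  rw [← h5]
  rfl

/-- The left invariant coframe of a Lie group, in a parametrization. -/
@[simps! param dom bracket]
def leftCoframe : Coframe 𝓘(ℝ, E) G E E :=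
  Coframe.ofFrame φ s hs h (leftFrame φ) (fun _ he ↦ contDiffAt_leftFrame hs h he)
    (lieBracketCLM E G) (fun _ he a b ↦ fderiv_leftFrame hs h he a b)

include hs h in
theorem mfderiv_leftFrame {e : E} (he : e ∈ s) (a : E) :
    (mfderiv 𝓘(ℝ, E) 𝓘(ℝ, E) φ e (leftFrame φ e a) : E) = leftMulDeriv (φ e) a := by
  have h2 : leftFrame φ e a = leftFrameCLM φ e a :=
    congrArg (fun L : E →L[ℝ] E ↦ L a) (coe_leftFrame (h e he))
  rw [h2, leftFrameCLM_apply hs h]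
  exact Coframe.dparam_pull (𝔣 := Coframe.ofParam φ s hs h) he
    (mulInvariantVectorField (I := 𝓘(ℝ, E)) (G := G) a)

theorem vec_leftCoframe {e : E} (he : e ∈ s) (a : E) :
    (leftCoframe hs h).vec e a = leftMulDeriv (φ e) a := mfderiv_leftFrame hs h he a

theorem leftMulDeriv_toModel {e : E} (he : e ∈ s) (u : TangentSpace 𝓘(ℝ, E) (φ e)) :
    leftMulDeriv (φ e) ((leftCoframe hs h).toModel e u) = (u : E) := by
  rw [← vec_leftCoframe hs h he]
  exact Coframe.vec_toModel (𝔣 := leftCoframe hs h) he u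

end LieBracket

end LieGroup

section LieGroup

variable {E : Type*} [NormedAddCommGroup E] [NormedSpace ℝ E] [FiniteDimensional ℝ E]
  {G : Type*} [TopologicalSpace G] [ChartedSpace E G] [Group G] [LieGroup 𝓘(ℝ, E) ∞ G]

/-- The differential at the identity of a right translation. -/
def rightMulDeriv (q : G) : E →L[ℝ] E := mfderiv 𝓘(ℝ, E) 𝓘(ℝ, E) (fun x ↦ x * q) (1 : G)

omit [FiniteDimensional ℝ E] [LieGroup 𝓘(ℝ, E) ∞ G] in
theorem leftMulDeriv_one (u : E) : leftMulDeriv (1 : G) u = u := by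
  have h : (fun x : G ↦ 1 * x) = id := by ext; simp
  have h2 : (leftMulDeriv (1 : G) : E →L[ℝ] E) = ContinuousLinearMap.id ℝ E := by
    rw [leftMulDeriv, h]; exact mfderiv_id
  rw [h2]; rfl

omit [FiniteDimensional ℝ E] [LieGroup 𝓘(ℝ, E) ∞ G] in
theorem rightMulDeriv_one (u : E) : rightMulDeriv (1 : G) u = u := by
  have h : (fun x : G ↦ x * 1) = id := by ext; simp
  have h2 : (rightMulDeriv (1 : G) : E →L[ℝ] E) = ContinuousLinearMap.id ℝ E := by
    rw [rightMulDeriv, h]; exact mfderiv_id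
  rw [h2]; rfl

/-- The multiplication of a Lie group in the chart at the identity. -/
def chartMul (G : Type*) [TopologicalSpace G] [ChartedSpace E G] [Group G] (p : E × E) : E :=
  extChartAt 𝓘(ℝ, E) (1 : G)
    ((extChartAt 𝓘(ℝ, E) (1 : G)).symm p.1 * (extChartAt 𝓘(ℝ, E) (1 : G)).symm p.2)

local notation "φ₁" => PartialEquiv.symm (extChartAt 𝓘(ℝ, E) (1 : G))
local notation "c₁" => extChartAt 𝓘(ℝ, E) (1 : G) (1 : G)

omit [FiniteDimensional ℝ E] in
variable (E G) in
theorem contDiffAt_chartMul : ContDiffAt ℝ ∞ (chartMul (E := E) G) (c₁, c₁) := by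
  have hφ : ContMDiffAt 𝓘(ℝ, E) 𝓘(ℝ, E) ∞ φ₁ c₁ :=
    (isLocalDiffeomorphAt_extChartAt_symm (1 : G) (mem_extChartAt_target 1)).contMDiffAt
  have h1 : ContMDiffAt 𝓘(ℝ, E × E) 𝓘(ℝ, E) ∞ (fun p : E × E ↦ φ₁ p.1 * φ₁ p.2) (c₁, c₁) :=
    (ContMDiffAt.comp (g := φ₁) (c₁, c₁) hφ contDiff_fst.contMDiff.contMDiffAt).mul
      (ContMDiffAt.comp (g := φ₁) (c₁, c₁) hφ contDiff_snd.contMDiff.contMDiffAt)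
  refine ContMDiffAt.contDiffAt (ContMDiffAt.comp (g := extChartAt 𝓘(ℝ, E) (1 : G)) (c₁, c₁) ?_ h1)
  refine contMDiffAt_extChartAt' ?_
  simp

omit [FiniteDimensional ℝ E] in
variable (E G) in
theorem eventually_chartMul : ∀ᶠ p in 𝓝 (c₁, c₁), φ₁ (chartMul (E := E) G p) = φ₁ p.1 * φ₁ p.2 := by
  have hφ : ContinuousAt φ₁ c₁ := continuousAt_extChartAt_symm 1
  have h1 : ContinuousAt (fun p : E × E ↦ φ₁ p.1 * φ₁ p.2) (c₁, c₁) := by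
    have : ContinuousMul G := continuousMul_of_contMDiffMul 𝓘(ℝ, E) ∞
    exact (ContinuousAt.comp (g := φ₁) (x := (c₁, c₁)) hφ continuousAt_fst).mul
      (ContinuousAt.comp (g := φ₁) (x := (c₁, c₁)) hφ continuousAt_snd)
  have h2 : (extChartAt 𝓘(ℝ, E) (1 : G)).source ∈ 𝓝 (φ₁ c₁ * φ₁ c₁) := by
    simpa using extChartAt_source_mem_nhds (I := 𝓘(ℝ, E)) (1 : G)
  filter_upwards [h1.preimage_mem_nhds h2] with p hp
  exact (extChartAt 𝓘(ℝ, E) (1 : G)).left_inv hp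

omit [FiniteDimensional ℝ E] in
/-- Left translations in the chart at the identity. -/
theorem eventually_mfderiv_chartMul_left (a : E) : ∀ᶠ e in 𝓝 c₁,
    (mfderiv 𝓘(ℝ, E) 𝓘(ℝ, E) φ₁ e (fderiv ℝ (chartMul (E := E) G) (e, c₁) (0, a)) : E) =
      leftMulDeriv (E := E) (φ₁ e) (mfderiv 𝓘(ℝ, E) 𝓘(ℝ, E) φ₁ c₁ a : E) := by
  have t1 : Filter.Tendsto (fun e : E ↦ (e, c₁)) (𝓝 c₁) (𝓝 (c₁, c₁)) :=
    (Continuous.prodMk_left c₁).continuousAt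
  have h2 := (((contDiffAt_chartMul E G).of_le (natCast_le_infty 2)).eventually (by simp))
  filter_upwards [(isOpen_extChartAt_target (I := 𝓘(ℝ, E)) (1 : G)).mem_nhds (mem_extChartAt_target 1),
    t1.eventually (eventually_chartMul E G).eventually_nhds, t1.eventually h2] with e he h1 h2
  have hec : chartMul (E := E) G (e, c₁) = e := by
    simp only [chartMul, extChartAt_to_inv, mul_one]
    exact (extChartAt 𝓘(ℝ, E) (1 : G)).right_inv he
  have hd := (h2.differentiableAt (by simp)).hasFDerivAt.comp c₁ (hasFDerivAt_prodMk_right e c₁)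
  have h3 : ∀ᶠ w in 𝓝 c₁, φ₁ (chartMul (E := E) G (e, w)) = φ₁ e * φ₁ w :=
    ((Continuous.prodMk_right e).continuousAt (x := c₁)).eventually h1
  have h4 : (φ₁ ∘ (chartMul (E := E) G ∘ fun w ↦ (e, w))) =ᶠ[𝓝 c₁] ((fun x : G ↦ φ₁ e * x) ∘ φ₁) := h3
  have hφ : ∀ e ∈ (extChartAt 𝓘(ℝ, E) (1 : G)).target, MDifferentiableAt 𝓘(ℝ, E) 𝓘(ℝ, E) φ₁ e :=
    fun e he ↦ (isLocalDiffeomorphAt_extChartAt_symm (1 : G) he).mdifferentiableAt (by simp)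
  have h5 := h4.mfderiv_eq (I := 𝓘(ℝ, E)) (I' := 𝓘(ℝ, E))
  rw [mfderiv_comp c₁ (I' := 𝓘(ℝ, E)) (by rw [Function.comp_apply, hec]; exact hφ e he)
    hd.differentiableAt.mdifferentiableAt, mfderiv_comp c₁ (I' := 𝓘(ℝ, E))
    ((contMDiff_leftMul (E := E) (φ₁ e)).contMDiffAt.mdifferentiableAt (by simp))
    (hφ _ (mem_extChartAt_target 1)), mfderiv_eq_fderiv, hd.fderiv] at h5
  have h6 := congrArg (fun L : E →L[ℝ] E ↦ L a) h5
  have h7 : ∀ e', e' = e → ∀ u : E, (mfderiv 𝓘(ℝ, E) 𝓘(ℝ, E) φ₁ e' u : E) =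
    mfderiv 𝓘(ℝ, E) 𝓘(ℝ, E) φ₁ e u := by rintro _ rfl _; rfl
  have h8 : ∀ q q' : G, q' = 1 → ∀ u : E, (mfderiv 𝓘(ℝ, E) 𝓘(ℝ, E) (fun x ↦ q * x) q' u : E) =
    leftMulDeriv q u := by rintro _ _ rfl _; rfl
  refine ((h7 _ hec _).symm.trans h6).trans (h8 _ _ (extChartAt_to_inv 1) _)

omit [FiniteDimensional ℝ E] in
/-- Right translations in the chart at the identity. -/
theorem eventually_mfderiv_chartMul_right (a : E) : ∀ᶠ e in 𝓝 c₁,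
    (mfderiv 𝓘(ℝ, E) 𝓘(ℝ, E) φ₁ e (fderiv ℝ (chartMul (E := E) G) (c₁, e) (a, 0)) : E) =
      rightMulDeriv (E := E) (φ₁ e) (mfderiv 𝓘(ℝ, E) 𝓘(ℝ, E) φ₁ c₁ a : E) := by
  have t1 : Filter.Tendsto (fun e : E ↦ (c₁, e)) (𝓝 c₁) (𝓝 (c₁, c₁)) :=
    (Continuous.prodMk_right c₁).continuousAt
  have h2 := (((contDiffAt_chartMul E G).of_le (natCast_le_infty 2)).eventually (by simp))
  filter_upwards [(isOpen_extChartAt_target (I := 𝓘(ℝ, E)) (1 : G)).mem_nhds (mem_extChartAt_target 1),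
    t1.eventually (eventually_chartMul E G).eventually_nhds, t1.eventually h2] with e he h1 h2
  have hec : chartMul (E := E) G (c₁, e) = e := by
    simp only [chartMul, extChartAt_to_inv, one_mul]
    exact (extChartAt 𝓘(ℝ, E) (1 : G)).right_inv he
  have hd := (h2.differentiableAt (by simp)).hasFDerivAt.comp c₁ (hasFDerivAt_prodMk_left (𝕜 := ℝ) c₁ e)
  have h3 : ∀ᶠ w in 𝓝 c₁, φ₁ (chartMul (E := E) G (w, e)) = φ₁ w * φ₁ e :=
    ((Continuous.prodMk_left e).continuousAt (x := c₁)).eventually h1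
  have h4 : (φ₁ ∘ (chartMul (E := E) G ∘ fun w ↦ (w, e))) =ᶠ[𝓝 c₁] ((fun x : G ↦ x * φ₁ e) ∘ φ₁) := h3
  have hφ : ∀ e ∈ (extChartAt 𝓘(ℝ, E) (1 : G)).target, MDifferentiableAt 𝓘(ℝ, E) 𝓘(ℝ, E) φ₁ e :=
    fun e he ↦ (isLocalDiffeomorphAt_extChartAt_symm (1 : G) he).mdifferentiableAt (by simp)
  have h5 := h4.mfderiv_eq (I := 𝓘(ℝ, E)) (I' := 𝓘(ℝ, E))
  have hr : ContMDiff 𝓘(ℝ, E) 𝓘(ℝ, E) ∞ (fun x : G ↦ x * φ₁ e) := contMDiff_mul_right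
  rw [mfderiv_comp c₁ (I' := 𝓘(ℝ, E)) (by rw [Function.comp_apply, hec]; exact hφ e he)
    hd.differentiableAt.mdifferentiableAt, mfderiv_comp c₁ (I' := 𝓘(ℝ, E))
    (hr.contMDiffAt.mdifferentiableAt (by simp))
    (hφ _ (mem_extChartAt_target 1)), mfderiv_eq_fderiv, hd.fderiv] at h5
  have h6 := congrArg (fun L : E →L[ℝ] E ↦ L a) h5
  have h7 : ∀ e', e' = e → ∀ u : E, (mfderiv 𝓘(ℝ, E) 𝓘(ℝ, E) φ₁ e' u : E) =
    mfderiv 𝓘(ℝ, E) 𝓘(ℝ, E) φ₁ e u := by rintro _ rfl _; rfl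
  have h8 : ∀ q q' : G, q' = 1 → ∀ u : E, (mfderiv 𝓘(ℝ, E) 𝓘(ℝ, E) (fun x ↦ x * q) q' u : E) =
    rightMulDeriv q u := by rintro _ _ rfl _; rfl
  refine ((h7 _ hec _).symm.trans h6).trans (h8 _ _ (extChartAt_to_inv 1) _)

theorem fderiv_bilin_eq_zero {W : Type*} [NormedAddCommGroup W] [NormedSpace ℝ W]
    {β : W → W →L[ℝ] W →L[ℝ] ℝ} {c : W} (hβ : DifferentiableAt ℝ β c)
    {p q : W → W} {p' q' : W →L[ℝ] W} {k : ℝ} (hp : HasFDerivAt p p' c)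
    (hq : HasFDerivAt q q' c) (hk : ∀ᶠ e in 𝓝 c, β e (p e) (q e) = k) (w : W) :
    fderiv ℝ β c w (p c) (q c) + β c (p' w) (q c) + β c (p c) (q' w) = 0 := by
  have h1 := (hβ.hasFDerivAt.clm_apply hp).clm_apply hq
  have h2 : HasFDerivAt (fun e ↦ β e (p e) (q e)) (0 : W →L[ℝ] ℝ) c :=
    (hasFDerivAt_const k c).congr_of_eventuallyEq hk
  have h3 := congrArg (fun T : W →L[ℝ] ℝ ↦ T w) (h1.unique h2)
  simp at h3
  linarith

/-- A bi-invariant metric is invariant under the adjoint representation. -/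
theorem inner_lieBracketCLM (b : SmoothMetric 𝓘(ℝ, E) G)
    (hl : ∀ (q : G) (u v : E), b.inner q (leftMulDeriv q u : E) (leftMulDeriv q v : E) =
      b.inner 1 u v)
    (hr : ∀ (q : G) (u v : E), b.inner q (rightMulDeriv q u : E) (rightMulDeriv q v : E) =
      b.inner 1 u v) (z x y : E) :
    b.inner 1 (lieBracketCLM E G z x) y = -b.inner 1 x (lieBracketCLM E G z y) := by
  set s := (extChartAt 𝓘(ℝ, E) (1 : G)).target with hs
  have hso : IsOpen s := isOpen_extChartAt_target 1
  have hc : c₁ ∈ s := mem_extChartAt_target 1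
  have hφ : ∀ e ∈ s, IsLocalDiffeomorphAt 𝓘(ℝ, E) 𝓘(ℝ, E) ∞ φ₁ e := fun e he ↦
    isLocalDiffeomorphAt_extChartAt_symm (1 : G) he
  set L : E → E →L[ℝ] E := fun e ↦ (leftFrame φ₁ e : E →L[ℝ] E) with hL
  set β := pullForm φ₁ b.inner
  set f := chartMul (E := E) G
  have hβ : DifferentiableAt ℝ β c₁ := (contDiffAt_pullForm b (hφ _ hc)).differentiableAt (by simp)
  have hLd : DifferentiableAt ℝ L c₁ := (contDiffAt_leftFrame hso hφ hc).differentiableAt (by simp)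
  have hLφ : ∀ a, (mfderiv 𝓘(ℝ, E) 𝓘(ℝ, E) φ₁ c₁ (L c₁ a) : E) = a := by
    intro a
    refine (mfderiv_leftFrame hso hφ hc a).trans ?_
    rw [extChartAt_to_inv, leftMulDeriv_one]
  have hinj : ∀ e ∈ s, ∀ u v : E, (mfderiv 𝓘(ℝ, E) 𝓘(ℝ, E) φ₁ e u : E) =
      mfderiv 𝓘(ℝ, E) 𝓘(ℝ, E) φ₁ e v → u = v := by
    intro e he u v huv
    obtain ⟨T, hT⟩ : ∃ T : E ≃L[ℝ] E, (T : E →L[ℝ] E) = mfderiv 𝓘(ℝ, E) 𝓘(ℝ, E) φ₁ e :=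
      isInvertible_mfderiv_of_isLocalDiffeomorphAt (hφ e he)
    have h1 : ∀ w : E, (mfderiv 𝓘(ℝ, E) 𝓘(ℝ, E) φ₁ e w : E) = T w := fun w ↦
      (congrArg (fun L : E →L[ℝ] E ↦ L w) hT).symm
    rw [h1, h1] at huv
    exact T.injective huv
  have hval : ∀ e u v u' v' : E, (mfderiv 𝓘(ℝ, E) 𝓘(ℝ, E) φ₁ e u : E) = u' →
      (mfderiv 𝓘(ℝ, E) 𝓘(ℝ, E) φ₁ e v : E) = v' → β e u v = b.inner (φ₁ e) u' v' := by
    rintro e u v _ _ rfl rfl; rfl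
  have hβ1 : ∀ e ∈ s, ∀ a a', β e (L e a) (L e a') = b.inner 1 a a' := fun e he a a' ↦
    (hval e _ _ _ _ (mfderiv_leftFrame hso hφ he a) (mfderiv_leftFrame hso hφ he a')).trans
      (hl _ _ _)
  have hf : ContDiffAt ℝ 2 f (c₁, c₁) := (contDiffAt_chartMul E G).of_le (natCast_le_infty 2)
  have hfd : DifferentiableAt ℝ (fderiv ℝ f) (c₁, c₁) :=
    (hf.fderiv_right (m := 1) (by norm_num)).differentiableAt (by simp)
  have hleft : ∀ a, (fun e ↦ L e a) =ᶠ[𝓝 c₁] fun e ↦ fderiv ℝ f (e, c₁) (0, L c₁ a) := by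
    intro a
    filter_upwards [hso.mem_nhds hc, eventually_mfderiv_chartMul_left (G := G) (L c₁ a)] with e he h1
    exact hinj e he _ _ ((mfderiv_leftFrame hso hφ he a).trans
      (h1.trans (congrArg (leftMulDeriv (E := E) (φ₁ e)) (hLφ a))).symm)
  set R : E → E → E := fun a e ↦ fderiv ℝ f (c₁, e) (L c₁ a, 0) with hR
  have hright : ∀ a, ∀ᶠ e in 𝓝 c₁,
      (mfderiv 𝓘(ℝ, E) 𝓘(ℝ, E) φ₁ e (R a e) : E) = rightMulDeriv (φ₁ e) a := by
    intro a
    filter_upwards [eventually_mfderiv_chartMul_right (G := G) (L c₁ a)] with e h1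
    exact h1.trans (congrArg (rightMulDeriv (E := E) (φ₁ e)) (hLφ a))
  have hRc : ∀ a, R a c₁ = L c₁ a := by
    intro a
    refine hinj c₁ hc _ _ (Eq.trans ?_ (hLφ a).symm)
    rw [(hright a).self_of_nhds, extChartAt_to_inv, rightMulDeriv_one]
  have hβ2 : ∀ a a', ∀ᶠ e in 𝓝 c₁, β e (R a e) (R a' e) = b.inner 1 a a' := by
    intro a a'
    filter_upwards [hright a, hright a'] with e h1 h2
    exact (hval e _ _ _ _ h1 h2).trans (hr _ _ _)
  have hLd' : ∀ a, HasFDerivAt (fun e ↦ L e a)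
      ((fderiv ℝ (fderiv ℝ f) (c₁, c₁)).flip (0, L c₁ a) ∘SL .inl ℝ E E) c₁ := by
    intro a
    have h1 := HasFDerivAt.comp (f := fun e ↦ (e, c₁)) c₁ hfd.hasFDerivAt
      (hasFDerivAt_prodMk_left (𝕜 := ℝ) c₁ c₁)
    refine (h1.clm_apply (hasFDerivAt_const (0, L c₁ a) c₁)).congr_of_eventuallyEq
      (hleft a) |>.congr_fderiv ?_
    ext; simp
  have hRd : ∀ a, HasFDerivAt (R a)
      ((fderiv ℝ (fderiv ℝ f) (c₁, c₁)).flip (L c₁ a, 0) ∘SL .inr ℝ E E) c₁ := by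
    intro a
    have h1 := HasFDerivAt.comp (f := fun e ↦ (c₁, e)) c₁ hfd.hasFDerivAt
      (hasFDerivAt_prodMk_right (𝕜 := ℝ) c₁ c₁)
    refine (h1.clm_apply (hasFDerivAt_const (L c₁ a, 0) c₁)).congr_fderiv ?_
    ext; simp
  have hsymm : ∀ u v, fderiv ℝ (fderiv ℝ f) (c₁, c₁) u v = fderiv ℝ (fderiv ℝ f) (c₁, c₁) v u :=
    hf.isSymmSndFDerivAt (by rw [minSmoothness_of_isRCLikeNormedField])
  have hA := fderiv_bilin_eq_zero hβ (hLd' x) (hLd' y) (Filter.eventually_of_mem (hso.mem_nhds hc)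
    fun e he ↦ hβ1 e he x y) (L c₁ z)
  have hB := fderiv_bilin_eq_zero hβ (hRd x) (hRd y) (hβ2 x y) (L c₁ z)
  have hbr : ∀ a, L c₁ (lieBracketCLM E G z a) =
      fderiv ℝ (fderiv ℝ f) (c₁, c₁) (L c₁ z, 0) (0, L c₁ a)
      - fderiv ℝ (fderiv ℝ f) (c₁, c₁) (0, L c₁ z) (L c₁ a, 0) := by
    intro a
    have h1 := fderiv_leftFrame hso hφ hc z a
    have h2 : ∀ u w, fderiv ℝ L c₁ w u = fderiv ℝ (fderiv ℝ f) (c₁, c₁) (w, 0) (0, L c₁ u) := by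
      intro u w
      have h3 := (hLd.hasFDerivAt.clm_apply (hasFDerivAt_const u c₁)).unique (hLd' u)
      simpa using congrArg (fun T : E →L[ℝ] E ↦ T w) h3
    refine h1.symm.trans ?_
    rw [h2, h2, hsymm (0, L c₁ z)]
    rfl
  rw [← hβ1 c₁ hc, ← hβ1 c₁ hc, hbr, hbr]
  simp only [hRc, ContinuousLinearMap.comp_apply, ContinuousLinearMap.flip_apply,
    ContinuousLinearMap.inl_apply, ContinuousLinearMap.inr_apply] at hA hB
  simp only [map_sub, sub_apply]
  linarith

end LieGroup

section Coframe

variable {E : Type*} [NormedAddCommGroup E] [NormedSpace ℝ E]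
    {H : Type*} [TopologicalSpace H] {I : ModelWithCorners ℝ E H}
    {M : Type*} [TopologicalSpace M] [ChartedSpace H M] [IsManifold I ∞ M]
    {F : Type*} [NormedAddCommGroup F] [NormedSpace ℝ F]
    {V : Type*} [NormedAddCommGroup V] [NormedSpace ℝ V]

/-- A coframe in which the complex structure of a Hermitian manifold is constant. -/
structure HermitianCoframe (S : HermitianStructure I M) (F : Type*) [NormedAddCommGroup F]
    [NormedSpace ℝ F] (V : Type*) [NormedAddCommGroup V] [NormedSpace ℝ V] extends
    Coframe I M F V where
  B : F → V →L[ℝ] V →L[ℝ] ℝ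
  differentiableAt_B : ∀ e ∈ dom, DifferentiableAt ℝ B e
  inner_eq : ∀ e ∈ dom, ∀ u v : TangentSpace I (param e),
    S.metric.inner (param e) u v = B e (toCoframe.toModel e u) (toCoframe.toModel e v)
  J : V →L[ℝ] V
  J_eq : ∀ e ∈ dom, ∀ u : TangentSpace I (param e),
    toCoframe.toModel e (S.J (param e) u) = J (toCoframe.toModel e u)

namespace HermitianCoframe

variable {S : HermitianStructure I M} (𝔥 : HermitianCoframe S F V) {e : F}

theorem B_symm (he : e ∈ 𝔥.dom) (a b : V) : 𝔥.B e a b = 𝔥.B e b a := by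
  rw [← 𝔥.toCoframe.toModel_vec he a, ← 𝔥.toCoframe.toModel_vec he b, ← 𝔥.inner_eq e he,
    ← 𝔥.inner_eq e he]
  exact S.metric.symm _ _ _

theorem B_pos (he : e ∈ 𝔥.dom) {a : V} (ha : a ≠ 0) : 0 < 𝔥.B e a a := by
  rw [← 𝔥.toCoframe.toModel_vec he a, ← 𝔥.inner_eq e he]
  refine S.metric.pos _ _ fun h ↦ ha ?_
  rw [← 𝔥.toCoframe.toModel_vec he a, h]
  exact map_zero (𝔥.toCoframe.toModel e)

theorem J_J (he : e ∈ 𝔥.dom) (a : V) : 𝔥.J (𝔥.J a) = -a := by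
  rw [← 𝔥.toCoframe.toModel_vec he a, ← 𝔥.J_eq e he, ← 𝔥.J_eq e he, S.J_sq]
  exact map_neg (𝔥.toCoframe.toModel e) _

theorem B_J_J (he : e ∈ 𝔥.dom) (a b : V) : 𝔥.B e (𝔥.J a) (𝔥.J b) = 𝔥.B e a b := by
  rw [← 𝔥.toCoframe.toModel_vec he a, ← 𝔥.toCoframe.toModel_vec he b, ← 𝔥.J_eq e he,
    ← 𝔥.J_eq e he, ← 𝔥.inner_eq e he, ← 𝔥.inner_eq e he]
  exact S.compatible _ _ _

theorem B_J (he : e ∈ 𝔥.dom) (a b : V) : 𝔥.B e (𝔥.J a) b = -𝔥.B e a (𝔥.J b) := by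
  rw [← 𝔥.B_J_J he a, 𝔥.J_J he, map_neg, neg_neg]

theorem eq_of_B_eq (he : e ∈ 𝔥.dom) {a b : V} (h : ∀ c, 𝔥.B e a c = 𝔥.B e b c) : a = b := by
  by_contra hab
  have := 𝔥.B_pos he (sub_ne_zero.2 hab)
  simp only [map_sub, sub_apply, h, sub_self] at this
  exact lt_irrefl _ this

/-- The Nijenhuis tensor of an integrable complex structure with constant coefficients. -/
theorem nijenhuis [CompleteSpace F] [CompleteSpace V] (he : e ∈ 𝔥.dom) (a b : V) :
    𝔥.bracket (𝔥.J a) (𝔥.J b) =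
      𝔥.bracket a b + 𝔥.J (𝔥.bracket (𝔥.J a) b + 𝔥.bracket a (𝔥.J b)) := by
  obtain ⟨m, z, hz, hzJ⟩ := S.exists_coordinates (𝔥.param e)
  have hd := 𝔥.diffeo e he
  set f : F → (Fin m → ℂ) := z ∘ 𝔥.param with hf
  have hfe : ∀ᶠ e' in 𝓝 e, e' ∈ 𝔥.dom ∧ ContDiffAt ℝ 2 f e' ∧
      ∀ u : TangentSpace I (𝔥.param e'),
      mvfderiv I z (𝔥.param e') (S.J (𝔥.param e') u) = Complex.I • mvfderiv I z (𝔥.param e') u := by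
    have h1 := hzJ.and (IsLocalDiffeomorphAt.eventually hz)
    filter_upwards [hd.contMDiffAt.continuousAt.eventually h1,
      𝔥.toCoframe.eventually_mem_dom he] with e' h2 he'
    refine ⟨he', ?_, h2.1⟩
    have h3 := h2.2.contMDiffAt.comp e' (𝔥.diffeo e' he').contMDiffAt
    exact h3.contDiffAt.of_le (natCast_le_infty 2)
  set P : F → V →L[ℝ] (Fin m → ℂ) := fun e ↦ 𝔥.toCoframe.der f e with hP
  have hPJ : ∀ᶠ e' in 𝓝 e, ∀ a, P e' (𝔥.J a) = Complex.I • P e' a := by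
    filter_upwards [hfe] with e' ⟨he', h1, h2⟩ a
    have h3 := h2 (𝔥.toCoframe.vec e' a)
    have h4 : DifferentiableAt ℝ (z ∘ 𝔥.param) e' := h1.differentiableAt (by simp)
    rw [𝔥.toCoframe.mvfderiv_eq_der he' h4, 𝔥.toCoframe.mvfderiv_eq_der he' h4, 𝔥.J_eq e' he',
      𝔥.toCoframe.toModel_vec he'] at h3
    exact h3
  have hf2 := hfe.self_of_nhds.2.1
  have hco := (𝔥.contDiff_co e he).differentiableAt (by simp)
  have hPd : DifferentiableAt ℝ P e := by
    have h1 : DifferentiableAt ℝ (fun e ↦ (𝔥.co e : F →L[ℝ] V).inverse) e :=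
      ContDiffAt.differentiableAt (n := 1)
        ((contDiffAt_map_inverse (𝔥.co e)).fun_comp e ((𝔥.contDiff_co e he).of_le (by simp)))
        (by simp)
    have h2 := ((hf2.fderiv_right (m := 1) (by norm_num)).differentiableAt (by simp)).clm_comp h1
    refine h2.congr_of_eventuallyEq (.of_forall fun e' ↦ ?_)
    simp [hP, Coframe.der, ContinuousLinearMap.inverse_equiv]
  have hcomm : ∀ u v : F, fderiv ℝ P e u (𝔥.co e v) - fderiv ℝ P e v (𝔥.co e u) =
      P e (𝔥.bracket (𝔥.co e u) (𝔥.co e v)) := by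
    have h1 : fderiv ℝ f = fun e ↦ (P e).comp (𝔥.co e : F →L[ℝ] V) := by
      ext e' u; simp [hP, Coframe.der]
    have h2 : ∀ u v : F, fderiv ℝ (fderiv ℝ f) e u v = fderiv ℝ P e u (𝔥.co e v) +
        P e (fderiv ℝ (fun e ↦ (𝔥.co e : F →L[ℝ] V)) e u v) := by
      intro u v
      rw [h1, fderiv_clm_comp hPd hco]
      simp [add_comm]
    intro u v
    have h3 : fderiv ℝ (fderiv ℝ f) e u v = fderiv ℝ (fderiv ℝ f) e v u :=
      (hf2.isSymmSndFDerivAt (by rw [minSmoothness_of_isRCLikeNormedField])) _ _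
    rw [h2, h2] at h3
    have h4 := congrArg (P e) (𝔥.maurerCartan e he u v)
    rw [map_neg, map_sub] at h4
    rw [← neg_eq_iff_eq_neg] at h4
    rw [← h4, sub_eq_iff_eq_add, neg_sub, sub_add_eq_add_sub, eq_sub_iff_add_eq, h3, add_comm]
  set D : V → V → (Fin m → ℂ) := fun a ↦ fderiv ℝ P e ((𝔥.co e).symm a) with hD
  have hDc : ∀ a b, D a b - D b a = P e (𝔥.bracket a b) := by
    intro a b
    simpa using hcomm ((𝔥.co e).symm a) ((𝔥.co e).symm b)
  have hDJ : ∀ a b, D a (𝔥.J b) = Complex.I • D a b := by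
    intro a b
    have h1 : (fun e ↦ P e (𝔥.J b)) =ᶠ[𝓝 e] fun e ↦ Complex.I • P e b := by
      filter_upwards [hPJ] with e' h using h b
    have h2 := h1.fderiv_eq (𝕜 := ℝ)
    have h3 : fderiv ℝ (fun e ↦ Complex.I • P e b) e = Complex.I • fderiv ℝ (fun e ↦ P e b) e :=
      fderiv_fun_const_smul (hPd.clm_apply (differentiableAt_const b)) _
    rw [h3, fderiv_clm_apply hPd (differentiableAt_const _),
      fderiv_clm_apply hPd (differentiableAt_const _)] at h2
    simpa using congrArg (fun L : F →L[ℝ] (Fin m → ℂ) ↦ L ((𝔥.co e).symm a)) h2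
  have hPinj : Function.Injective (P e) := by
    have h1 : (mfderiv 𝓘(ℝ, F) 𝓘(ℝ, Fin m → ℂ) f e).IsInvertible := by
      rw [hf, mfderiv_comp e (hz.mdifferentiableAt (by simp)) (hd.mdifferentiableAt (by simp))]
      exact (isInvertible_mfderiv_of_isLocalDiffeomorphAt hz).comp
        (isInvertible_mfderiv_of_isLocalDiffeomorphAt hd)
    obtain ⟨T, hT⟩ : ∃ T : F ≃L[ℝ] (Fin m → ℂ), (T : F →L[ℝ] (Fin m → ℂ)) =
      mfderiv 𝓘(ℝ, F) 𝓘(ℝ, Fin m → ℂ) f e := h1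
    have h2 : ∀ a, P e a = T ((𝔥.co e).symm a) := by
      intro a
      have : (T : F →L[ℝ] (Fin m → ℂ)) = fderiv ℝ f e := hT.trans mfderiv_eq_fderiv
      simp only [hP, Coframe.der, ← this]
      rfl
    intro a b hab
    rw [h2, h2] at hab
    exact (𝔥.co e).symm.injective (T.injective hab)
  refine hPinj ?_
  rw [map_add, hPJ.self_of_nhds, map_add, ← hDc, ← hDc, ← hDc, ← hDc]
  simp only [hDJ, smul_sub, smul_add, smul_smul, Complex.I_mul_I]
  module

end HermitianCoframe
end Coframe

section Samelson

variable {EG : Type*} [NormedAddCommGroup EG] [NormedSpace ℝ EG] [FiniteDimensional ℝ EG]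
  {G : Type*} [TopologicalSpace G] [ChartedSpace EG G] [Group G] [LieGroup 𝓘(ℝ, EG) ∞ G] {n : ℕ}

variable (EG G n) in
/-- Left-invariant coordinates on `G × ℝⁿ` around a point. -/
def leftCoframeProd (q : G) : Coframe (modelGR EG n) (G × EuclideanSpace ℝ (Fin n))
    (EG × EuclideanSpace ℝ (Fin n)) (EG × EuclideanSpace ℝ (Fin n)) :=
  (leftCoframe (φ := (extChartAt 𝓘(ℝ, EG) q).symm) (isOpen_extChartAt_target q)
    fun _ he ↦ isLocalDiffeomorphAt_extChartAt_symm q he).prod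
  (Coframe.ofParam (I := 𝓘(ℝ, EuclideanSpace ℝ (Fin n))) (fun t : EuclideanSpace ℝ (Fin n) ↦ t)
    Set.univ isOpen_univ fun t _ ↦
      (Diffeomorph.refl 𝓘(ℝ, EuclideanSpace ℝ (Fin n)) _ ∞).isLocalDiffeomorph t)

theorem mem_leftCoframeProd_dom (q : G) (t : EuclideanSpace ℝ (Fin n)) :
    (extChartAt 𝓘(ℝ, EG) q q, t) ∈ (leftCoframeProd EG G n q).dom :=
  ⟨mem_extChartAt_target q, trivial⟩

theorem leftCoframeProd_param (q : G) (t : EuclideanSpace ℝ (Fin n)) :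
    (leftCoframeProd EG G n q).param (extChartAt 𝓘(ℝ, EG) q q, t) = (q, t) :=
  Prod.ext (extChartAt_to_inv q) rfl

theorem leftCoframeProd_bracket (q : G) (u v : EG × EuclideanSpace ℝ (Fin n)) :
    (leftCoframeProd EG G n q).bracket u v = (lieBracketCLM EG G u.1 v.1, 0) :=
  Coframe.prod_bracket_apply _ _ u v

theorem leftMulDeriv_toModel_leftCoframeProd {q : G} {e : EG × EuclideanSpace ℝ (Fin n)}
    (he : e ∈ (leftCoframeProd EG G n q).dom)
    (u : TangentSpace (modelGR EG n) ((leftCoframeProd EG G n q).param e)) :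
    ((leftMulDeriv ((leftCoframeProd EG G n q).param e).1
      ((leftCoframeProd EG G n q).toModel e u).1 : EG),
      ((leftCoframeProd EG G n q).toModel e u).2) = (u : EG × EuclideanSpace ℝ (Fin n)) := by
  have h1 : (leftCoframeProd EG G n q).toModel e u = _ := Coframe.toModel_prod he.1 he.2 u
  rw [h1]
  refine Prod.ext (leftMulDeriv_toModel _ _ he.1 _) ?_
  have h2 : (mfderiv 𝓘(ℝ, EuclideanSpace ℝ (Fin n)) 𝓘(ℝ, EuclideanSpace ℝ (Fin n))
    (fun t : EuclideanSpace ℝ (Fin n) ↦ t) e.2 :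
      EuclideanSpace ℝ (Fin n) →L[ℝ] EuclideanSpace ℝ (Fin n)) = .id ℝ _ := mfderiv_id
  change ((mfderiv 𝓘(ℝ, EuclideanSpace ℝ (Fin n)) 𝓘(ℝ, EuclideanSpace ℝ (Fin n))
    (fun t : EuclideanSpace ℝ (Fin n) ↦ t) e.2 :
      EuclideanSpace ℝ (Fin n) →L[ℝ] EuclideanSpace ℝ (Fin n)).inverse
      (u : EG × EuclideanSpace ℝ (Fin n)).2) = (u : EG × EuclideanSpace ℝ (Fin n)).2
  rw [h2, ContinuousLinearMap.inverse_id]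
  rfl

omit [FiniteDimensional ℝ EG] in
theorem mfderiv_translation (a : G) (s : EuclideanSpace ℝ (Fin n))
    (u : EG × EuclideanSpace ℝ (Fin n)) :
    (mfderiv (modelGR EG n) (modelGR EG n)
      (fun y : G × EuclideanSpace ℝ (Fin n) ↦ (a * y.1, s + y.2)) (1, 0) u :
        EG × EuclideanSpace ℝ (Fin n)) = (leftMulDeriv a u.1, u.2) := by
  have h1 : MDifferentiableAt 𝓘(ℝ, EG) 𝓘(ℝ, EG) (fun x : G ↦ a * x) 1 :=
    (contMDiff_leftMul a).mdifferentiable (by simp) 1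
  have h2 : HasMFDerivAt 𝓘(ℝ, EuclideanSpace ℝ (Fin n)) 𝓘(ℝ, EuclideanSpace ℝ (Fin n))
      (fun t : EuclideanSpace ℝ (Fin n) ↦ s + t) 0 (ContinuousLinearMap.id ℝ _) :=
    ((hasFDerivAt_id (𝕜 := ℝ) (0 : EuclideanSpace ℝ (Fin n))).const_add s).hasMFDerivAt
  have h3 := mfderiv_prodMap (p := ((1 : G), (0 : EuclideanSpace ℝ (Fin n)))) h1
    h2.mdifferentiableAt
  rw [h2.mfderiv] at h3
  exact congrArg (fun L : EG × EuclideanSpace ℝ (Fin n) →L[ℝ] EG × EuclideanSpace ℝ (Fin n) ↦ L u) h3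

namespace IsSamelson

variable {b : SmoothMetric 𝓘(ℝ, EG) G}
  {S : HermitianStructure (modelGR EG n) (G × EuclideanSpace ℝ (Fin n))}

omit [FiniteDimensional ℝ EG] in
theorem inner_leftMulDeriv (hL : IsSamelson b S) (q : G) (u v : EG) :
    b.inner q (leftMulDeriv q u : EG) (leftMulDeriv q v : EG) = b.inner 1 u v := by
  have h : ∀ q', q' = q → ∀ u v : EG, b.inner q' u v = b.inner q u v := by rintro _ rfl _ _; rfl
  exact (h _ (mul_one q) _ _).symm.trans (hL.left_invariant q 1 u v)

omit [FiniteDimensional ℝ EG] in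
theorem inner_rightMulDeriv (hL : IsSamelson b S) (q : G) (u v : EG) :
    b.inner q (rightMulDeriv q u : EG) (rightMulDeriv q v : EG) = b.inner 1 u v := by
  have h : ∀ q', q' = q → ∀ u v : EG, b.inner q' u v = b.inner q u v := by rintro _ rfl _ _; rfl
  exact (h _ (one_mul q) _ _).symm.trans (hL.right_invariant q 1 u v)

omit [FiniteDimensional ℝ EG] in
theorem J_leftMulDeriv (hL : IsSamelson b S) (y : G × EuclideanSpace ℝ (Fin n)) (u : EG × EuclideanSpace ℝ (Fin n)) :
    (S.J y ((leftMulDeriv y.1 u.1, u.2) : EG × EuclideanSpace ℝ (Fin n)) :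
      EG × EuclideanSpace ℝ (Fin n)) =
      (leftMulDeriv y.1 (S.J (1, 0) u : EG × EuclideanSpace ℝ (Fin n)).1,
        (S.J (1, 0) u : EG × EuclideanSpace ℝ (Fin n)).2) := by
  have h : ∀ y', y' = y → ∀ u v : EG × EuclideanSpace ℝ (Fin n), u = v →
      (S.J y u : EG × EuclideanSpace ℝ (Fin n)) = S.J y' v := by rintro _ rfl _ _ rfl; rfl
  refine (h (y.1 * 1, y.2 + 0) ?_ _ _ (mfderiv_translation (n := n) y.1 y.2 u).symm).trans
    ((hL.J_left_invariant y.1 y.2 (1, 0) u).trans (mfderiv_translation (n := n) y.1 y.2 _))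
  simp

/-- The left-invariant coframe of a Samelson space. -/
def hermitianCoframe (hL : IsSamelson b S) (q : G) : HermitianCoframe S (EG × EuclideanSpace ℝ (Fin n))
    (EG × EuclideanSpace ℝ (Fin n)) where
  toCoframe := leftCoframeProd EG G n q
  B _ := sumBilinear (b.inner (1 : G) : EG →L[ℝ] EG →L[ℝ] ℝ) (innerSL ℝ)
  differentiableAt_B _ _ := differentiableAt_const _
  inner_eq e he u v := by
    have hu := leftMulDeriv_toModel_leftCoframeProd he u
    have hv := leftMulDeriv_toModel_leftCoframeProd he v
    refine (hL.metric_eq _ _ u v).trans ?_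
    have h : ∀ u v u' v' : EG × EuclideanSpace ℝ (Fin n), u' = u → v' = v →
        b.inner ((leftCoframeProd EG G n q).param e).1 u.1 v.1 + inner ℝ u.2 v.2 =
        b.inner ((leftCoframeProd EG G n q).param e).1 u'.1 v'.1 + inner ℝ u'.2 v'.2 := by
      rintro _ _ _ _ rfl rfl; rfl
    refine (h _ _ _ _ hu hv).trans ?_
    exact congrArg₂ (· + ·) (hL.inner_leftMulDeriv _ _ _) rfl
  J := S.J (1, 0)
  J_eq e he u := by
    have hu := leftMulDeriv_toModel_leftCoframeProd he u
    have h1 := leftMulDeriv_toModel_leftCoframeProd he (S.J _ u)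
    have h2 := hL.J_leftMulDeriv ((leftCoframeProd EG G n q).param e)
      ((leftCoframeProd EG G n q).toModel e u)
    have h3 := h1.trans ((congrArg (S.J ((leftCoframeProd EG G n q).param e)) hu).symm.trans h2)
    have h4 : Function.Injective
        (leftMulDeriv ((leftCoframeProd EG G n q).param e).1 : EG →L[ℝ] EG) := by
      obtain ⟨T, hT⟩ := isInvertible_leftMulDeriv (E := EG) ((leftCoframeProd EG G n q).param e).1
      rw [← hT]
      exact T.injective
    exact Prod.ext (h4 (Prod.ext_iff.1 h3).1) (Prod.ext_iff.1 h3).2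

/-- The `3`-form `g([u,v],w)` is totally skew-symmetric. -/
theorem inner_bracket (hL : IsSamelson b S) (q : G) (e u v w : EG × EuclideanSpace ℝ (Fin n)) :
    (hL.hermitianCoframe q).B e ((hL.hermitianCoframe q).bracket u v) w =
      -(hL.hermitianCoframe q).B e ((hL.hermitianCoframe q).bracket u w) v := by
  have hB : ∀ u v : EG × EuclideanSpace ℝ (Fin n), (hL.hermitianCoframe q).B e u v =
    b.inner 1 u.1 v.1 + inner ℝ u.2 v.2 := fun _ _ ↦ rfl
  have h : ∀ v, (hL.hermitianCoframe q).bracket u v = (lieBracketCLM EG G u.1 v.1, 0) :=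
    leftCoframeProd_bracket (n := n) q u
  rw [hB, hB, h, h, inner_zero_left, inner_zero_left, add_zero, add_zero]
  refine (inner_lieBracketCLM b hL.inner_leftMulDeriv hL.inner_rightMulDeriv u.1 v.1 w.1).trans ?_
  exact congrArg Neg.neg (b.symm 1 _ _)

end IsSamelson
end Samelson

section Kahler

variable {E : Type*} [NormedAddCommGroup E] [NormedSpace ℝ E]
    {H : Type*} [TopologicalSpace H] {I : ModelWithCorners ℝ E H}
    {M : Type*} [TopologicalSpace M] [ChartedSpace H M] [IsManifold I ∞ M]
    {F : Type*} [NormedAddCommGroup F] [NormedSpace ℝ F]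
    {V : Type*} [NormedAddCommGroup V] [NormedSpace ℝ V]

/-- A coordinate frame of a Kähler manifold in which the complex structure is constant, with
the Christoffel symbols of the metric. -/
structure KahlerCoframe (S : HermitianStructure I M) (F : Type*) [NormedAddCommGroup F]
    [NormedSpace ℝ F] (V : Type*) [NormedAddCommGroup V] [NormedSpace ℝ V] extends
    HermitianCoframe S F V where
  bracket_eq_zero : bracket = 0
  christoffel : F → V →L[ℝ] V →L[ℝ] V
  differentiableAt_christoffel : ∀ e ∈ dom, DifferentiableAt ℝ christoffel e
  christoffel_symm : ∀ e ∈ dom, ∀ a b, christoffel e a b = christoffel e b a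
  der_B : ∀ e ∈ dom, ∀ a b c, toCoframe.der B e a b c =
    B e (christoffel e a b) c + B e b (christoffel e a c)
  christoffel_J : ∀ e ∈ dom, ∀ a b, christoffel e a (J b) = J (christoffel e a b)

namespace HermitianCoframe

variable {S : HermitianStructure I M} (𝔥 : HermitianCoframe S F V) {e : F}

omit [IsManifold I ∞ M] in
theorem der_apply_apply {W : Type*} [NormedAddCommGroup W] [NormedSpace ℝ W]
    {𝔣 : Coframe I M F V} {B : F → V →L[ℝ] V →L[ℝ] W} (hB : DifferentiableAt ℝ B e) (a b c : V) :
    𝔣.der B e a b c = 𝔣.der (fun e ↦ B e b c) e a := by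
  have h := Coframe.der_clm_apply₂ (𝔣 := 𝔣) hB (differentiableAt_const b)
    (differentiableAt_const c) a
  rw [h]
  simp [Coframe.der]

omit [IsManifold I ∞ M] in
theorem der_congr {W : Type*} [NormedAddCommGroup W] [NormedSpace ℝ W]
    {𝔣 : Coframe I M F V} (he : e ∈ 𝔣.dom) {f k : F → W} (h : ∀ e ∈ 𝔣.dom, f e = k e) :
    𝔣.der f e = 𝔣.der k e := by
  have : f =ᶠ[𝓝 e] k := Filter.eventually_of_mem (𝔣.isOpen_dom.mem_nhds he) h
  rw [Coframe.der, Coframe.der, this.fderiv_eq]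

theorem der_B_symm (he : e ∈ 𝔥.dom) (a b c : V) :
    𝔥.toCoframe.der 𝔥.B e a b c = 𝔥.toCoframe.der 𝔥.B e a c b := by
  rw [der_apply_apply (𝔥.differentiableAt_B e he), der_apply_apply (𝔥.differentiableAt_B e he),
    der_congr he fun e he ↦ 𝔥.B_symm he b c]

theorem der_B_J (he : e ∈ 𝔥.dom) (a b c : V) :
    𝔥.toCoframe.der 𝔥.B e a (𝔥.J b) c = -𝔥.toCoframe.der 𝔥.B e a b (𝔥.J c) := by
  rw [der_apply_apply (𝔥.differentiableAt_B e he), der_apply_apply (𝔥.differentiableAt_B e he),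
    der_congr he fun e he ↦ 𝔥.B_J he b c]
  simp only [Coframe.der]
  rw [fderiv_fun_neg]
  rfl

variable [FiniteDimensional ℝ E] [T2Space M] [CompleteSpace F]

/-- The fundamental form of a Kähler manifold is closed, in coordinates. -/
theorem der_fundamentalForm (hS : S.IsKahler) (hb : 𝔥.bracket = 0) (he : e ∈ 𝔥.dom) (a b c : V) :
    𝔥.toCoframe.der 𝔥.B e a (𝔥.J b) c - 𝔥.toCoframe.der 𝔥.B e b (𝔥.J a) c +
      𝔥.toCoframe.der 𝔥.B e c (𝔥.J a) b = 0 := by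
  obtain ⟨X, hX, hXa⟩ := exists_isSmoothField_eq (𝔥.param e) (𝔥.toCoframe.vec e a)
  obtain ⟨Y, hY, hYb⟩ := exists_isSmoothField_eq (𝔥.param e) (𝔥.toCoframe.vec e b)
  obtain ⟨Z, hZ, hZc⟩ := exists_isSmoothField_eq (𝔥.param e) (𝔥.toCoframe.vec e c)
  have hv : ∀ {X : Π x : M, TangentSpace I x} {a : V}, X (𝔥.param e) = 𝔥.toCoframe.vec e a →
      𝔥.toCoframe.comp X e = a := by
    intro X a h
    rw [Coframe.comp, h, Coframe.toModel_vec he]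
  have hB := 𝔥.differentiableAt_B e he
  have hd : DifferentiableAt ℝ (fun e ↦ (𝔥.B e).comp 𝔥.J) e :=
    hB.clm_comp (differentiableAt_const _)
  have hder : ∀ a b c, 𝔥.toCoframe.der (fun e ↦ (𝔥.B e).comp 𝔥.J) e a b c =
      𝔥.toCoframe.der 𝔥.B e a (𝔥.J b) c := by
    intro a b c
    rw [der_apply_apply hd, der_apply_apply hB]
    rfl
  have h := Coframe.extDerivTwo_eq (𝔣 := 𝔥.toCoframe) (w := S.fundamentalForm)
    (B := fun e ↦ (𝔥.B e).comp 𝔥.J) he hd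
    (fun a b ↦ by
      change 𝔥.B e (𝔥.J a) b = -𝔥.B e (𝔥.J b) a
      rw [𝔥.B_J he, 𝔥.B_symm he a])
    (fun e he X Y ↦ by
      change S.metric.inner _ _ _ = _
      rw [𝔥.inner_eq e he, 𝔥.J_eq e he]
      rfl)
    (hX.mdifferentiableAt _) (hY.mdifferentiableAt _) (hZ.mdifferentiableAt _)
  rw [hS X Y Z hX hY hZ, hv hXa, hv hYb, hv hZc, hder, hder, hder, hb] at h
  simpa using h.symm

omit [CompleteSpace F] [T2Space M] [FiniteDimensional ℝ E] in
theorem isInvertible_B [FiniteDimensional ℝ V] (he : e ∈ 𝔥.dom) : (𝔥.B e).IsInvertible := by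
  have hinj : Function.Injective (𝔥.B e) := fun a b h ↦
    𝔥.eq_of_B_eq he fun c ↦ by rw [h]
  have hf : finrank ℝ V = finrank ℝ (V →L[ℝ] ℝ) := by
    rw [← (LinearMap.toContinuousLinearMap (𝕜 := ℝ) (E := V) (F' := ℝ)).finrank_eq]
    exact (Subspace.dual_finrank_eq (K := ℝ) (V := V)).symm
  exact ⟨(LinearEquiv.ofInjectiveOfFinrankEq (𝔥.B e : V →ₗ[ℝ] V →L[ℝ] ℝ) hinj
    hf).toContinuousLinearEquiv, by ext; rfl⟩

/-- Twice the Christoffel symbols of the first kind. -/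
def koszul (e : F) : V →L[ℝ] V →L[ℝ] V →L[ℝ] ℝ :=
  𝔥.toCoframe.der 𝔥.B e + (𝔥.toCoframe.der 𝔥.B e).flip -
    ((ContinuousLinearMap.flipₗᵢ ℝ V V ℝ).toContinuousLinearEquiv :
      (V →L[ℝ] V →L[ℝ] ℝ) →L[ℝ] V →L[ℝ] V →L[ℝ] ℝ).comp (𝔥.toCoframe.der 𝔥.B e).flip

omit [CompleteSpace F] [T2Space M] [FiniteDimensional ℝ E] in
theorem koszul_apply (a b c : V) : 𝔥.koszul e a b c =
    𝔥.toCoframe.der 𝔥.B e a b c + 𝔥.toCoframe.der 𝔥.B e b a c - 𝔥.toCoframe.der 𝔥.B e c a b := rfl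

/-- The Christoffel symbols. -/
def koszulChristoffel (e : F) : V →L[ℝ] V →L[ℝ] V :=
  (ContinuousLinearMap.compL ℝ V (V →L[ℝ] ℝ) V ((2⁻¹ : ℝ) • (𝔥.B e).inverse)).comp (𝔥.koszul e)

omit [CompleteSpace F] [T2Space M] [FiniteDimensional ℝ E] in
theorem B_koszulChristoffel [FiniteDimensional ℝ V] (he : e ∈ 𝔥.dom) (a b c : V) :
    𝔥.B e (𝔥.koszulChristoffel e a b) c = 2⁻¹ * 𝔥.koszul e a b c := by
  obtain ⟨T, hT⟩ := 𝔥.isInvertible_B he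
  have h : 𝔥.koszulChristoffel e a b = (2⁻¹ : ℝ) • T.symm (𝔥.koszul e a b) := by
    have h1 := ContinuousLinearMap.inverse_equiv T
    rw [hT] at h1
    change (2⁻¹ : ℝ) • (𝔥.B e).inverse (𝔥.koszul e a b) = _
    rw [h1]
    rfl
  rw [h, ← hT]
  simp

omit [T2Space M] [CompleteSpace F] [FiniteDimensional ℝ E] in
set_option synthInstance.maxHeartbeats 400000 in
theorem differentiableAt_koszulChristoffel [FiniteDimensional ℝ V] [FiniteDimensional ℝ F]
    (he : e ∈ 𝔥.dom) (hB : ContDiffAt ℝ 1 𝔥.B e)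
    (hB' : ContDiffAt ℝ 1 (𝔥.toCoframe.der 𝔥.B) e) :
    DifferentiableAt ℝ 𝔥.koszulChristoffel e := by
  have h1 : ContDiffAt ℝ 1 (fun e ↦ (2⁻¹ : ℝ) • (𝔥.B e).inverse) e := by
    obtain ⟨T, hT⟩ := 𝔥.isInvertible_B he
    have h2 := contDiffAt_map_inverse (𝕜 := ℝ) (n := 1) T
    rw [hT] at h2
    exact (h2.comp e hB).const_smul _
  have h2a : ∀ a, ContDiffAt ℝ 1 (fun e ↦ 𝔥.toCoframe.der 𝔥.B e a) e := fun a ↦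
    hB'.clm_apply contDiffAt_const
  have h2b : ∀ a b, ContDiffAt ℝ 1 (fun e ↦ 𝔥.toCoframe.der 𝔥.B e a b) e := fun a b ↦
    (h2a a).clm_apply contDiffAt_const
  have h2 : ∀ a b c, ContDiffAt ℝ 1 (fun e ↦ 𝔥.toCoframe.der 𝔥.B e a b c) e := fun a b c ↦
    (h2b a b).clm_apply contDiffAt_const
  have h3 : ∀ a b, ContDiffAt ℝ 1 (fun e ↦ 𝔥.koszul e a b) e := fun a b ↦
    contDiffAt_clm_of_apply fun c ↦ ((h2 a b c).add (h2 b a c)).sub (h2 c a b)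
  have h4 : ∀ a b, ContDiffAt ℝ 1 (fun e ↦ 𝔥.koszulChristoffel e a b) e := fun a b ↦
    h1.clm_apply (h3 a b)
  have h5 : ContDiffAt ℝ 1 𝔥.koszulChristoffel e :=
    contDiffAt_clm_of_apply fun a ↦ contDiffAt_clm_of_apply fun b ↦ h4 a b
  exact h5.differentiableAt (by simp)

/-- The Levi-Civita connection of a Kähler manifold in holomorphic coordinates. -/
def toKahlerCoframe [FiniteDimensional ℝ V] [FiniteDimensional ℝ F] (hS : S.IsKahler)
    (hb : 𝔥.bracket = 0)
    (hB : ∀ e ∈ 𝔥.dom, ContDiffAt ℝ 1 𝔥.B e)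
    (hB' : ∀ e ∈ 𝔥.dom, ContDiffAt ℝ 1 (𝔥.toCoframe.der 𝔥.B) e) : KahlerCoframe S F V where
  toHermitianCoframe := 𝔥
  bracket_eq_zero := hb
  christoffel := 𝔥.koszulChristoffel
  differentiableAt_christoffel e he :=
    𝔥.differentiableAt_koszulChristoffel he (hB e he) (hB' e he)
  christoffel_symm e he a b := by
    refine 𝔥.eq_of_B_eq he fun c ↦ ?_
    rw [𝔥.B_koszulChristoffel he, 𝔥.B_koszulChristoffel he, koszul_apply, koszul_apply,
      𝔥.der_B_symm he c a]
    ring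
  der_B e he a b c := by
    rw [𝔥.B_symm he b, 𝔥.B_koszulChristoffel he, 𝔥.B_koszulChristoffel he, koszul_apply,
      koszul_apply, 𝔥.der_B_symm he c a, 𝔥.der_B_symm he b a, 𝔥.der_B_symm he a c]
    ring
  christoffel_J e he a b := by
    refine 𝔥.eq_of_B_eq he fun c ↦ ?_
    rw [𝔥.B_J he, 𝔥.B_koszulChristoffel he, 𝔥.B_koszulChristoffel he, koszul_apply,
      koszul_apply]
    have h1 := 𝔥.der_fundamentalForm hS hb he (𝔥.J b) a (𝔥.J c)
    have h2 := 𝔥.der_fundamentalForm hS hb he b a c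
    simp only [𝔥.der_B_J he, 𝔥.J_J he, map_neg, neg_apply] at h1 h2 ⊢
    have h3 := 𝔥.der_B_symm he a c (𝔥.J b)
    have h4 := 𝔥.der_B_symm he (𝔥.J c) a b
    have h5 := 𝔥.der_B_symm he (𝔥.J c) (𝔥.J b) (𝔥.J a)
    have h6 := 𝔥.der_B_symm he c a (𝔥.J b)
    have h7 := 𝔥.der_B_J he c a b
    have h8 := 𝔥.der_B_J he a c b
    have h9 := 𝔥.der_B_symm he a b (𝔥.J c)
    have h11 := 𝔥.der_B_symm he c b (𝔥.J a)
    have h10 := 𝔥.der_B_symm he a (𝔥.J c) b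
    linarith

end HermitianCoframe

section Coordinates

variable {E : Type*} [NormedAddCommGroup E] [NormedSpace ℝ E] [FiniteDimensional ℝ E]
    {H : Type*} [TopologicalSpace H] {I : ModelWithCorners ℝ E H}
    {M : Type*} [TopologicalSpace M] [ChartedSpace H M] [IsManifold I ∞ M] [T2Space M]
    {S : HermitianStructure I M}

omit [FiniteDimensional ℝ E] [T2Space M] in
/-- Holomorphic coordinates. -/
theorem exists_hermitianCoframe (S : HermitianStructure I M) (x : M) :
    ∃ (m : ℕ) (𝔥 : HermitianCoframe S (Fin m → ℂ) (Fin m → ℂ)), 𝔥.bracket = 0 ∧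
      (∀ e, 𝔥.co e = .refl ℝ _) ∧ 𝔥.J = Complex.I • ContinuousLinearMap.id ℝ (Fin m → ℂ) ∧
      (∀ e ∈ 𝔥.dom, ContDiffAt ℝ ∞ 𝔥.B e) ∧ ∃ e ∈ 𝔥.dom, 𝔥.param e = x := by
  obtain ⟨m, z, hz, hzJ⟩ := S.exists_coordinates x
  set φ : (Fin m → ℂ) → M := fun e ↦ hz.localInverse e with hφ
  have hφx : φ (z x) = x := hz.localInverse_left_inv hz.localInverse_mem_target
  have hφd : IsLocalDiffeomorphAt 𝓘(ℝ, Fin m → ℂ) I ∞ φ (z x) :=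
    hz.localInverse_isLocalDiffeomorphAt
  have hev : ∀ᶠ e in 𝓝 (z x), IsLocalDiffeomorphAt 𝓘(ℝ, Fin m → ℂ) I ∞ φ e ∧
      (∀ᶠ e' in 𝓝 e, z (φ e') = e') ∧ ∀ u : TangentSpace I (φ e),
      mvfderiv I z (φ e) (S.J (φ e) u) = Complex.I • mvfderiv I z (φ e) u := by
    refine (IsLocalDiffeomorphAt.eventually hφd).and (Filter.Eventually.and ?_ ?_)
    · rw [eventually_eventually_nhds]
      filter_upwards [hz.localInverse.open_source.mem_nhds hz.localInverse_mem_source] with e he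
      exact hz.localInverse_right_inv he
    · rw [← hφx] at hzJ
      exact hφd.contMDiffAt.continuousAt.eventually hzJ
  obtain ⟨s, hs, hso, hzs⟩ := mem_nhds_iff.1 hev
  let 𝔣 := Coframe.ofParam φ s hso fun e he ↦ (hs he).1
  have hsmooth : ∀ e ∈ s, ContDiffAt ℝ ∞ (pullForm φ S.metric.inner) e := fun e he ↦
    contDiffAt_pullForm S.metric (hs he).1
  let 𝔥 : HermitianCoframe S (Fin m → ℂ) (Fin m → ℂ) :=
    { 𝔣 with
      B := pullForm φ S.metric.inner
      differentiableAt_B := fun e he ↦ (hsmooth e he).differentiableAt (by simp)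
      inner_eq := fun e he u v ↦ by
        have h := fun u ↦ Coframe.vec_toModel (𝔣 := 𝔣) (e := e) he u
        conv_lhs => rw [← h u, ← h v]
        rfl
      J := Complex.I • ContinuousLinearMap.id ℝ (Fin m → ℂ)
      J_eq := fun e he u ↦ by
        have h : ∀ u, mvfderiv I z (φ e) u = 𝔣.toModel e u := fun u ↦ by
          refine (Coframe.mvfderiv_eq_der_of_eventuallyEq (𝔣 := 𝔣) he (k := fun e ↦ e)
            (hs he).2.1 differentiableAt_id u).trans ?_
          simp [Coframe.der, 𝔣]
        exact (h _).symm.trans (((hs he).2.2 u).trans (congrArg (Complex.I • ·) (h u))) }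
  exact ⟨m, 𝔥, rfl, fun _ ↦ rfl, rfl, hsmooth, z x, hzs, hφx⟩

theorem exists_kahlerCoframe (hS : S.IsKahler) (x : M) :
    ∃ (m : ℕ) (𝔨 : KahlerCoframe S (Fin m → ℂ) (Fin m → ℂ)), ∃ e ∈ 𝔨.dom, 𝔨.param e = x := by
  obtain ⟨m, 𝔥, hb, hco, -, hB, e, he, hx⟩ := exists_hermitianCoframe S x
  refine ⟨m, 𝔥.toKahlerCoframe hS hb (fun e he ↦ (hB e he).of_le (natCast_le_infty 1))
    (fun e he ↦ ?_), e, he, hx⟩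
  have h : 𝔥.toCoframe.der 𝔥.B = fderiv ℝ 𝔥.B := by
    ext1 e
    rw [Coframe.der, hco]
    rfl
  rw [h]
  exact (hB e he).fderiv_right (m := 1) (by exact natCast_le_infty 2)

end Coordinates
end Kahler

section Invariant

variable {E : Type*} [NormedAddCommGroup E] [NormedSpace ℝ E]
    {H : Type*} [TopologicalSpace H] {I : ModelWithCorners ℝ E H}
    {M : Type*} [TopologicalSpace M] [ChartedSpace H M] [IsManifold I ∞ M]
    {F : Type*} [NormedAddCommGroup F] [NormedSpace ℝ F]
    {V : Type*} [NormedAddCommGroup V] [NormedSpace ℝ V]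

/-- A coframe in which metric and complex structure are constant, and whose structure constants
are those of a quadratic Lie algebra. -/
structure InvariantCoframe (S : HermitianStructure I M) (F : Type*) [NormedAddCommGroup F]
    [NormedSpace ℝ F] (V : Type*) [NormedAddCommGroup V] [NormedSpace ℝ V] extends
    HermitianCoframe S F V where
  form : V →L[ℝ] V →L[ℝ] ℝ
  B_eq : B = fun _ ↦ form
  bracket_skew : ∀ a b, bracket a b = -bracket b a
  bracket_jacobi : ∀ a b c, bracket a (bracket b c) =
    bracket (bracket a b) c + bracket b (bracket a c)
  form_bracket : ∀ a b c, form (bracket a b) c = -form (bracket a c) b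

namespace InvariantCoframe

variable {S : HermitianStructure I M} (𝔦 : InvariantCoframe S F V) {e : F}

theorem form_bracket_left (a b c : V) : 𝔦.form (𝔦.bracket a b) c = -𝔦.form (𝔦.bracket b a) c := by
  rw [𝔦.bracket_skew, map_neg, neg_apply]

theorem form_J (he : e ∈ 𝔦.dom) (a b : V) : 𝔦.form (𝔦.J a) b = -𝔦.form a (𝔦.J b) := by
  have h := 𝔦.toHermitianCoframe.B_J he a b
  rwa [𝔦.B_eq] at h

theorem form_symm (he : e ∈ 𝔦.dom) (a b : V) : 𝔦.form a b = 𝔦.form b a := by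
  have h := 𝔦.toHermitianCoframe.B_symm he a b
  rwa [𝔦.B_eq] at h

/-- `d^c ω` is the Cartan `3`-form. -/
theorem form_bracket_J [CompleteSpace F] [CompleteSpace V] (he : e ∈ 𝔦.dom) (a b c : V) :
    𝔦.form (𝔦.bracket (𝔦.J a) (𝔦.J b)) c - 𝔦.form (𝔦.bracket (𝔦.J a) (𝔦.J c)) b
      + 𝔦.form (𝔦.bracket (𝔦.J b) (𝔦.J c)) a = 𝔦.form (𝔦.bracket a b) c := by
  have h1 : 𝔦.form (𝔦.bracket (𝔦.J a) (𝔦.J b)) c = 𝔦.form (𝔦.bracket a b) c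
      - 𝔦.form (𝔦.bracket (𝔦.J a) b) (𝔦.J c) - 𝔦.form (𝔦.bracket a (𝔦.J b)) (𝔦.J c) := by
    rw [𝔦.toHermitianCoframe.nijenhuis he, map_add, map_add, map_add, add_apply, add_apply,
      𝔦.form_J he, 𝔦.form_J he]
    ring
  have h2 := 𝔦.form_bracket (𝔦.J a) (𝔦.J c) b
  have h3 := 𝔦.form_bracket (𝔦.J b) (𝔦.J c) a
  have h4 := 𝔦.form_bracket_left (𝔦.J b) a (𝔦.J c)
  rw [h1, h2, h3, h4]
  ring

theorem form_bracket_bracket (he : e ∈ 𝔦.dom) (a b c d : V) :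
    𝔦.form (𝔦.bracket (𝔦.bracket a b) c) d = 𝔦.form (𝔦.bracket a b) (𝔦.bracket c d) := by
  rw [𝔦.form_bracket_left, 𝔦.form_bracket, neg_neg, 𝔦.form_symm he]

/-- The Cartan `3`-form is closed. -/
theorem cartan_closed (he : e ∈ 𝔦.dom) (a b c d : V) :
    - 𝔦.form (𝔦.bracket (𝔦.bracket a b) c) d + 𝔦.form (𝔦.bracket (𝔦.bracket a c) b) d
      - 𝔦.form (𝔦.bracket (𝔦.bracket a d) b) c - 𝔦.form (𝔦.bracket (𝔦.bracket b c) a) d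
      + 𝔦.form (𝔦.bracket (𝔦.bracket b d) a) c - 𝔦.form (𝔦.bracket (𝔦.bracket c d) a) b = 0 := by
  have h1 := congrArg (fun x ↦ 𝔦.form x d) (𝔦.bracket_jacobi a b c)
  simp only [map_add, add_apply] at h1
  have h2 := 𝔦.form_bracket_left a (𝔦.bracket b c) d
  have h3 := 𝔦.form_bracket_left b (𝔦.bracket a c) d
  have k1 := 𝔦.form_bracket_bracket he a d b c
  have k2 := 𝔦.form_bracket_bracket he b c a d
  have k3 := 𝔦.form_symm he (𝔦.bracket a d) (𝔦.bracket b c)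
  have k4 := 𝔦.form_bracket_bracket he b d a c
  have k5 := 𝔦.form_bracket_bracket he a c b d
  have k6 := 𝔦.form_symm he (𝔦.bracket b d) (𝔦.bracket a c)
  have k7 := 𝔦.form_bracket_bracket he c d a b
  have k8 := 𝔦.form_bracket_bracket he a b c d
  have k9 := 𝔦.form_symm he (𝔦.bracket c d) (𝔦.bracket a b)
  linarith

end InvariantCoframe

end Invariant

section Samelson

variable {EG : Type*} [NormedAddCommGroup EG] [NormedSpace ℝ EG] [FiniteDimensional ℝ EG]
  {G : Type*} [TopologicalSpace G] [ChartedSpace EG G] [Group G] [LieGroup 𝓘(ℝ, EG) ∞ G] {n : ℕ}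

/-- The left-invariant coframe of a Samelson space. -/
def IsSamelson.invariantCoframe {b : SmoothMetric 𝓘(ℝ, EG) G}
    {S : HermitianStructure (modelGR EG n) (G × EuclideanSpace ℝ (Fin n))} (hL : IsSamelson b S)
    (q : G) : InvariantCoframe S (EG × EuclideanSpace ℝ (Fin n))
      (EG × EuclideanSpace ℝ (Fin n)) where
  toHermitianCoframe := hL.hermitianCoframe q
  form := sumBilinear (b.inner (1 : G) : EG →L[ℝ] EG →L[ℝ] ℝ) (innerSL ℝ)
  B_eq := rfl
  bracket_skew a c := by
    have h : ∀ u v, (hL.hermitianCoframe q).bracket u v = (lieBracketCLM EG G u.1 v.1, 0) :=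
      leftCoframeProd_bracket (n := n) q
    rw [h, h, lieBracketCLM_skew]
    simp
  bracket_jacobi a c d := by
    have h : ∀ u v, (hL.hermitianCoframe q).bracket u v = (lieBracketCLM EG G u.1 v.1, 0) :=
      leftCoframeProd_bracket (n := n) q
    simp only [h]
    rw [lieBracketCLM_jacobi]
    simp
  form_bracket := hL.inner_bracket q (extChartAt 𝓘(ℝ, EG) q q, 0)

theorem IsSamelson.exists_invariantCoframe {b : SmoothMetric 𝓘(ℝ, EG) G}
    {S : HermitianStructure (modelGR EG n) (G × EuclideanSpace ℝ (Fin n))} (hL : IsSamelson b S)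
    (y : G × EuclideanSpace ℝ (Fin n)) :
    ∃ 𝔦 : InvariantCoframe S (EG × EuclideanSpace ℝ (Fin n)) (EG × EuclideanSpace ℝ (Fin n)),
      ∃ e ∈ 𝔦.dom, 𝔦.param e = y :=
  ⟨hL.invariantCoframe y.1, (extChartAt 𝓘(ℝ, EG) y.1 y.1, y.2), mem_leftCoframeProd_dom _ _,
    leftCoframeProd_param _ _⟩

end Samelson

section Product

variable {E : Type*} [NormedAddCommGroup E] [NormedSpace ℝ E]
    {H : Type*} [TopologicalSpace H] {I : ModelWithCorners ℝ E H}
    {M : Type*} [TopologicalSpace M] [ChartedSpace H M] [IsManifold I ∞ M]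
    {F : Type*} [NormedAddCommGroup F] [NormedSpace ℝ F]
    {V : Type*} [NormedAddCommGroup V] [NormedSpace ℝ V]
    {E' : Type*} [NormedAddCommGroup E'] [NormedSpace ℝ E']
    {H' : Type*} [TopologicalSpace H'] {I' : ModelWithCorners ℝ E' H'}
    {M' : Type*} [TopologicalSpace M'] [ChartedSpace H' M'] [IsManifold I' ∞ M']
    {F' : Type*} [NormedAddCommGroup F'] [NormedSpace ℝ F']
    {V' : Type*} [NormedAddCommGroup V'] [NormedSpace ℝ V']
    {Q : Type*} [TopologicalSpace Q] [ChartedSpace (ModelProd H H') Q]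
    [IsManifold (I.prod I') ∞ Q]

/-- The Hermitian structure on `Q` is induced by the product Hermitian structure along the local
diffeomorphism `p`. -/
structure IsInducedBy (S : HermitianStructure I M) (S' : HermitianStructure I' M') (p : M × M' → Q)
    (T : HermitianStructure (I.prod I') Q) : Prop where
  isLocalDiffeomorph : IsLocalDiffeomorph (I.prod I') (I.prod I') ∞ p
  inner : ∀ (x : M) (y : M') (u v : E × E'),
    T.metric.inner (p (x, y)) (mfderiv (I.prod I') (I.prod I') p (x, y) u)
      (mfderiv (I.prod I') (I.prod I') p (x, y) v) =
      S.metric.inner x u.1 v.1 + S'.metric.inner y u.2 v.2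
  J : ∀ (x : M) (y : M') (u : E × E'),
    T.J (p (x, y)) (mfderiv (I.prod I') (I.prod I') p (x, y) u) =
      mfderiv (I.prod I') (I.prod I') p (x, y) ((S.J x u.1, S'.J y u.2) : E × E')

theorem _root_.DifferentiableAt.bilinearComp {D W W' W'' : Type*} [NormedAddCommGroup D] [NormedSpace ℝ D]
    [NormedAddCommGroup W] [NormedSpace ℝ W] [NormedAddCommGroup W'] [NormedSpace ℝ W']
    [NormedAddCommGroup W''] [NormedSpace ℝ W'']
    {f : D → W →L[ℝ] W →L[ℝ] W''} {x : D} (hf : DifferentiableAt ℝ f x) (L : W' →L[ℝ] W) :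
    DifferentiableAt ℝ (fun x ↦ (f x).bilinearComp L L) x := by
  have h := ((differentiableAt_const ((ContinuousLinearMap.compL ℝ W' W W'').flip L)).clm_comp
    hf).clm_comp (differentiableAt_const L)
  exact h

theorem differentiableAt_comp_fst {D D' Z : Type*} [NormedAddCommGroup D]
    [NormedSpace ℝ D] [NormedAddCommGroup D'] [NormedSpace ℝ D'] [NormedAddCommGroup Z]
    [NormedSpace ℝ Z] {f : D → Z} {x : D × D'} (hf : DifferentiableAt ℝ f x.1) :
    DifferentiableAt ℝ (fun x : D × D' ↦ f x.1) x :=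
  hf.comp x differentiableAt_fst

theorem differentiableAt_comp_snd {D D' Z : Type*} [NormedAddCommGroup D]
    [NormedSpace ℝ D] [NormedAddCommGroup D'] [NormedSpace ℝ D'] [NormedAddCommGroup Z]
    [NormedSpace ℝ Z] {f : D' → Z} {x : D × D'} (hf : DifferentiableAt ℝ f x.2) :
    DifferentiableAt ℝ (fun x : D × D' ↦ f x.2) x :=
  hf.comp x differentiableAt_snd

set_option synthInstance.maxHeartbeats 400000 in
theorem _root_.DifferentiableAt.sumBilinear {D D' W W' W'' : Type*} [NormedAddCommGroup D]
    [NormedSpace ℝ D] [NormedAddCommGroup D'] [NormedSpace ℝ D']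
    [NormedAddCommGroup W] [NormedSpace ℝ W] [NormedAddCommGroup W'] [NormedSpace ℝ W']
    [NormedAddCommGroup W''] [NormedSpace ℝ W'']
    {f : D → W →L[ℝ] W →L[ℝ] W''} {g : D' → W' →L[ℝ] W' →L[ℝ] W''} {x : D × D'}
    (hf : DifferentiableAt ℝ f x.1) (hg : DifferentiableAt ℝ g x.2) :
    DifferentiableAt ℝ (fun x ↦ Bismut.sumBilinear (f x.1) (g x.2)) x := by
  have h1 : DifferentiableAt ℝ (fun x : D × D' ↦ f x.1) x :=
    differentiableAt_comp_fst (f := f) (x := x) hf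
  have h2 : DifferentiableAt ℝ (fun x : D × D' ↦ g x.2) x :=
    differentiableAt_comp_snd (f := g) (x := x) hg
  have h3 := h1.bilinearComp (.fst ℝ W W')
  have h4 := h2.bilinearComp (.snd ℝ W W')
  exact DifferentiableAt.add (𝕜 := ℝ) (E := D × D') (F := W × W' →L[ℝ] W × W' →L[ℝ] W'') h3 h4

omit [IsManifold I ∞ M] [IsManifold I' ∞ M'] [IsManifold (I.prod I') ∞ Q] in
theorem Coframe.map_prod_der_fst {𝔣 : Coframe I M F V} {𝔣' : Coframe I' M' F' V'}
    {p : M × M' → Q} {hp : IsLocalDiffeomorph (I.prod I') (I.prod I') ∞ p}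
    {W : Type*} [NormedAddCommGroup W] [NormedSpace ℝ W] {f : F → W} {e : F × F'}
    (hf : DifferentiableAt ℝ f e.1) (a : V × V') :
    ((𝔣.prod 𝔣').map p hp).der (fun e ↦ f e.1) e a = 𝔣.der f e.1 a.1 := by
  have h := fderiv_comp e (g := f) (f := Prod.fst) hf differentiableAt_fst
  change fderiv ℝ (f ∘ Prod.fst) e ((𝔣.co e.1).symm a.1, (𝔣'.co e.2).symm a.2) = _
  rw [h, fderiv_fst]
  rfl

omit [IsManifold I ∞ M] [IsManifold I' ∞ M'] [IsManifold (I.prod I') ∞ Q] in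
theorem Coframe.exists_toModel_map_prod {𝔣 : Coframe I M F V} {𝔣' : Coframe I' M' F' V'}
    {p : M × M' → Q} (hp : IsLocalDiffeomorph (I.prod I') (I.prod I') ∞ p) {e : F × F'}
    (he : e ∈ (𝔣.prod 𝔣').dom)
    (u : TangentSpace (I.prod I') (((𝔣.prod 𝔣').map p hp).param e)) :
    ∃ w : E × E', mfderiv (I.prod I') (I.prod I') p ((𝔣.prod 𝔣').param e) w = u ∧
      ((𝔣.prod 𝔣').map p hp).toModel e u = (𝔣.toModel e.1 w.1, 𝔣'.toModel e.2 w.2) := by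
  obtain ⟨L, hL⟩ : ∃ L : (E × E') ≃L[ℝ] (E × E'), (L : (E × E') →L[ℝ] (E × E')) =
      mfderiv (I.prod I') (I.prod I') p ((𝔣.prod 𝔣').param e) :=
    isInvertible_mfderiv_of_isLocalDiffeomorphAt (hp _)
  have h2 : (mfderiv (I.prod I') (I.prod I') p ((𝔣.prod 𝔣').param e)
    (L.symm u) : E × E') = u := (congrArg (fun L : (E × E') →L[ℝ] (E × E') ↦ L _)
      hL).symm.trans (L.apply_symm_apply u)
  refine ⟨L.symm u, h2, ?_⟩
  refine (congrArg (((𝔣.prod 𝔣').map p hp).toModel e) h2).symm.trans ?_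
  exact (toModel_map hp he _).trans (toModel_prod he.1 he.2 _)

variable {S : HermitianStructure I M} {S' : HermitianStructure I' M'} {p : M × M' → Q}
    {T : HermitianStructure (I.prod I') Q}

/-- The coframe of a manifold that is locally a Hermitian product. -/
def HermitianCoframe.prodMap (𝔥 : HermitianCoframe S F V) (𝔥' : HermitianCoframe S' F' V')
    (hT : IsInducedBy S S' p T) : HermitianCoframe T (F × F') (V × V') where
  toCoframe := (𝔥.toCoframe.prod 𝔥'.toCoframe).map p hT.isLocalDiffeomorph
  B e := sumBilinear (𝔥.B e.1) (𝔥'.B e.2)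
  differentiableAt_B e he := (𝔥.differentiableAt_B e.1 he.1).sumBilinear
    (𝔥'.differentiableAt_B e.2 he.2)
  inner_eq e he u v := by
    obtain ⟨w, rfl, hw⟩ := Coframe.exists_toModel_map_prod hT.isLocalDiffeomorph he u
    obtain ⟨w', rfl, hw'⟩ := Coframe.exists_toModel_map_prod hT.isLocalDiffeomorph he v
    rw [hw, hw']
    exact (hT.inner _ _ w w').trans (congrArg₂ (· + ·) (𝔥.inner_eq _ he.1 _ _)
      (𝔥'.inner_eq _ he.2 _ _))
  J := 𝔥.J.prodMap 𝔥'.J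
  J_eq e he u := by
    obtain ⟨w, rfl, hw⟩ := Coframe.exists_toModel_map_prod hT.isLocalDiffeomorph he u
    rw [hw]
    refine (congrArg (((𝔥.toCoframe.prod 𝔥'.toCoframe).map p hT.isLocalDiffeomorph).toModel e)
      (hT.J _ _ w)).trans (((Coframe.toModel_map (𝔣 := 𝔥.toCoframe.prod 𝔥'.toCoframe)
        hT.isLocalDiffeomorph he _).trans (Coframe.toModel_prod he.1 he.2 _)).trans ?_)
    exact Prod.ext (𝔥.J_eq _ he.1 _) (𝔥'.J_eq _ he.2 _)

/-- The curvature of a Kähler manifold in coordinates. -/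
def KahlerCoframe.curvature (𝔨 : KahlerCoframe S F V) (e : F) (a b : V) : V →L[ℝ] V :=
  𝔨.toCoframe.der 𝔨.christoffel e a b - 𝔨.toCoframe.der 𝔨.christoffel e b a
    + (𝔨.christoffel e a).comp (𝔨.christoffel e b) - (𝔨.christoffel e b).comp (𝔨.christoffel e a)

/-- The Christoffel symbols of the Bismut connection. -/
def KahlerCoframe.bismutSymbol (𝔨 : KahlerCoframe S F V) (V' : Type*) [NormedAddCommGroup V']
    [NormedSpace ℝ V'] (e : F) : V × V' →L[ℝ] V × V' →L[ℝ] V × V' :=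
  ((ContinuousLinearMap.compL ℝ (V × V') V (V × V') (.inl ℝ V V')).comp
    ((ContinuousLinearMap.compL ℝ (V × V') V V).flip (.fst ℝ V V'))).comp
      ((𝔨.christoffel e).comp (.fst ℝ V V'))

theorem KahlerCoframe.bismutSymbol_apply (𝔨 : KahlerCoframe S F V) (e : F) (a b : V × V') :
    𝔨.bismutSymbol V' e a b = (𝔨.christoffel e a.1 b.1, 0) := rfl

theorem KahlerCoframe.differentiableAt_bismutSymbol (𝔨 : KahlerCoframe S F V) {e : F}
    (he : e ∈ 𝔨.dom) : DifferentiableAt ℝ (𝔨.bismutSymbol V') e :=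
  (differentiableAt_const _).clm_comp
    ((𝔨.differentiableAt_christoffel e he).clm_comp (differentiableAt_const _))

variable (𝔨 : KahlerCoframe S F V) (𝔦 : InvariantCoframe S' F' V') (hT : IsInducedBy S S' p T)

/-- The coframe of a manifold that is locally the product of a Kähler manifold and a Lie group. -/
abbrev productCoframe : HermitianCoframe T (F × F') (V × V') :=
  𝔨.toHermitianCoframe.prodMap 𝔦.toHermitianCoframe hT

theorem productCoframe_bracket (a b : V × V') :
    (productCoframe 𝔨 𝔦 hT).bracket a b = (0, 𝔦.bracket a.2 b.2) := by
  have h : (productCoframe 𝔨 𝔦 hT).bracket a b = (𝔨.bracket a.1 b.1, 𝔦.bracket a.2 b.2) :=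
    Coframe.prod_bracket_apply _ _ a b
  rw [h, 𝔨.bracket_eq_zero]
  rfl

theorem productCoframe_B (e : F × F') (a b : V × V') :
    (productCoframe 𝔨 𝔦 hT).B e a b = 𝔨.B e.1 a.1 b.1 + 𝔦.form a.2 b.2 := by
  change 𝔨.B e.1 a.1 b.1 + 𝔦.B e.2 a.2 b.2 = _
  rw [𝔦.B_eq]

theorem der_productCoframe_B {e : F × F'} (he : e ∈ (productCoframe 𝔨 𝔦 hT).dom) (a b c : V × V') :
    (productCoframe 𝔨 𝔦 hT).toCoframe.der (productCoframe 𝔨 𝔦 hT).B e a b c =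
      𝔨.toCoframe.der 𝔨.B e.1 a.1 b.1 c.1 := by
  have hB := 𝔨.differentiableAt_B _ he.1
  rw [HermitianCoframe.der_apply_apply ((productCoframe 𝔨 𝔦 hT).differentiableAt_B e he),
    HermitianCoframe.der_apply_apply hB]
  simp only [productCoframe_B]
  exact Coframe.map_prod_der_fst (𝔣' := 𝔦.toCoframe) (hp := hT.isLocalDiffeomorph) (f := fun e ↦ 𝔨.B e b.1 c.1 + 𝔦.form b.2 c.2)
    (((hB.clm_apply (differentiableAt_const _)).clm_apply (differentiableAt_const _)).add_const _) a |>.trans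
    (by simp only [Coframe.der]; rw [fderiv_add_const])

end Product

section Product

variable {E : Type*} [NormedAddCommGroup E] [NormedSpace ℝ E] [FiniteDimensional ℝ E]
    {H : Type*} [TopologicalSpace H] {I : ModelWithCorners ℝ E H}
    {M : Type*} [TopologicalSpace M] [ChartedSpace H M] [IsManifold I ∞ M]
    {F : Type*} [NormedAddCommGroup F] [NormedSpace ℝ F] [CompleteSpace F]
    {V : Type*} [NormedAddCommGroup V] [NormedSpace ℝ V]
    {E' : Type*} [NormedAddCommGroup E'] [NormedSpace ℝ E'] [FiniteDimensional ℝ E']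
    {H' : Type*} [TopologicalSpace H'] {I' : ModelWithCorners ℝ E' H'}
    {M' : Type*} [TopologicalSpace M'] [ChartedSpace H' M'] [IsManifold I' ∞ M']
    {F' : Type*} [NormedAddCommGroup F'] [NormedSpace ℝ F'] [CompleteSpace F']
    {V' : Type*} [NormedAddCommGroup V'] [NormedSpace ℝ V'] [CompleteSpace V']
    {Q : Type*} [TopologicalSpace Q] [ChartedSpace (ModelProd H H') Q]
    [IsManifold (I.prod I') ∞ Q]
    {S : HermitianStructure I M} {S' : HermitianStructure I' M'} {p : M × M' → Q}
    {T : HermitianStructure (I.prod I') Q}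
    (𝔨 : KahlerCoframe S F V) (𝔦 : InvariantCoframe S' F' V') (hT : IsInducedBy S S' p T)

omit [FiniteDimensional ℝ E] [CompleteSpace F] in
/-- The fundamental form of a Kähler manifold is closed, in coordinates. -/
theorem KahlerCoframe.closed {e : F} (he : e ∈ 𝔨.dom) (a b c : V) :
    𝔨.toCoframe.der 𝔨.B e a (𝔨.J b) c - 𝔨.toCoframe.der 𝔨.B e b (𝔨.J a) c +
      𝔨.toCoframe.der 𝔨.B e c (𝔨.J a) b = 0 := by
  simp only [𝔨.der_B e he, 𝔨.christoffel_J e he]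
  rw [𝔨.christoffel_symm e he b a, 𝔨.christoffel_symm e he c a, 𝔨.christoffel_symm e he c b,
    𝔨.B_J he (𝔨.christoffel e a c), 𝔨.B_symm he (𝔨.christoffel e a c),
    𝔨.B_symm he (𝔨.J a)]
  have h := 𝔨.B_symm he (𝔨.J a) (𝔨.christoffel e b c)
  linarith

theorem dcFundamentalForm_eq {e : F × F'} (he : e ∈ (productCoframe 𝔨 𝔦 hT).dom)
    {X Y Z : Π x : Q, TangentSpace (I.prod I') x} (hX : IsSmoothField (I.prod I') X)
    (hY : IsSmoothField (I.prod I') Y) (hZ : IsSmoothField (I.prod I') Z) :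
    T.dcFundamentalForm X Y Z ((productCoframe 𝔨 𝔦 hT).param e) =
      sumBilinear 0 𝔦.form ((productCoframe 𝔨 𝔦 hT).bracket
        ((productCoframe 𝔨 𝔦 hT).toCoframe.comp X e) ((productCoframe 𝔨 𝔦 hT).toCoframe.comp Y e))
        ((productCoframe 𝔨 𝔦 hT).toCoframe.comp Z e) := by
  set 𝔪 := productCoframe 𝔨 𝔦 hT with h𝔪
  have hB := 𝔪.differentiableAt_B e he
  have hd : DifferentiableAt ℝ (fun e ↦ (𝔪.B e).comp 𝔪.J) e :=
    hB.clm_comp (differentiableAt_const _)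
  have hder : ∀ a b c, 𝔪.toCoframe.der (fun e ↦ (𝔪.B e).comp 𝔪.J) e a b c =
      𝔪.toCoframe.der 𝔪.B e a (𝔪.J b) c := by
    intro a b c
    rw [HermitianCoframe.der_apply_apply hd, HermitianCoframe.der_apply_apply hB]
    rfl
  have hJ := fun {X : Π x : Q, TangentSpace (I.prod I') x} (hX : IsSmoothField (I.prod I') X) ↦
    Coframe.mdifferentiableAt_applyJ (𝔣 := 𝔪.toCoframe) 𝔪.J_eq he (hX.mdifferentiableAt _)
  have h := Coframe.extDerivTwo_eq (𝔣 := 𝔪.toCoframe) (w := T.fundamentalForm)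
    (B := fun e ↦ (𝔪.B e).comp 𝔪.J) he hd
    (fun a b ↦ by
      change 𝔪.B e (𝔪.J a) b = -𝔪.B e (𝔪.J b) a
      rw [𝔪.B_J he, 𝔪.B_symm he a])
    (fun e he X Y ↦ by
      change T.metric.inner _ _ _ = _
      rw [𝔪.inner_eq e he, 𝔪.J_eq e he]
      rfl)
    (hJ hX) (hJ hY) (hJ hZ)
  rw [HermitianStructure.dcFundamentalForm, h]
  simp only [Coframe.comp_applyJ 𝔪.J_eq he, hder, ContinuousLinearMap.comp_apply, 𝔪.B_J_J he]
  generalize 𝔪.toCoframe.comp X e = x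
  generalize 𝔪.toCoframe.comp Y e = y
  generalize 𝔪.toCoframe.comp Z e = z
  simp only [h𝔪, der_productCoframe_B 𝔨 𝔦 hT he, productCoframe_bracket, productCoframe_B,
    sumBilinear_apply]
  have h1 := 𝔨.closed he.1 (𝔨.J x.1) (𝔨.J y.1) (𝔨.J z.1)
  have h2 := 𝔦.form_bracket_J he.2 x.2 y.2 z.2
  have hJ1 : ∀ v : V × V', ((productCoframe 𝔨 𝔦 hT).J v).1 = 𝔨.J v.1 := fun _ ↦ rfl
  have hJ2 : ∀ v : V × V', ((productCoframe 𝔨 𝔦 hT).J v).2 = 𝔦.J v.2 := fun _ ↦ rfl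
  simp only [hJ1, hJ2, map_zero, zero_apply]
  linarith

variable (V') in
/-- The product coframes cover the manifold. -/
def HasProductCoframes (hT : IsInducedBy S S' p T) : Prop :=
  ∀ x, ∃ (m : ℕ) (𝔨 : KahlerCoframe S (Fin m → ℂ) (Fin m → ℂ)) (𝔦 : InvariantCoframe S' V' V'),
    ∃ e ∈ (productCoframe 𝔨 𝔦 hT).dom, (productCoframe 𝔨 𝔦 hT).param e = x

variable {hT} in
/-- A local product of a Kähler manifold and a Lie group with a bi-invariant metric is strong Kähler
with torsion. -/
theorem HasProductCoframes.isSKT (h : HasProductCoframes V' hT) : T.IsSKT := by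
  intro X Y Z W hX hY hZ hW x
  obtain ⟨m, 𝔨, 𝔦, e, he, rfl⟩ := h x
  set 𝔪 := productCoframe 𝔨 𝔦 hT with h𝔪
  have hb := productCoframe_bracket 𝔨 𝔦 hT
  have h1 : ∀ a b c, sumBilinear (0 : (Fin m → ℂ) →L[ℝ] (Fin m → ℂ) →L[ℝ] ℝ) 𝔦.form (𝔪.bracket a b) c =
      𝔦.form (𝔦.bracket a.2 b.2) c.2 := by
    intro a b c
    rw [hb]
    simp
  have h2 := Coframe.extDerivThree_eq (𝔣 := 𝔪.toCoframe) (g := sumBilinear 0 𝔦.form)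
    (L := 𝔪.bracket) (η := T.dcFundamentalForm) he
    (fun a b c ↦ by rw [h1, h1, 𝔦.form_bracket_left])
    (fun a b c ↦ by rw [h1, h1, 𝔦.form_bracket])
    (fun e he X Y Z hX hY hZ ↦ dcFundamentalForm_eq 𝔨 𝔦 hT he hX hY hZ) hX hY hZ hW
  rw [h2]
  simp only [h1]
  simp only [h𝔪, hb]
  exact 𝔦.cartan_closed he.2 _ _ _ _

omit [CompleteSpace V'] in
theorem isBismutAt_productCoframe {e : F × F'} (he : e ∈ (productCoframe 𝔨 𝔦 hT).dom) :
    IsBismutAt T ((productCoframe 𝔨 𝔦 hT).param e)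
      ((productCoframe 𝔨 𝔦 hT).toCoframe.connection e (𝔨.bismutSymbol V' e.1)) := by
  refine Coframe.isBismutAt_connection he ((productCoframe 𝔨 𝔦 hT).differentiableAt_B e he)
    (productCoframe 𝔨 𝔦 hT).inner_eq (fun a b c ↦ ?_) (productCoframe 𝔨 𝔦 hT).J_eq
    (fun a b ↦ ?_) fun a b c ↦ ?_
  · rw [der_productCoframe_B 𝔨 𝔦 hT he, productCoframe_B, productCoframe_B, 𝔨.der_B _ he.1]
    simp [KahlerCoframe.bismutSymbol_apply]
  · refine Prod.ext (𝔨.christoffel_J _ he.1 _ _) (map_zero 𝔦.J).symm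
  · simp only [KahlerCoframe.bismutSymbol_apply, productCoframe_bracket, productCoframe_B,
      𝔨.christoffel_symm _ he.1 b.1 a.1, 𝔨.christoffel_symm _ he.1 c.1 a.1]
    have h := 𝔦.form_bracket a.2 b.2 c.2
    simpa [neg_eq_iff_eq_neg] using h

omit [CompleteSpace V'] in
/-- The curvature of the Bismut connection of a local product. -/
theorem toModel_curvature_bismut [T2Space Q] {nabla : AffineConnection (I.prod I') Q}
    (hn : T.IsBismut nabla) {e : F × F'} (he : e ∈ (productCoframe 𝔨 𝔦 hT).dom)
    {X Y Z : Π x : Q, TangentSpace (I.prod I') x} (hX : IsSmoothField (I.prod I') X)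
    (hY : IsSmoothField (I.prod I') Y) (hZ : ContDiffAt ℝ 2 ((productCoframe 𝔨 𝔦 hT).toCoframe.comp Z) e) :
    (productCoframe 𝔨 𝔦 hT).toCoframe.toModel e
      (curvature nabla X Y Z ((productCoframe 𝔨 𝔦 hT).param e)) =
      (𝔨.curvature e.1 ((productCoframe 𝔨 𝔦 hT).toCoframe.comp X e).1
        ((productCoframe 𝔨 𝔦 hT).toCoframe.comp Y e).1
        ((productCoframe 𝔨 𝔦 hT).toCoframe.comp Z e).1, 0) := by
  have hA : DifferentiableAt ℝ (fun e : F × F' ↦ 𝔨.bismutSymbol V' e.1) e :=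
    differentiableAt_comp_fst (f := 𝔨.bismutSymbol V') (x := e)
      (𝔨.differentiableAt_bismutSymbol he.1)
  have h1 := Coframe.toModel_curvature (𝔣 := (productCoframe 𝔨 𝔦 hT).toCoframe) he hA
    (nabla := nabla) ?_ hX hY hZ
  · rw [h1]
    generalize (productCoframe 𝔨 𝔦 hT).toCoframe.comp X e = x
    generalize (productCoframe 𝔨 𝔦 hT).toCoframe.comp Y e = y
    generalize (productCoframe 𝔨 𝔦 hT).toCoframe.comp Z e = z
    have hd : ∀ a b c, (productCoframe 𝔨 𝔦 hT).toCoframe.der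
        (fun e : F × F' ↦ 𝔨.bismutSymbol V' e.1) e a b c =
        (𝔨.toCoframe.der 𝔨.christoffel e.1 a.1 b.1 c.1, 0) := by
      intro a b c
      have hΓ := 𝔨.differentiableAt_christoffel _ he.1
      rw [HermitianCoframe.der_apply_apply hA, HermitianCoframe.der_apply_apply hΓ]
      have hf : DifferentiableAt ℝ (fun e ↦ 𝔨.christoffel e b.1 c.1) e.1 :=
        (hΓ.clm_apply (differentiableAt_const _)).clm_apply (differentiableAt_const _)
      have h3 := Coframe.map_prod_der_fst (𝔣 := 𝔨.toCoframe) (𝔣' := 𝔦.toCoframe)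
        (hp := hT.isLocalDiffeomorph)
        (f := fun e ↦ (𝔨.christoffel e b.1 c.1, (0 : V'))) (hf.prodMk (differentiableAt_const _)) a
      refine h3.trans ?_
      simp only [Coframe.der, ContinuousLinearMap.comp_apply]
      rw [(hf.hasFDerivAt.prodMk (hasFDerivAt_const (0 : V') e.1)).fderiv]
      rfl
    rw [hd, hd]
    simp only [KahlerCoframe.bismutSymbol_apply, productCoframe_bracket, map_zero,
      zero_apply, Prod.mk_sub_mk, Prod.mk_add_mk, sub_zero, add_zero,
      KahlerCoframe.curvature, sub_apply, add_apply, ContinuousLinearMap.comp_apply]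
  · filter_upwards [Coframe.eventually_mem_dom he] with e' he' σ hσ
    exact (hn.isBismutAt _).unique (isBismutAt_productCoframe 𝔨 𝔦 hT he')
      (fun X hX ↦ Coframe.mdifferentiableAt_applyJ (𝔣 := (productCoframe 𝔨 𝔦 hT).toCoframe)
        (productCoframe 𝔨 𝔦 hT).J_eq he' (hX.mdifferentiableAt _)) hσ

end Product

section Trace

variable {V : Type*} [NormedAddCommGroup V] [NormedSpace ℝ V] [FiniteDimensional ℝ V]
  {B : V →L[ℝ] V →L[ℝ] ℝ}

/-- The trace of an endomorphism in terms of an orthonormal family of maximal cardinality. -/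
theorem trace_eq_sum {d : ℕ} (hd : finrank ℝ V = d) {v : Fin d → V}
    (hv : ∀ i j, B (v i) (v j) = if i = j then 1 else 0) (T : V →L[ℝ] V) :
    LinearMap.trace ℝ V (T : V →ₗ[ℝ] V) = ∑ i, B (T (v i)) (v i) := by
  have hli : LinearIndependent ℝ v := by
    rw [Fintype.linearIndependent_iff]
    intro c hc i
    have h := congrArg (fun x ↦ B x (v i)) hc
    simpa [hv, sum_apply] using h
  let b := basisOfLinearIndependentOfCardEqFinrank' v hli (by simp [hd])
  have hb : ∀ i, b i = v i := fun i ↦ by simp [b]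
  have hr : ∀ x i, b.repr x i = B x (v i) := by
    intro x i
    conv_rhs => rw [← b.sum_repr x]
    simp [hb, hv, sum_apply]
  rw [LinearMap.trace_eq_matrix_trace ℝ b, Matrix.trace]
  refine Finset.sum_congr rfl fun i _ ↦ ?_
  rw [Matrix.diag_apply, LinearMap.toMatrix_apply, hr, hb]
  rfl

theorem exists_orthonormal (hs : ∀ a b, B a b = B b a) (hp : ∀ a, a ≠ 0 → 0 < B a a) {d : ℕ}
    (hd : finrank ℝ V = d) :
    ∃ v : Fin d → V, ∀ i j, B (v i) (v j) = if i = j then 1 else 0 := by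
  subst hd
  let B' : LinearMap.BilinForm ℝ V := LinearMap.mk₂ ℝ (fun a b ↦ B a b) (by simp) (by simp) (by simp)
    (by simp)
  obtain ⟨b, hb⟩ := LinearMap.BilinForm.exists_orthogonal_basis (B := B') ⟨fun a b ↦ hs a b⟩
  have hpos : ∀ i, 0 < B (b i) (b i) := fun i ↦ hp _ (b.ne_zero i)
  refine ⟨fun i ↦ (√(B (b i) (b i)))⁻¹ • b i, fun i j ↦ ?_⟩
  simp only [map_smul, _root_.smul_apply, smul_eq_mul]
  split_ifs with h
  · subst h
    have := Real.mul_self_sqrt (hpos i).le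
    have h0 : √(B (b i) (b i)) ≠ 0 := (Real.sqrt_pos.2 (hpos i)).ne'
    field_simp
    nlinarith
  · have : B (b i) (b j) = 0 := hb h
    simp [this]

end Trace

theorem Coframe.finrank_eq {E : Type*} [NormedAddCommGroup E] [NormedSpace ℝ E]
    {H : Type*} [TopologicalSpace H] {I : ModelWithCorners ℝ E H}
    {M : Type*} [TopologicalSpace M] [ChartedSpace H M]
    {F : Type*} [NormedAddCommGroup F] [NormedSpace ℝ F]
    {V : Type*} [NormedAddCommGroup V] [NormedSpace ℝ V] {𝔣 : Coframe I M F V} {e : F}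
    (he : e ∈ 𝔣.dom) : finrank ℝ V = finrank ℝ E :=
  (LinearEquiv.finrank_eq (LinearEquiv.ofLinearMap (𝔣.toModel e : TangentSpace I (𝔣.param e) →ₗ[ℝ] V)
    (𝔣.vec e : V →ₗ[ℝ] TangentSpace I (𝔣.param e)) (LinearMap.ext fun a ↦ toModel_vec he a)
    (LinearMap.ext fun u ↦ vec_toModel he u))).symm

section Curvature

variable {E : Type*} [NormedAddCommGroup E] [NormedSpace ℝ E] [FiniteDimensional ℝ E]
    {H : Type*} [TopologicalSpace H] {I : ModelWithCorners ℝ E H}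
    {M : Type*} [TopologicalSpace M] [ChartedSpace H M] [IsManifold I ∞ M]
    {F : Type*} [NormedAddCommGroup F] [NormedSpace ℝ F] [CompleteSpace F]
    {V : Type*} [NormedAddCommGroup V] [NormedSpace ℝ V]
    {S : HermitianStructure I M}

namespace KahlerCoframe

variable (𝔨 : KahlerCoframe S F V) {e : F}

theorem toModel_curvature_leviCivita [T2Space M] {nabla : AffineConnection I M}
    (hn : IsLeviCivita S.metric nabla) (he : e ∈ 𝔨.dom)
    {X Y Z : Π x : M, TangentSpace I x} (hX : IsSmoothField I X) (hY : IsSmoothField I Y)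
    (hZ : IsSmoothField I Z) :
    𝔨.toCoframe.toModel e (Bismut.curvature nabla X Y Z (𝔨.param e)) =
      𝔨.curvature e (𝔨.toCoframe.comp X e) (𝔨.toCoframe.comp Y e) (𝔨.toCoframe.comp Z e) := by
  have h := Coframe.toModel_curvature (𝔣 := 𝔨.toCoframe) he (𝔨.differentiableAt_christoffel e he)
    (nabla := nabla) ?_ hX hY (Coframe.contDiffAt_comp he le_rfl ((hZ _).of_le (natCast_le_infty 2)))
  · rw [h, 𝔨.bracket_eq_zero]
    simp [KahlerCoframe.curvature]
  · filter_upwards [Coframe.eventually_mem_dom he] with e' he' σ hσ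
    refine levi_civita_unique S.metric (.of_connection nabla _)
      (Coframe.isConnectionAt_connection he' _) (fun Y Z hY hZ u ↦ hn.1 Y Z hY hZ _ u)
      (Coframe.isMetricAt_connection he' (𝔨.differentiableAt_B e' he') 𝔨.inner_eq (𝔨.der_B e' he'))
      (fun X Y hX hY ↦ ?_) (fun X Y hX hY ↦ ?_) hσ
    · rw [torsionAt_connection nabla hX hY]
      exact hn.2 _ _ _
    · refine Coframe.toModel_injective he' ?_
      rw [Coframe.toModel_torsionAt_connection he' hX hY, 𝔨.christoffel_symm e' he',
        𝔨.bracket_eq_zero]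
      simp

omit [FiniteDimensional ℝ E] [CompleteSpace F] in
theorem der_christoffel_symm (he : e ∈ 𝔨.dom) (a b c : V) :
    𝔨.toCoframe.der 𝔨.christoffel e a b c = 𝔨.toCoframe.der 𝔨.christoffel e a c b := by
  have h := 𝔨.differentiableAt_christoffel e he
  rw [HermitianCoframe.der_apply_apply h, HermitianCoframe.der_apply_apply h,
    HermitianCoframe.der_congr he fun e he ↦ 𝔨.christoffel_symm e he b c]

omit [FiniteDimensional ℝ E] [CompleteSpace F] in
theorem der_christoffel_J (he : e ∈ 𝔨.dom) (a b c : V) :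
    𝔨.toCoframe.der 𝔨.christoffel e a b (𝔨.J c) = 𝔨.J (𝔨.toCoframe.der 𝔨.christoffel e a b c) := by
  have h := 𝔨.differentiableAt_christoffel e he
  have h1 : DifferentiableAt ℝ (fun e ↦ 𝔨.christoffel e b c) e :=
    (h.clm_apply (differentiableAt_const _)).clm_apply (differentiableAt_const _)
  rw [HermitianCoframe.der_apply_apply h, HermitianCoframe.der_apply_apply h,
    HermitianCoframe.der_congr he fun e he ↦ 𝔨.christoffel_J e he b c]
  simp only [Coframe.der, ContinuousLinearMap.comp_apply]
  have h2 : fderiv ℝ (fun e ↦ 𝔨.J (𝔨.christoffel e b c)) e =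
    𝔨.J.comp (fderiv ℝ (fun e ↦ 𝔨.christoffel e b c) e) :=
    (𝔨.J.hasFDerivAt.comp e h1.hasFDerivAt).fderiv
  rw [h2]
  rfl

omit [FiniteDimensional ℝ E] [CompleteSpace F] in
theorem curvature_apply (a b c : V) : 𝔨.curvature e a b c =
    𝔨.toCoframe.der 𝔨.christoffel e a b c - 𝔨.toCoframe.der 𝔨.christoffel e b a c
    + 𝔨.christoffel e a (𝔨.christoffel e b c) - 𝔨.christoffel e b (𝔨.christoffel e a c) := rfl

omit [FiniteDimensional ℝ E] [CompleteSpace F] in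
/-- The first Bianchi identity. -/
theorem bianchi (he : e ∈ 𝔨.dom) (a b c : V) :
    𝔨.curvature e a b c = 𝔨.curvature e c b a - 𝔨.curvature e c a b := by
  simp only [curvature_apply]
  rw [𝔨.der_christoffel_symm he a b c, 𝔨.der_christoffel_symm he b a c,
    𝔨.der_christoffel_symm he c b a, 𝔨.christoffel_symm e he c a, 𝔨.christoffel_symm e he b a,
    𝔨.christoffel_symm e he c b]
  abel

omit [FiniteDimensional ℝ E] [CompleteSpace F] in
theorem curvature_J (he : e ∈ 𝔨.dom) (a b c : V) :
    𝔨.curvature e a b (𝔨.J c) = 𝔨.J (𝔨.curvature e a b c) := by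
  simp only [curvature_apply, map_add, map_sub, 𝔨.der_christoffel_J he, 𝔨.christoffel_J e he]

/-- The endomorphism whose trace is the Ricci tensor. -/
def ricciMap (e : F) (b c : V) : V →L[ℝ] V :=
  ((𝔨.toCoframe.der 𝔨.christoffel e).flip b).flip c - (𝔨.toCoframe.der 𝔨.christoffel e b).flip c
    + (𝔨.christoffel e).flip (𝔨.christoffel e b c)
    - (𝔨.christoffel e b).comp ((𝔨.christoffel e).flip c)

omit [FiniteDimensional ℝ E] [CompleteSpace F] in
theorem ricciMap_apply (a b c : V) : 𝔨.ricciMap e b c a = 𝔨.curvature e a b c := rfl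

theorem trace_ricciMap [T2Space M] [FiniteDimensional ℝ V] (hS : IsRicciFlat S.metric)
    (he : e ∈ 𝔨.dom) (b c : V) : LinearMap.trace ℝ V (𝔨.ricciMap e b c : V →ₗ[ℝ] V) = 0 := by
  obtain ⟨nabla, hn, hr⟩ := hS
  obtain ⟨v, hv⟩ := exists_orthonormal (𝔨.B_symm he) (fun a ha ↦ 𝔨.B_pos he ha)
    (Coframe.finrank_eq (𝔣 := 𝔨.toCoframe) he)
  have hex := fun a : V ↦ exists_isSmoothField_eq (𝔨.param e) (𝔨.toCoframe.vec e a)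
  choose X hX hXa using hex
  have hcomp : ∀ a, 𝔨.toCoframe.comp (X a) e = a := fun a ↦ by
    rw [Coframe.comp, hXa, Coframe.toModel_vec he]
  have h1 := hr (𝔨.param e) (fun i ↦ X (v i)) ⟨fun i ↦ hX _, fun i j ↦ by
    rw [𝔨.inner_eq e he]
    refine Eq.trans ?_ (hv i j)
    exact congrArg₂ (fun a b ↦ 𝔨.B e a b) (hcomp _) (hcomp _)⟩ (X b) (X c) (hX b) (hX c)
  rw [trace_eq_sum (Coframe.finrank_eq (𝔣 := 𝔨.toCoframe) he) hv, ← h1]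
  refine Finset.sum_congr rfl fun i _ ↦ ?_
  rw [𝔨.inner_eq e he, 𝔨.toModel_curvature_leviCivita hn he (hX _) (hX _) (hX _), hcomp, hcomp,
    hcomp, ricciMap_apply]
  exact congrArg (𝔨.B e _) (hcomp _).symm

/-- The Ricci form of a Ricci-flat Kähler manifold vanishes. -/
theorem trace_curvature_comp_J [T2Space M] [FiniteDimensional ℝ V] (hS : IsRicciFlat S.metric)
    (he : e ∈ 𝔨.dom) (a b : V) :
    LinearMap.trace ℝ V ((𝔨.curvature e a b).comp 𝔨.J : V →L[ℝ] V) = 0 := by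
  have h : (((𝔨.curvature e a b).comp 𝔨.J : V →L[ℝ] V) : V →ₗ[ℝ] V) =
      (𝔨.ricciMap e b (𝔨.J a) : V →ₗ[ℝ] V) - (𝔨.ricciMap e a (𝔨.J b) : V →ₗ[ℝ] V) := by
    refine LinearMap.ext fun c ↦ ?_
    change 𝔨.curvature e a b (𝔨.J c) = 𝔨.curvature e c b (𝔨.J a) - 𝔨.curvature e c a (𝔨.J b)
    rw [𝔨.curvature_J he, 𝔨.curvature_J he, 𝔨.curvature_J he, ← map_sub, ← 𝔨.bianchi he]
  rw [h, map_sub, 𝔨.trace_ricciMap hS he, 𝔨.trace_ricciMap hS he, sub_zero]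

end KahlerCoframe
end Curvature

section Product

variable {E : Type*} [NormedAddCommGroup E] [NormedSpace ℝ E] [FiniteDimensional ℝ E]
    {H : Type*} [TopologicalSpace H] {I : ModelWithCorners ℝ E H}
    {M : Type*} [TopologicalSpace M] [ChartedSpace H M] [IsManifold I ∞ M]
    {E' : Type*} [NormedAddCommGroup E'] [NormedSpace ℝ E'] [FiniteDimensional ℝ E']
    {H' : Type*} [TopologicalSpace H'] {I' : ModelWithCorners ℝ E' H'}
    {M' : Type*} [TopologicalSpace M'] [ChartedSpace H' M'] [IsManifold I' ∞ M']
    {V' : Type*} [NormedAddCommGroup V'] [NormedSpace ℝ V'] [FiniteDimensional ℝ V']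
    {Q : Type*} [TopologicalSpace Q] [ChartedSpace (ModelProd H H') Q]
    [IsManifold (I.prod I') ∞ Q] [T2Space Q]
    {S : HermitianStructure I M} {S' : HermitianStructure I' M'} {p : M × M' → Q}
    {T : HermitianStructure (I.prod I') Q} {hT : IsInducedBy S S' p T}

namespace HasProductCoframes

/-- The Bismut connection of a local product exists. -/
theorem exists_isBismut (h : HasProductCoframes V' hT) :
    ∃ nabla : AffineConnection (I.prod I') Q, T.IsBismut nabla := by
  have h1 : ∀ x, ∃ D, IsBismutAt T x D := by
    intro x
    obtain ⟨m, 𝔨, 𝔦, e, he, rfl⟩ := h x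
    exact ⟨_, isBismutAt_productCoframe 𝔨 𝔦 hT he⟩
  choose D hD using h1
  obtain ⟨nabla, hn⟩ := exists_connection fun x ↦ (hD x).isConnectionAt
  refine ⟨nabla, isBismut_of_isBismutAt fun x ↦ ?_⟩
  have h2 : (fun σ ↦ nabla σ x) = D x := funext fun σ ↦ hn σ x
  rw [h2]
  exact hD x

/-- A local product of a Ricci-flat Kähler manifold and a Lie group is Calabi–Yau with torsion. -/
theorem isCYT [T2Space M] (h : HasProductCoframes V' hT) (hS : IsRicciFlat S.metric) :
    T.IsCYT := by
  obtain ⟨nabla, hn⟩ := h.exists_isBismut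
  refine ⟨nabla, hn, fun x f hf X Y hX hY ↦ ?_⟩
  obtain ⟨m, 𝔨, 𝔦, e, he, rfl⟩ := h x
  set 𝔪 := productCoframe 𝔨 𝔦 hT with h𝔪
  have hd := Coframe.finrank_eq (𝔣 := 𝔪.toCoframe) he
  set v := fun i ↦ 𝔪.toCoframe.comp (f i) e with hv
  have horth : ∀ i j, 𝔪.B e (v i) (v j) = if i = j then 1 else 0 := by
    intro i j
    rw [← hf.2 i j, 𝔪.inner_eq e he]
    rfl
  set x := (𝔪.toCoframe.comp X e).1
  set y := (𝔪.toCoframe.comp Y e).1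
  set L : (Fin m → ℂ) →L[ℝ] (Fin m → ℂ) := (𝔨.curvature e.1 x y).comp 𝔨.J with hL
  set R : (Fin m → ℂ) × V' →L[ℝ] (Fin m → ℂ) × V' :=
    (ContinuousLinearMap.inl ℝ (Fin m → ℂ) V').comp (L.comp (.fst ℝ (Fin m → ℂ) V')) with hR
  have hsum : T.ricciForm nabla f X Y (𝔪.param e) = (1 / 2) * ∑ i, 𝔪.B e (R (v i)) (v i) := by
    rw [HermitianStructure.ricciForm]
    congr 1
    refine Finset.sum_congr rfl fun i _ ↦ ?_
    have hJ : 𝔪.toCoframe.comp (T.applyJ (f i)) =ᶠ[𝓝 e] fun e ↦ 𝔪.J (𝔪.toCoframe.comp (f i) e) := by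
      filter_upwards [Coframe.eventually_mem_dom he] with e' he' using
        Coframe.comp_applyJ 𝔪.J_eq he' _
    have hc : ContDiffAt ℝ 2 (𝔪.toCoframe.comp (T.applyJ (f i))) e :=
      (𝔪.J.contDiff.contDiffAt.comp e (Coframe.contDiffAt_comp he le_rfl
        ((hf.1 i _).of_le (natCast_le_infty 2)))).congr_of_eventuallyEq hJ
    have h1 := toModel_curvature_bismut 𝔨 𝔦 hT hn he hX hY hc
    rw [𝔪.inner_eq e he, h1, hJ.self_of_nhds]
    rfl
  rw [hsum, ← trace_eq_sum hd horth R]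
  have h2 : LinearMap.trace ℝ _ (R : (Fin m → ℂ) × V' →ₗ[ℝ] (Fin m → ℂ) × V') =
      LinearMap.trace ℝ _ (L : (Fin m → ℂ) →ₗ[ℝ] (Fin m → ℂ)) := by
    have h3 := LinearMap.trace_comp_comm' (R := ℝ)
      ((L : (Fin m → ℂ) →ₗ[ℝ] (Fin m → ℂ)).comp (LinearMap.fst ℝ (Fin m → ℂ) V'))
      (LinearMap.inl ℝ (Fin m → ℂ) V')
    refine Eq.trans ?_ (h3.trans ?_)
    · rfl
    · congr 1
  rw [h2, 𝔨.trace_curvature_comp_J hS he.1, mul_zero]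

end HasProductCoframes

/-- If the Bismut connection of a local product is flat, then so is the Kähler factor. -/
theorem isFlatMetric_of_isBismutFlat [T2Space M] (hcov : ∀ x : M, ∃ (m : ℕ)
      (𝔨 : KahlerCoframe S (Fin m → ℂ) (Fin m → ℂ)), ∃ e ∈ 𝔨.dom, 𝔨.param e = x)
    (𝔦 : InvariantCoframe S' V' V') {e' : V'} (he' : e' ∈ 𝔦.dom) (hT : IsInducedBy S S' p T)
    (hS : ∃ nabla : AffineConnection I M, IsLeviCivita S.metric nabla) (hflat : T.IsBismutFlat) :
    IsFlatMetric S.metric := by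
  obtain ⟨nabla, hn⟩ := hS
  obtain ⟨nabla', hn', hf⟩ := hflat
  refine ⟨nabla, hn, fun X Y Z hX hY hZ x ↦ ?_⟩
  obtain ⟨m, 𝔨, e, he, rfl⟩ := hcov x
  refine Coframe.toModel_injective (𝔣 := 𝔨.toCoframe) he ?_
  rw [𝔨.toModel_curvature_leviCivita hn he hX hY hZ]
  generalize 𝔨.toCoframe.comp X e = a
  generalize 𝔨.toCoframe.comp Y e = b
  generalize 𝔨.toCoframe.comp Z e = c
  set 𝔪 := productCoframe 𝔨 𝔦 hT with h𝔪
  have hem : (e, e') ∈ 𝔪.dom := ⟨he, he'⟩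
  have hex := fun a : (Fin m → ℂ) × V' ↦
    exists_isSmoothField_eq (𝔪.param (e, e')) (𝔪.toCoframe.vec (e, e') a)
  choose X hX hXa using hex
  have hcomp : ∀ a, 𝔪.toCoframe.comp (X a) (e, e') = a := fun a ↦ by
    rw [Coframe.comp, hXa, Coframe.toModel_vec hem]
  have h1 := toModel_curvature_bismut 𝔨 𝔦 hT hn' hem (hX (a, 0)) (hX (b, 0))
    (Coframe.contDiffAt_comp hem le_rfl ((hX (c, 0) _).of_le (natCast_le_infty 2)))
  rw [hf _ _ _ (hX _) (hX _) (hX _)] at h1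
  rw [← h𝔪, hcomp, hcomp, hcomp] at h1
  refine ((Prod.ext_iff.1 h1).1.symm.trans ?_).trans (map_zero (𝔨.toCoframe.toModel e)).symm
  exact congrArg Prod.fst (map_zero (𝔪.toCoframe.toModel (e, e')))

end Product

section HolomorphicParam

variable {E : Type*} [NormedAddCommGroup E] [NormedSpace ℝ E]
    {H : Type*} [TopologicalSpace H] {I : ModelWithCorners ℝ E H}
    {M : Type*} [TopologicalSpace M] [ChartedSpace H M]
    {W : Type*} [NormedAddCommGroup W] [NormedSpace ℝ W] [NormedSpace ℂ W]

/-- `φ` is a holomorphic local parametrization of `(M, J)` near the point `e`. -/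
structure IsHolomorphicParam (J : Π x : M, TangentSpace I x →L[ℝ] TangentSpace I x) (φ : W → M)
    (e : W) : Prop where
  isLocalDiffeomorphAt : IsLocalDiffeomorphAt 𝓘(ℝ, W) I ∞ φ e
  mfderiv_I_smul : ∀ᶠ e' in 𝓝 e, ∀ u : W, mfderiv 𝓘(ℝ, W) I φ e' (Complex.I • u) =
    J (φ e') (mfderiv 𝓘(ℝ, W) I φ e' u)

theorem exists_isHolomorphicParam [IsManifold I ∞ M] (S : HermitianStructure I M) (x : M) :
    ∃ (m : ℕ) (φ : (Fin m → ℂ) → M) (e : Fin m → ℂ), φ e = x ∧ IsHolomorphicParam S.J φ e := by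
  obtain ⟨m, 𝔥, -, hco, hJ, -, e, he, hx⟩ := exists_hermitianCoframe S x
  refine ⟨m, 𝔥.param, e, hx, 𝔥.diffeo e he, ?_⟩
  filter_upwards [Coframe.eventually_mem_dom he] with e' he' u
  refine Coframe.toModel_injective he' ?_
  rw [𝔥.J_eq e' he', hJ]
  have h : ∀ u, 𝔥.toCoframe.toModel e' (mfderiv 𝓘(ℝ, Fin m → ℂ) I 𝔥.param e' u) = u := fun u ↦
    (Coframe.toModel_dparam he' u).trans (by rw [hco]; rfl)
  exact (h _).trans (congrArg (Complex.I • ·) (h u).symm)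

theorem IsHolomorphicParam.exists_coordinates [FiniteDimensional ℂ W] [IsScalarTower ℝ ℂ W]
    {J : Π x : M, TangentSpace I x →L[ℝ] TangentSpace I x} {φ : W → M} {e : W}
    (h : IsHolomorphicParam J φ e) : ∃ (m : ℕ) (z : M → (Fin m → ℂ)),
    IsLocalDiffeomorphAt I 𝓘(ℝ, Fin m → ℂ) ∞ z (φ e) ∧
    ∀ᶠ y in 𝓝 (φ e), ∀ u : TangentSpace I y,
      mvfderiv I z y (J y u) = Complex.I • mvfderiv I z y u := by
  have hd := h.isLocalDiffeomorphAt
  obtain ⟨A⟩ : Nonempty (W ≃L[ℂ] (Fin (finrank ℂ W) → ℂ)) :=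
    ⟨ContinuousLinearEquiv.ofFinrankEq (by simp)⟩
  let A' : W ≃L[ℝ] (Fin (finrank ℂ W) → ℂ) :=
    { toLinearEquiv := A.toLinearEquiv.restrictScalars ℝ
      continuous_toFun := A.continuous
      continuous_invFun := A.symm.continuous }
  have hA : IsLocalDiffeomorph 𝓘(ℝ, W) 𝓘(ℝ, Fin (finrank ℂ W) → ℂ) ∞ A' :=
    A'.toDiffeomorph.isLocalDiffeomorph
  refine ⟨finrank ℂ W, A' ∘ hd.localInverse, ?_, ?_⟩
  · exact hd.localInverse_isLocalDiffeomorphAt.comp _ _ (hA _)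
  rw [← IsLocalDiffeomorphAt.map_nhds_eq hd, Filter.eventually_map]
  obtain ⟨s, hso, hes, hs⟩ := exists_param hd
  let 𝔣 := Coframe.ofParam φ s hso hs
  have h1 : ∀ᶠ e' in 𝓝 e, ∀ᶠ e'' in 𝓝 e', hd.localInverse (φ e'') = e'' := by
    rw [eventually_eventually_nhds]
    filter_upwards [hd.localInverse.open_target.mem_nhds hd.localInverse_mem_target] with e' he
    exact hd.localInverse_left_inv he
  filter_upwards [h1, hso.mem_nhds hes, h.mfderiv_I_smul] with e' h1 he' h2 u
  have h3 : ∀ u, mvfderiv I (A' ∘ hd.localInverse) (φ e') u =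
      A (𝔣.toModel e' u) := by
    intro u
    refine (Coframe.mvfderiv_eq_der_of_eventuallyEq (𝔣 := 𝔣) he' (k := A') ?_
      A'.differentiableAt u).trans ?_
    · filter_upwards [h1] with e'' h
      exact congrArg A h
    · simp only [Coframe.der]
      rw [A'.fderiv]
      rfl
  have h4 : ∀ u : W, 𝔣.toModel e' (mfderiv 𝓘(ℝ, W) I φ e' u) = u := fun u ↦
    Coframe.toModel_dparam (𝔣 := 𝔣) he' u
  obtain ⟨a, rfl⟩ : ∃ a : W, mfderiv 𝓘(ℝ, W) I φ e' a = u := ⟨_, Coframe.vec_toModel (𝔣 := 𝔣) he' u⟩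
  rw [h3, h3, ← h2]
  refine (congrArg A (h4 _)).trans ?_
  rw [map_smul]
  exact congrArg (fun a ↦ Complex.I • A a) (h4 a).symm

end HolomorphicParam

section Product

variable {E : Type*} [NormedAddCommGroup E] [NormedSpace ℝ E] [FiniteDimensional ℝ E]
    {H : Type*} [TopologicalSpace H] {I : ModelWithCorners ℝ E H}
    {M : Type*} [TopologicalSpace M] [ChartedSpace H M] [IsManifold I ∞ M]
    {E' : Type*} [NormedAddCommGroup E'] [NormedSpace ℝ E'] [FiniteDimensional ℝ E']
    {H' : Type*} [TopologicalSpace H'] {I' : ModelWithCorners ℝ E' H'}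
    {M' : Type*} [TopologicalSpace M'] [ChartedSpace H' M'] [IsManifold I' ∞ M']

/-- The product of two Riemannian metrics. -/
def prodInner (g : SmoothMetric I M) (g' : SmoothMetric I' M') (x : M × M') :
    TangentSpace (I.prod I') x →L[ℝ] TangentSpace (I.prod I') x →L[ℝ] ℝ :=
  (sumBilinear (g.inner x.1 : E →L[ℝ] E →L[ℝ] ℝ) (g'.inner x.2 : E' →L[ℝ] E' →L[ℝ] ℝ) :
    E × E' →L[ℝ] E × E' →L[ℝ] ℝ)

theorem contMDiffAt_prodInner (g : SmoothMetric I M) (g' : SmoothMetric I' M')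
    {F : Type*} [NormedAddCommGroup F] [NormedSpace ℝ F] [FiniteDimensional ℝ F]
    {F' : Type*} [NormedAddCommGroup F'] [NormedSpace ℝ F'] [FiniteDimensional ℝ F']
    {φ : F → M} {φ' : F' → M'} {e : F × F'}
    (h : IsLocalDiffeomorphAt 𝓘(ℝ, F) I ∞ φ e.1) (h' : IsLocalDiffeomorphAt 𝓘(ℝ, F') I' ∞ φ' e.2) :
    ContMDiffAt (I.prod I') ((I.prod I').prod 𝓘(ℝ, (E × E') →L[ℝ] (E × E') →L[ℝ] ℝ)) ∞
      (fun b ↦ TotalSpace.mk' ((E × E') →L[ℝ] (E × E') →L[ℝ] ℝ)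
      (E := fun x : M × M' ↦ TangentSpace (I.prod I') x →L[ℝ] TangentSpace (I.prod I') x →L[ℝ] ℝ)
        b (prodInner g g' b)) (φ e.1, φ' e.2) := by
  refine contMDiffAt_form_of_pullForm (φ := fun e : F × F' ↦ (φ e.1, φ' e.2))
    (IsLocalDiffeomorphAt.prodParam h h') ?_
  have h1 : ∀ u v : F × F', ContDiffAt ℝ ∞ (fun e : F × F' ↦ pullForm φ g.inner e.1 u.1 v.1 +
      pullForm φ' g'.inner e.2 u.2 v.2) e := by
    intro u v
    have k1 : ContDiffAt ℝ ∞ (fun e : F × F' ↦ pullForm φ g.inner e.1 u.1 v.1) e :=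
      (((contDiffAt_pullForm g h).clm_apply contDiffAt_const).clm_apply contDiffAt_const).comp e
        contDiffAt_fst
    have k2 : ContDiffAt ℝ ∞ (fun e : F × F' ↦ pullForm φ' g'.inner e.2 u.2 v.2) e :=
      (((contDiffAt_pullForm g' h').clm_apply contDiffAt_const).clm_apply contDiffAt_const).comp e
        contDiffAt_snd
    exact k1.add k2
  refine contDiffAt_clm_of_apply fun u ↦ contDiffAt_clm_of_apply fun v ↦
    (h1 u v).congr_of_eventuallyEq ?_
  have k1 := (continuousAt_fst (p := e)).eventually (IsLocalDiffeomorphAt.eventually h)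
  have k2 := (continuousAt_snd (p := e)).eventually (IsLocalDiffeomorphAt.eventually h')
  filter_upwards [k1, k2] with e' k1 k2
  have k3 := mfderiv_prodParam (e := e') (k1.mdifferentiableAt (by simp))
    (k2.mdifferentiableAt (by simp))
  exact congrArg₂ (fun a b : E × E' ↦ prodInner g g' (φ e'.1, φ' e'.2) a b) (k3 u) (k3 v)

/-- The product of two Hermitian structures. -/
def HermitianStructure.prod (S : HermitianStructure I M) (S' : HermitianStructure I' M') :
    HermitianStructure (I.prod I') (M × M') where
  metric :=
    { inner := prodInner S.metric S'.metric
      symm := fun x u v ↦ congrArg₂ (· + ·) (S.metric.symm x.1 _ _) (S'.metric.symm x.2 _ _)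
      pos := fun x u hu ↦ by
        have h0 : ∀ (x : M) (u : TangentSpace I x), 0 ≤ S.metric.inner x u u := fun x u ↦ by
          by_cases h : u = 0
          · simp [h]
          · exact (S.metric.pos x u h).le
        have h0' : ∀ (x : M') (u : TangentSpace I' x), 0 ≤ S'.metric.inner x u u := fun x u ↦ by
          by_cases h : u = 0
          · simp [h]
          · exact (S'.metric.pos x u h).le
        by_cases h : (u : E × E').1 = 0
        · have h' : (u : E × E').2 ≠ 0 := fun h' ↦ hu (Prod.ext h h')
          exact add_pos_of_nonneg_of_pos (h0 x.1 _) (S'.metric.pos x.2 _ h')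
        · exact add_pos_of_pos_of_nonneg (S.metric.pos x.1 _ h) (h0' x.2 _)
      isVonNBounded := fun x ↦ by
        have h0 : ∀ (x : M) (u : TangentSpace I x), 0 ≤ S.metric.inner x u u := fun x u ↦ by
          by_cases h : u = 0
          · simp [h]
          · exact (S.metric.pos x u h).le
        have h0' : ∀ (x : M') (u : TangentSpace I' x), 0 ≤ S'.metric.inner x u u := fun x u ↦ by
          by_cases h : u = 0
          · simp [h]
          · exact (S'.metric.pos x u h).le
        have h1 : Bornology.IsVonNBounded ℝ {v : E | S.metric.inner x.1 v v < 1} :=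
          S.metric.isVonNBounded x.1
        have h2 : Bornology.IsVonNBounded ℝ {v : E' | S'.metric.inner x.2 v v < 1} :=
          S'.metric.isVonNBounded x.2
        rw [NormedSpace.isVonNBounded_iff] at h1 h2
        have h3 : Bornology.IsVonNBounded ℝ {v : E × E' | prodInner S.metric S'.metric x v v < 1} := by
          rw [NormedSpace.isVonNBounded_iff]
          refine (h1.prod h2).subset fun v hv ↦ ?_
          have hv' : S.metric.inner x.1 v.1 v.1 + S'.metric.inner x.2 v.2 v.2 < 1 := hv
          exact ⟨(le_add_of_nonneg_right (h0' x.2 v.2)).trans_lt hv',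
            (le_add_of_nonneg_left (h0 x.1 v.1)).trans_lt hv'⟩
        exact h3
      contMDiff := fun x ↦ by
        obtain ⟨m, φ, e, hx, h⟩ := exists_isHolomorphicParam S x.1
        obtain ⟨m', φ', e', hx', h'⟩ := exists_isHolomorphicParam S' x.2
        have := contMDiffAt_prodInner (e := (e, e')) S.metric S'.metric h.isLocalDiffeomorphAt
          h'.isLocalDiffeomorphAt
        rwa [hx, hx'] at this }
  J x := ((S.J x.1 : E →L[ℝ] E).prodMap (S'.J x.2 : E' →L[ℝ] E') : E × E' →L[ℝ] E × E')
  J_sq x u := Prod.ext (S.J_sq x.1 _) (S'.J_sq x.2 _)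
  compatible x u v := congrArg₂ (· + ·) (S.compatible x.1 _ _) (S'.compatible x.2 _ _)
  exists_coordinates x := by
    obtain ⟨m, φ, e, hx, h⟩ := exists_isHolomorphicParam S x.1
    obtain ⟨m', φ', e', hx', h'⟩ := exists_isHolomorphicParam S' x.2
    have h1 : IsHolomorphicParam (I := I.prod I') (M := M × M')
        (fun x ↦ ((S.J x.1 : E →L[ℝ] E).prodMap (S'.J x.2 : E' →L[ℝ] E') : E × E' →L[ℝ] E × E'))
        (fun e : (Fin m → ℂ) × (Fin m' → ℂ) ↦ (φ e.1, φ' e.2)) (e, e') := by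
      refine ⟨IsLocalDiffeomorphAt.prodParam h.isLocalDiffeomorphAt h'.isLocalDiffeomorphAt, ?_⟩
      have k1 := (continuousAt_fst (p := (e, e'))).eventually
        ((IsLocalDiffeomorphAt.eventually h.isLocalDiffeomorphAt).and h.mfderiv_I_smul)
      have k2 := (continuousAt_snd (p := (e, e'))).eventually
        ((IsLocalDiffeomorphAt.eventually h'.isLocalDiffeomorphAt).and h'.mfderiv_I_smul)
      filter_upwards [k1, k2] with f k1 k2 u
      have k3 := mfderiv_prodParam (e := f) (k1.1.mdifferentiableAt (by simp))
        (k2.1.mdifferentiableAt (by simp))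
      refine (k3 _).trans (Eq.trans ?_ (congrArg (fun u ↦ ((S.J (φ f.1) : E →L[ℝ] E).prodMap
        (S'.J (φ' f.2) : E' →L[ℝ] E') : E × E' →L[ℝ] E × E') u) (k3 u).symm))
      exact Prod.ext (k1.2 u.1) (k2.2 u.2)
    obtain ⟨d, z, hz⟩ := h1.exists_coordinates
    refine ⟨d, z, ?_⟩
    have h2 : x = (φ e, φ' e') := Prod.ext hx.symm hx'.symm
    rw [h2]
    exact hz

end Product

section Descent

variable {E : Type*} [NormedAddCommGroup E] [NormedSpace ℝ E]
    {H : Type*} [TopologicalSpace H] {I : ModelWithCorners ℝ E H}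
    {N : Type*} [TopologicalSpace N] [ChartedSpace H N] [IsManifold I ∞ N]
    {Q : Type*} [TopologicalSpace Q] [ChartedSpace H Q]
    {S : HermitianStructure I N} {p : N → Q}

/-- Any two points of a fibre are related by a deck transformation that is a holomorphic
isometry. -/
def HasIsometricDeckTransformations (S : HermitianStructure I N) (p : N → Q) : Prop :=
  ∀ x x', p x = p x' → ∃ τ ∈ S.holIsometryGroup, τ x = x' ∧ ∀ y, p (τ y) = p y

/-- The Riemannian metric induced along `p`. -/
def descInner (S : HermitianStructure I N) (hs : Function.Surjective p) (q : Q) :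
    TangentSpace I q →L[ℝ] TangentSpace I q →L[ℝ] ℝ :=
  pullBilinear (E := E) (F := E) (S.metric.inner (hs q).choose)
    (mfderiv I I p (hs q).choose : E →L[ℝ] E).inverse

/-- The complex structure induced along `p`. -/
def descJ (S : HermitianStructure I N) (hs : Function.Surjective p) (q : Q) :
    TangentSpace I q →L[ℝ] TangentSpace I q :=
  (mfderiv I I p (hs q).choose : E →L[ℝ] E).comp
    ((S.J (hs q).choose : E →L[ℝ] E).comp
      (mfderiv I I p (hs q).choose : E →L[ℝ] E).inverse)

omit [IsManifold I ∞ N] in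
theorem inverse_mfderiv_comp_deck (hp : IsLocalDiffeomorph I I ∞ p) {τ : N → N} {x x' : N}
    (hτ : MDifferentiableAt I I τ x) (hτx : τ x = x') (hpτ : ∀ y, p (τ y) = p y) (u : E) :
    (mfderiv I I p x' : E →L[ℝ] E).inverse (mfderiv I I p x u) = mfderiv I I τ x u := by
  subst hτx
  have h1 : (mfderiv I I p x : E →L[ℝ] E) = (mfderiv I I p (τ x) : E →L[ℝ] E).comp
      (mfderiv I I τ x : E →L[ℝ] E) := by
    have := mfderiv_comp x ((hp (τ x)).mdifferentiableAt (by simp)) hτ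
    rwa [show p ∘ τ = p from funext hpτ] at this
  obtain ⟨L, hL⟩ : ∃ L : E ≃L[ℝ] E, (L : E →L[ℝ] E) = mfderiv I I p (τ x) :=
    isInvertible_mfderiv_of_isLocalDiffeomorphAt (hp _)
  refine (congrArg (fun A : E →L[ℝ] E ↦ (mfderiv I I p (τ x) : E →L[ℝ] E).inverse (A u))
    h1).trans ?_
  have h2 : ∀ T : E →L[ℝ] E, T = L → ∀ v, T.inverse (T v) = v := by
    rintro T rfl v
    simp
  exact h2 _ hL.symm _

theorem descInner_apply (hp : IsLocalDiffeomorph I I ∞ p) (hs : Function.Surjective p)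
    (hd : HasIsometricDeckTransformations S p) (x : N) (u v : TangentSpace I x) :
    descInner S hs (p x) (mfderiv I I p x u) (mfderiv I I p x v) = S.metric.inner x u v := by
  obtain ⟨τ, ⟨⟨hτ, -, hg⟩, -⟩, hx, hpτ⟩ := hd x _ (hs (p x)).choose_spec.symm
  have h := inverse_mfderiv_comp_deck hp ((hτ x).mdifferentiableAt (by simp)) hx hpτ
  refine (congrArg₂ (fun a b : E ↦ S.metric.inner (hs (p x)).choose a b) (h u) (h v)).trans ?_
  rw [← hx]
  exact hg x u v

theorem descJ_apply (hp : IsLocalDiffeomorph I I ∞ p) (hs : Function.Surjective p)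
    (hd : HasIsometricDeckTransformations S p) (x : N) (u : TangentSpace I x) :
    descJ S hs (p x) (mfderiv I I p x u) = mfderiv I I p x (S.J x u) := by
  obtain ⟨τ, ⟨⟨hτ, -, -⟩, hJ⟩, hx, hpτ⟩ := hd x _ (hs (p x)).choose_spec.symm
  have h := inverse_mfderiv_comp_deck hp ((hτ x).mdifferentiableAt (by simp)) hx hpτ
  refine (congrArg (fun a : E ↦ mfderiv I I p (hs (p x)).choose (S.J (hs (p x)).choose a))
    (h u)).trans ?_
  have h1 : mfderiv I I p x = (mfderiv I I p (τ x)).comp (mfderiv I I τ x) := by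
    have := mfderiv_comp x ((hp (τ x)).mdifferentiableAt (by simp))
      ((hτ x).mdifferentiableAt (by simp))
    rwa [show p ∘ τ = p from funext hpτ] at this
  rw [← hx]
  refine (congrArg (mfderiv I I p (τ x)) (hJ x u).symm).trans ?_
  exact (congrArg (fun A : E →L[ℝ] E ↦ A (S.J x u)) h1).symm

omit [IsManifold I ∞ N] in
theorem exists_mfderiv_eq (hp : IsLocalDiffeomorph I I ∞ p) (x : N) (w : TangentSpace I (p x)) :
    ∃ u : TangentSpace I x, mfderiv I I p x u = w := by
  obtain ⟨L, hL⟩ : ∃ L : E ≃L[ℝ] E, (L : E →L[ℝ] E) = mfderiv I I p x :=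
    isInvertible_mfderiv_of_isLocalDiffeomorphAt (hp _)
  exact ⟨L.symm w, (congrArg (fun A : E →L[ℝ] E ↦ A (L.symm w)) hL).symm.trans
    (L.apply_symm_apply w)⟩

variable [IsManifold I ∞ Q] [FiniteDimensional ℝ E]

/-- The Hermitian structure induced along a surjective local diffeomorphism whose deck
transformations are holomorphic isometries. -/
def HermitianStructure.descend (S : HermitianStructure I N) (hp : IsLocalDiffeomorph I I ∞ p)
    (hs : Function.Surjective p) (hd : HasIsometricDeckTransformations S p) :
    HermitianStructure I Q where
  metric :=
    { inner := descInner S hs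
      symm := fun q w w' ↦ by
        obtain ⟨x, rfl⟩ := hs q
        obtain ⟨u, rfl⟩ := exists_mfderiv_eq hp x w
        obtain ⟨v, rfl⟩ := exists_mfderiv_eq hp x w'
        rw [descInner_apply hp hs hd, descInner_apply hp hs hd]
        exact S.metric.symm x u v
      pos := fun q w hw ↦ by
        obtain ⟨x, rfl⟩ := hs q
        obtain ⟨u, rfl⟩ := exists_mfderiv_eq hp x w
        rw [descInner_apply hp hs hd]
        exact S.metric.pos x u fun h ↦ hw (by rw [h, map_zero])
      isVonNBounded := fun q ↦ by
        obtain ⟨x, rfl⟩ := hs q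
        have h1 : Bornology.IsVonNBounded ℝ {v : E | S.metric.inner x v v < 1} :=
          S.metric.isVonNBounded x
        have h2 : Bornology.IsVonNBounded ℝ {w : E | descInner S hs (p x) w w < 1} := by
          refine (h1.image (mfderiv I I p x : E →L[ℝ] E)).subset fun w hw ↦ ?_
          obtain ⟨u, hu⟩ := exists_mfderiv_eq hp x w
          refine ⟨u, ?_, hu⟩
          have h3 := descInner_apply hp hs hd x u u
          rw [hu] at h3
          exact h3.symm.trans_lt hw
        exact h2
      contMDiff := fun q ↦ by
        obtain ⟨x, rfl⟩ := hs q
        obtain ⟨m, φ, e, rfl, h⟩ := exists_isHolomorphicParam S x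
        refine contMDiffAt_form_of_pullForm (φ := p ∘ φ)
          (h.isLocalDiffeomorphAt.comp _ _ (hp _)) ?_
        refine (contDiffAt_pullForm S.metric h.isLocalDiffeomorphAt).congr_of_eventuallyEq ?_
        filter_upwards [IsLocalDiffeomorphAt.eventually h.isLocalDiffeomorphAt] with e' h'
        have h1 : mfderiv 𝓘(ℝ, Fin m → ℂ) I (p ∘ φ) e' = _ := mfderiv_comp e'
          ((hp (φ e')).mdifferentiableAt (by simp)) (h'.mdifferentiableAt (by simp))
        ext u v
        rw [pullForm_apply, pullForm_apply, h1]
        exact descInner_apply hp hs hd (φ e') _ _ }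
  J := descJ S hs
  J_sq q w := by
    obtain ⟨x, rfl⟩ := hs q
    obtain ⟨u, rfl⟩ := exists_mfderiv_eq hp x w
    rw [descJ_apply hp hs hd, descJ_apply hp hs hd, S.J_sq, map_neg]
  compatible q w w' := by
    obtain ⟨x, rfl⟩ := hs q
    obtain ⟨u, rfl⟩ := exists_mfderiv_eq hp x w
    obtain ⟨v, rfl⟩ := exists_mfderiv_eq hp x w'
    rw [descJ_apply hp hs hd, descJ_apply hp hs hd]
    exact (descInner_apply hp hs hd x _ _).trans
      ((S.compatible x u v).trans (descInner_apply hp hs hd x u v).symm)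
  exists_coordinates q := by
    obtain ⟨x, rfl⟩ := hs q
    obtain ⟨m, φ, e, rfl, h⟩ := exists_isHolomorphicParam S x
    have h1 : IsHolomorphicParam (descJ S hs) (p ∘ φ) e := by
      refine ⟨h.isLocalDiffeomorphAt.comp _ _ (hp _), ?_⟩
      filter_upwards [IsLocalDiffeomorphAt.eventually h.isLocalDiffeomorphAt,
        h.mfderiv_I_smul] with e' h' h'' u
      have h1 : mfderiv 𝓘(ℝ, Fin m → ℂ) I (p ∘ φ) e' = _ := mfderiv_comp e'
        ((hp (φ e')).mdifferentiableAt (by simp)) (h'.mdifferentiableAt (by simp))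
      rw [h1]
      exact (congrArg (mfderiv I I p (φ e')) (h'' u)).trans
        (descJ_apply hp hs hd (φ e') _).symm
    exact h1.exists_coordinates

end Descent

section Quotient

variable {E : Type*} [NormedAddCommGroup E] [NormedSpace ℝ E] [FiniteDimensional ℝ E]
    {H : Type*} [TopologicalSpace H] {I : ModelWithCorners ℝ E H}
    {M : Type*} [TopologicalSpace M] [ChartedSpace H M] [IsManifold I ∞ M]
    {E' : Type*} [NormedAddCommGroup E'] [NormedSpace ℝ E'] [FiniteDimensional ℝ E']
    {H' : Type*} [TopologicalSpace H'] {I' : ModelWithCorners ℝ E' H'}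
    {M' : Type*} [TopologicalSpace M'] [ChartedSpace H' M'] [IsManifold I' ∞ M']
    {Q : Type*} [TopologicalSpace Q] [ChartedSpace (ModelProd H H') Q]
    [IsManifold (I.prod I') ∞ Q]

theorem isInducedBy_descend (S : HermitianStructure I M) (S' : HermitianStructure I' M')
    {p : M × M' → Q} (hp : IsLocalDiffeomorph (I.prod I') (I.prod I') ∞ p)
    (hs : Function.Surjective p) (hd : HasIsometricDeckTransformations (S.prod S') p) :
    IsInducedBy S S' p ((S.prod S').descend hp hs hd) where
  isLocalDiffeomorph := hp
  inner x y u v := descInner_apply hp hs hd (x, y) u v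
  J x y u := descJ_apply hp hs hd (x, y) u

omit [FiniteDimensional ℝ E] [FiniteDimensional ℝ E'] [IsManifold I ∞ M] [IsManifold I' ∞ M'] in
theorem mfderiv_prodCongr {f : Equiv.Perm M} {f' : Equiv.Perm M'} (hf : ContMDiff I I ∞ f)
    (hf' : ContMDiff I' I' ∞ f') (x : M × M') (u : E × E') :
    mfderiv (I.prod I') (I.prod I') (Equiv.prodCongr f f') x u =
      ((mfderiv I I f x.1 u.1, mfderiv I' I' f' x.2 u.2) : E × E') := by
  have h : mfderiv (I.prod I') (I.prod I') (Prod.map f f') x = _ :=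
    mfderiv_prodMap ((hf x.1).mdifferentiableAt (by simp)) ((hf' x.2).mdifferentiableAt (by simp))
  exact congrArg (fun A : E × E' →L[ℝ] E × E' ↦ A u) h

theorem prodCongr_mem_holIsometryGroup {S : HermitianStructure I M} {S' : HermitianStructure I' M'}
    {f : Equiv.Perm M} {f' : Equiv.Perm M'} (hf : f ∈ S.holIsometryGroup)
    (hf' : f' ∈ S'.holIsometryGroup) :
    (Equiv.prodCongr f f' : Equiv.Perm (M × M')) ∈ (S.prod S').holIsometryGroup := by
  obtain ⟨⟨h1, h2, h3⟩, h4⟩ := hf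
  obtain ⟨⟨h1', h2', h3'⟩, h4'⟩ := hf'
  refine ⟨⟨h1.prodMap h1', h2.prodMap h2', fun x u v ↦ ?_⟩, fun x u ↦ ?_⟩
  · have h5 := mfderiv_prodCongr h1 h1' x
    refine (congrArg₂ (fun a b : E × E' ↦ prodInner S.metric S'.metric (f x.1, f' x.2) a b)
      (h5 u) (h5 v)).trans ?_
    exact congrArg₂ (· + ·) (h3 x.1 _ _) (h3' x.2 _ _)
  · have h5 := mfderiv_prodCongr h1 h1' x
    refine (h5 _).trans (Eq.trans ?_ (congrArg (fun u ↦ ((S.J (f x.1) : E →L[ℝ] E).prodMap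
        (S'.J (f' x.2) : E' →L[ℝ] E') : E × E' →L[ℝ] E × E') u) (h5 u).symm))
    exact Prod.ext (h4 x.1 _) (h4' x.2 _)

end Quotient

section Quotient

variable {EK : Type*} [NormedAddCommGroup EK] [NormedSpace ℝ EK] [FiniteDimensional ℝ EK]
    {EG : Type*} [NormedAddCommGroup EG] [NormedSpace ℝ EG] [FiniteDimensional ℝ EG]
    {K : Type*} [TopologicalSpace K] [ChartedSpace EK K] [IsManifold 𝓘(ℝ, EK) ∞ K]
    {SK : HermitianStructure 𝓘(ℝ, EK) K}
    {G : Type*} [TopologicalSpace G] [ChartedSpace EG G] [IsManifold 𝓘(ℝ, EG) ∞ G]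
    {n : ℕ} {b : SmoothMetric 𝓘(ℝ, EG) G}
    {SL : HermitianStructure (modelGR EG n) (G × EuclideanSpace ℝ (Fin n))}
    (psi : IntLattice n →* SK.holIsometryGroup) (rho : IntLattice n →* isometryGroup b)

omit [FiniteDimensional ℝ EK] [FiniteDimensional ℝ EG] in
theorem continuousConstSMul_deckAction :
    letI := deckAction psi rho
    ContinuousConstSMul (IntLattice n) (K × G × EuclideanSpace ℝ (Fin n)) := by
  let _ := deckAction psi rho
  refine ⟨fun m ↦ ?_⟩
  change Continuous fun x : K × G × EuclideanSpace ℝ (Fin n) ↦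
    ((psi m : Equiv.Perm K) x.1, (rho m : Equiv.Perm G) x.2.1, x.2.2 + latticeVec m)
  have h1 : Continuous (psi m : Equiv.Perm K) := (psi m).2.1.1.continuous
  have h2 : Continuous (rho m : Equiv.Perm G) := (rho m).2.1.continuous
  fun_prop

theorem quotientMap_surjective {K G : Type*} {ΓK : Subgroup (Equiv.Perm K)}
    {ΓG : Subgroup (Equiv.Perm G)} (psi : IntLattice n →* ΓK) (rho : IntLattice n →* ΓG) :
    Function.Surjective (quotientMap psi rho) := Quotient.mk_surjective

theorem quotientMap_smul {K G : Type*} {ΓK : Subgroup (Equiv.Perm K)}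
    {ΓG : Subgroup (Equiv.Perm G)} (psi : IntLattice n →* ΓK) (rho : IntLattice n →* ΓG)
    (m : IntLattice n) (x : K × G × EuclideanSpace ℝ (Fin n)) :
    quotientMap psi rho ((psi m : Equiv.Perm K) x.1, shift rho m x.2) = quotientMap psi rho x :=
  letI := deckAction psi rho
  Quotient.sound ⟨m, rfl⟩

theorem exists_of_quotientMap_eq {K G : Type*} {ΓK : Subgroup (Equiv.Perm K)}
    {ΓG : Subgroup (Equiv.Perm G)} (psi : IntLattice n →* ΓK) (rho : IntLattice n →* ΓG)
    {x x' : K × G × EuclideanSpace ℝ (Fin n)} (h : quotientMap psi rho x = quotientMap psi rho x') :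
    ∃ m : IntLattice n, ((psi m : Equiv.Perm K) x.1, shift rho m x.2) = x' :=
  letI := deckAction psi rho
  Quotient.exact h.symm

theorem hasIsometricDeckTransformations_quotientMap
    (hrho : ∀ m : IntLattice n, shift rho m ∈ SL.holIsometryGroup) :
    HasIsometricDeckTransformations (SK.prod SL) (quotientMap psi rho) := fun x x' h ↦ by
  obtain ⟨m, hm⟩ := exists_of_quotientMap_eq psi rho h
  exact ⟨_, prodCongr_mem_holIsometryGroup (psi m).2 (hrho m), hm,
    fun y ↦ quotientMap_smul psi rho m y⟩

omit [FiniteDimensional ℝ EK] [FiniteDimensional ℝ EG] in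
theorem hasDeckTransformations_quotientMap :
    HasDeckTransformations (modelKGR EK EG n) (quotientMap psi rho) := fun x x' h ↦ by
  obtain ⟨m, hm⟩ := exists_of_quotientMap_eq psi rho h
  refine ⟨fun x ↦ ((psi m : Equiv.Perm K) x.1, shift rho m x.2), ?_, hm,
    quotientMap_smul psi rho m⟩
  have h1 : ContMDiff 𝓘(ℝ, EK) 𝓘(ℝ, EK) ∞ (psi m : Equiv.Perm K) := (psi m).2.1.1
  have h2 : ContMDiff 𝓘(ℝ, EG) 𝓘(ℝ, EG) ∞ (rho m : Equiv.Perm G) := (rho m).2.1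
  have h3 : ContMDiff 𝓘(ℝ, EuclideanSpace ℝ (Fin n)) 𝓘(ℝ, EuclideanSpace ℝ (Fin n)) ∞
      (fun t ↦ t + latticeVec m) := (contDiff_id.add contDiff_const).contMDiff
  exact h1.prodMap (h2.prodMap h3)

variable [T2Space K] [T2Space G]

theorem isLocalHomeomorph_quotientMap : IsLocalHomeomorph (quotientMap psi rho) := by
  let _ := deckAction psi rho
  have := continuousConstSMul_deckAction psi rho
  have := properlyDiscontinuousSMul_deckAction psi rho
  have := isCancelSMul_deckAction psi rho
  have : LocallyCompactSpace K := Manifold.locallyCompact_of_finiteDimensional 𝓘(ℝ, EK)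
  have : LocallyCompactSpace G := Manifold.locallyCompact_of_finiteDimensional 𝓘(ℝ, EG)
  exact (isQuotientCoveringMap_quotientMk_of_properlyDiscontinuousSMul
    (G := IntLattice n) (E := K × G × EuclideanSpace ℝ (Fin n))).isCoveringMap.isLocalHomeomorph

theorem t2Space_quotientSpace : T2Space (QuotientSpace psi rho) := by
  let _ := deckAction psi rho
  have := continuousConstSMul_deckAction psi rho
  have := properlyDiscontinuousSMul_deckAction psi rho
  have : LocallyCompactSpace K := Manifold.locallyCompact_of_finiteDimensional 𝓘(ℝ, EK)
  have : LocallyCompactSpace G := Manifold.locallyCompact_of_finiteDimensional 𝓘(ℝ, EG)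
  exact t2Space_of_properlyDiscontinuousSMul_of_t2Space
    (Γ := IntLattice n) (T := K × G × EuclideanSpace ℝ (Fin n))

omit [T2Space K] [T2Space G] in
theorem secondCountableTopology_quotientSpace [CompactSpace K] [CompactSpace G] :
    SecondCountableTopology (QuotientSpace psi rho) := by
  let _ := deckAction psi rho
  have := continuousConstSMul_deckAction psi rho
  have : SecondCountableTopology K := ChartedSpace.secondCountable_of_sigmaCompact EK K
  have : SecondCountableTopology G := ChartedSpace.secondCountable_of_sigmaCompact EG G
  exact ContinuousConstSMul.secondCountableTopology
    (Γ := IntLattice n) (T := K × G × EuclideanSpace ℝ (Fin n))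

end Quotient

end Bismut

end

theorem mainTheorem7
    {EK : Type*} [NormedAddCommGroup EK] [NormedSpace ℝ EK] [FiniteDimensional ℝ EK]
    {EG : Type*} [NormedAddCommGroup EG] [NormedSpace ℝ EG] [FiniteDimensional ℝ EG]
    -- the compact Kähler manifold `(K, g, J)`
    {K : Type*} [TopologicalSpace K] [T2Space K] [CompactSpace K]
    [ChartedSpace EK K] [IsManifold 𝓘(ℝ, EK) ∞ K]
    (SK : HermitianStructure 𝓘(ℝ, EK) K) (hK : SK.IsKahler)
    -- the Samelson space `(G × ℝⁿ, b + g_E, J_L)`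
    {G : Type*} [TopologicalSpace G] [T2Space G] [CompactSpace G] [SimplyConnectedSpace G]
    [ChartedSpace EG G] [Group G] [LieGroup 𝓘(ℝ, EG) ∞ G]
    [LieAlgebra.IsSemisimple ℝ (GroupLieAlgebra 𝓘(ℝ, EG) G)]
    {n : ℕ} (b : SmoothMetric 𝓘(ℝ, EG) G)
    (SL : HermitianStructure (modelGR EG n) (G × EuclideanSpace ℝ (Fin n)))
    (hL : IsSamelson b SL)
    (psi : IntLattice n →* SK.holIsometryGroup)
    (rho : IntLattice n →* isometryGroup b)
    (hrho : ∀ m : IntLattice n, shift rho m ∈ SL.holIsometryGroup) :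
    letI := deckAction psi rho
    -- the action is free and properly discontinuous
    (∀ (m : IntLattice n) (x : K × G × EuclideanSpace ℝ (Fin n)), m • x = x → m = 1) ∧
    ProperlyDiscontinuousSMul (IntLattice n) (K × G × EuclideanSpace ℝ (Fin n)) ∧
    -- the quotient is a smooth manifold, locally diffeomorphic to `K × G × ℝⁿ`
    T2Space (QuotientSpace psi rho) ∧ SecondCountableTopology (QuotientSpace psi rho) ∧
    ∃ (_ : ChartedSpace (ModelProd EK (ModelProd EG (EuclideanSpace ℝ (Fin n))))
        (QuotientSpace psi rho))
      (_ : IsManifold (modelKGR EK EG n) ∞ (QuotientSpace psi rho)),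
      IsLocalDiffeomorph (modelKGR EK EG n) (modelKGR EK EG n) ∞ (quotientMap psi rho) ∧
      -- it carries the induced Hermitian structure, which is SKT
      ∃ S : HermitianStructure (modelKGR EK EG n) (QuotientSpace psi rho),
        IsInduced SK SL psi rho S ∧ S.IsSKT ∧
        (IsRicciFlat SK.metric →
          S.IsCYT ∧ (¬ IsFlatMetric SK.metric → ¬ S.IsBismutFlat)) := by
  let _ := deckAction psi rho
  have hd := hasDeckTransformations_quotientMap psi rho
  have hp := isLocalHomeomorph_quotientMap psi rho
  have hs := quotientMap_surjective psi rho
  have h2 := t2Space_quotientSpace psi rho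
  refine ⟨deckAction_free psi rho, properlyDiscontinuousSMul_deckAction psi rho, h2,
    secondCountableTopology_quotientSpace psi rho, chartedSpaceOfIsLocalHomeomorph hp hs,
    isManifold_of_isLocalHomeomorph hd hp hs, isLocalDiffeomorph_of_isLocalHomeomorph hd hp hs, ?_⟩
  let _ := chartedSpaceOfIsLocalHomeomorph
    (H := ModelProd EK (ModelProd EG (EuclideanSpace ℝ (Fin n)))) hp hs
  have _ : IsManifold (modelKGR EK EG n) ∞ (QuotientSpace psi rho) :=
    isManifold_of_isLocalHomeomorph hd hp hs
  have hl : IsLocalDiffeomorph (modelKGR EK EG n) (modelKGR EK EG n) ∞ (quotientMap psi rho) :=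
    isLocalDiffeomorph_of_isLocalHomeomorph hd hp hs
  have hT := isInducedBy_descend SK SL hl hs (hasIsometricDeckTransformations_quotientMap psi rho hrho)
  set T := (SK.prod SL).descend hl hs (hasIsometricDeckTransformations_quotientMap psi rho hrho)
  have hcov : HasProductCoframes (EG × EuclideanSpace ℝ (Fin n)) hT := fun q ↦ by
    obtain ⟨⟨x, y⟩, rfl⟩ := hs q
    obtain ⟨m, 𝔨, e, he, rfl⟩ := exists_kahlerCoframe hK x
    obtain ⟨𝔦, e', he', rfl⟩ := hL.exists_invariantCoframe y
    exact ⟨m, 𝔨, 𝔦, (e, e'), ⟨he, he'⟩, rfl⟩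
  refine ⟨T, fun x y u v ↦ ⟨hT.inner x y u v, hT.J x y u⟩, hcov.isSKT, fun hric ↦
    ⟨hcov.isCYT hric, fun hflat hBflat ↦ hflat ?_⟩⟩
  obtain ⟨𝔦, e', he', -⟩ := hL.exists_invariantCoframe ((1 : G), (0 : EuclideanSpace ℝ (Fin n)))
  obtain ⟨nabla, hnabla, -⟩ := hric
  exact isFlatMetric_of_isBismutFlat (exists_kahlerCoframe hK) 𝔦 he' hT ⟨nabla, hnabla⟩ hBflat
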